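/- Let $R>0$, let $B_R$ denote the ball of radius $R$ centred at the origin of $\mathbb R^3$, and let $V\in L^\infty(\mathbb R^3,\mathbb C)$ vanish almost everywhere outside $B_R$. Then there are constants $C_0>0$ and $C>0$, depending only on $R$ and $V$, such that for every wavenumber $\kappa\ge C_0$ and every $f\in L^2(\mathbb R^3)$ vanishing almost everywhere outside $B_R$, the scattering problem $$\Delta^2u+Vu-\kappa^4u=f\quad\text{in }\mathbb R^3,$$ $$\lim_{r\to\infty}r(\partial_ru-\mathrm i\kappa u)=0,\qquad \lim_{r\to\infty}r\big(\partial_r(\Delta u)-\mathrm i\kappa\,\Delta u\big)=0,\qquad r=|x|,$$ both limits being uniform in all directions $x/|x|$, has a unique solution $u\in H^4_{\rm loc}(\mathbb R^3)$ (unique up to equality almost everywhere). Here the equation is understood in the sense of distributions, and $u$ is represented in $|x|>R$ by a $C^3$ function, so that the derivatives in the radiation conditions are classical. Moreover $u\in H^4(B_R)$ and $$\|u\|_{H^4(B_R)}\le C\,\kappa^{2}\,\|f\|_{L^2(B_R)}.$$ -/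

import Mathlib

open MeasureTheory Filter Topology Set
open scoped ContDiff ENNReal

namespace Biharmonic

/-- Three-dimensional Euclidean space. -/
abbrev E3 : Type := EuclideanSpace ℝ (Fin 3)

/-- The classical partial derivative `∂ᵢ φ`. -/
noncomputable def partialDeriv (i : Fin 3) (φ : E3 → ℂ) : E3 → ℂ :=
  fun x => fderiv ℝ φ x (EuclideanSpace.single i 1)

/-- The classical iterated partial derivative `∂^α φ` for a multi-index `α`. -/
noncomputable def multiDeriv (α : Fin 3 → ℕ) (φ : E3 → ℂ) : E3 → ℂ :=
  (partialDeriv 0)^[α 0] ((partialDeriv 1)^[α 1] ((partialDeriv 2)^[α 2] φ))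

/-- The order `|α|` of a multi-index. -/
def order (α : Fin 3 → ℕ) : ℕ := ∑ i, α i

/-- The finite set of multi-indices `α` with `|α| ≤ m`. -/
def multiIndices (m : ℕ) : Finset (Fin 3 → ℕ) :=
  (Finset.range (m + 1)).biUnion fun k => Finset.piAntidiag Finset.univ k

theorem mem_multiIndices {m : ℕ} {α : Fin 3 → ℕ} :
    α ∈ multiIndices m ↔ order α ≤ m := by
  simp [multiIndices, order]

/-- `φ` belongs to `C_c^∞(Ω)` (complex valued). -/
structure IsTestFunction (Ω : Set E3) (φ : E3 → ℂ) : Prop where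
  smooth : ContDiff ℝ ∞ φ
  compact_support : HasCompactSupport φ
  support_subset : tsupport φ ⊆ Ω

/-- `g` is the weak derivative `∂^α u` on the open set `Ω`. -/
structure HasWeakDeriv (Ω : Set E3) (α : Fin 3 → ℕ) (u g : E3 → ℂ) : Prop where
  locInt_left : LocallyIntegrableOn u Ω volume
  locInt_right : LocallyIntegrableOn g Ω volume
  integral_eq : ∀ φ : E3 → ℂ, IsTestFunction Ω φ →
    ∫ x in Ω, u x * multiDeriv α φ x = (-1) ^ order α * ∫ x in Ω, g x * φ x

/-- `u ∈ H^m(Ω)` for an open set `Ω`. -/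
def MemSobolev (m : ℕ) (Ω : Set E3) (u : E3 → ℂ) : Prop :=
  ∀ α ∈ multiIndices m, ∃ g : E3 → ℂ,
    HasWeakDeriv Ω α u g ∧ MemLp g 2 (volume.restrict Ω)

/-- The norm `(∑_{|α| ≤ m} ‖∂^α u‖²_{L²(Ω)})^{1/2}` of `H^m(Ω)`, as an extended nonnegative number.
Weak derivatives are unique up to null sets, so the infimum is the common value of the
`L²` norm over all versions of `∂^α u` (and it is `∞` if `u` has no weak derivative `∂^α u`). -/
noncomputable def sobolevNorm (m : ℕ) (Ω : Set E3) (u : E3 → ℂ) : ℝ≥0∞ :=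
  (∑ α ∈ multiIndices m,
    (⨅ g : E3 → ℂ, ⨅ _ : HasWeakDeriv Ω α u g,
      eLpNorm g 2 (volume.restrict Ω)) ^ (2 : ℝ)) ^ (1 / 2 : ℝ)

/-- `u ∈ H^m_loc(ℝ³)`. -/
def MemSobolevLoc (m : ℕ) (u : E3 → ℂ) : Prop :=
  ∀ α ∈ multiIndices m, ∃ g : E3 → ℂ, HasWeakDeriv univ α u g ∧
    ∀ ρ : ℝ, 0 < ρ → MemLp g 2 (volume.restrict (Metric.ball (0 : E3) ρ))

/-- The radial derivative `∂_r w` at `x ≠ 0`. -/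
noncomputable def radialDeriv (w : E3 → ℂ) (x : E3) : ℂ :=
  fderiv ℝ w x (‖x‖⁻¹ • x)

/-- `lim_{r → ∞} r (∂_r w - iκ w) = 0` uniformly in all directions: the limit is taken
as `|x| → ∞`, along the filter of complements of bounded sets. -/
def RadiationCondition (κ : ℝ) (w : E3 → ℂ) : Prop :=
  Tendsto (fun x : E3 => (‖x‖ : ℂ) * (radialDeriv w x - Complex.I * (κ : ℂ) * w x))
    (Bornology.cobounded E3) (𝓝 0)

/-- `u` solves the equation `Δ²u + V u - κ⁴ u = f` on `ℝ³` in the sense of distributions. For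
`u ∈ H^4_loc` this is the same as the equation holding almost everywhere. -/
def SolvesEquation (V : E3 → ℂ) (κ : ℝ) (f u : E3 → ℂ) : Prop :=
  ∀ φ : E3 → ℂ, IsTestFunction univ φ →
    ∫ x, (u x * Laplacian.laplacian (Laplacian.laplacian φ) x
      + (V x * u x - (κ : ℂ) ^ 4 * u x) * φ x) = ∫ x, f x * φ x

/-- `u` is a solution of the scattering problem for `Δ² + V` with source `f` and wavenumber `κ`,
where `V` and `f` vanish outside the ball of radius `R`. By elliptic regularity every
`H^4_loc` solution of the equation has a version that is smooth in `|x| > R`; the field `regular`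
selects such a version, so that the derivatives in the radiation conditions are classical. -/
structure IsScatteringSolution (R : ℝ) (V : E3 → ℂ) (κ : ℝ) (f u : E3 → ℂ) : Prop where
  memSobolevLoc : MemSobolevLoc 4 u
  equation : SolvesEquation V κ f u
  regular : ContDiffOn ℝ 3 u (Metric.closedBall (0 : E3) R)ᶜ
  radiation : RadiationCondition κ u
  radiation_laplacian : RadiationCondition κ (Laplacian.laplacian u)

end Biharmonic

namespace Biharmonic

open scoped Laplacian ComplexConjugate

/-! ### Partial derivatives of smooth functions -/

/-! Since `Δ² - κ⁴ = (Δ + κ²)(Δ - κ²)`, its outgoing fundamental solution is `Φ = (e^{iκr} -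
e^{-κr}) / (8πκ²r)`. A solution must have the form `u = Φ * g` with `g = f - Vu` supported in the
closed ball of radius `R`, so the scattering problem becomes a fixed-point equation for `g` in `L²`.

For arguments in that ball only the values of `Φ` at distance at most `2R` matter. Cutting `Φ` off
beyond `a = 2R` gives a compactly supported kernel `K` with `(Δ² - κ⁴)K = δ + E`, where `E` is
smooth and lives in the shell `a ≤ r ≤ a + 1`. The theorem rests on two `L¹` bounds, `‖K‖₁ ≤ C/κ²`
and `‖E‖₁ ≤ Cκ` (`exists_integral_norm_kernel_le`). By Young's inequality, `g ↦ V (K * g)` halves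
the `L²` norm once `κ` is large, so the fixed-point equation has a unique solution and `‖g‖ ≤ 2‖f‖`
(`exists_fixedPoint`, `ae_eq_of_fixedPoint`). For the `H⁴` bound, integration by parts controls all
derivatives of order at most four by `φ` and `Δ²φ` (`sqNorm_multiDeriv_le`). For test functions `φ`,
`Δ²(K * φ) = φ + E * φ + κ⁴ K * φ` has norm `O(1 + κ + κ⁴/κ²)` times that of `φ`, which is where
`κ²` comes from; density extends the bound to `L²` sources (`exists_weakDeriv_conv`).

Existence also needs the radiation conditions for `Φ * g`. They follow from the two exponential
profiles, which also span the profile of `ΔΦ` off the origin (`radiationCondition_conv_bihKernel`).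

For uniqueness, an outgoing `w` with `Δ²w = κ⁴w` must vanish (`ae_eq_zero_of_outgoing`). Testing
against `K * φ` gives `w = -E_a * w` for every truncation radius `a`; in particular `w` is smooth.
The functions `Δw ± κ²w` satisfy `Δp = cp` with `c` real, so they have no energy flux through
spheres, and the radiation condition then forces their `L²` mass on shells of fixed width to tend to
zero. The same follows for `w`. As `E_a` has `L²` norm bounded independently of `a`, letting `a → ∞`
in `w(x) = -(E_a * w)(x)` gives `w(x) = 0`. Neither Rellich's lemma nor unique continuation is
needed: large `κ` makes the perturbation by `V` a contraction. -/

theorem contDiff_partialDeriv {φ : E3 → ℂ} (hφ : ContDiff ℝ ∞ φ) (i : Fin 3) :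
    ContDiff ℝ ∞ (partialDeriv i φ) :=
  (hφ.fderiv_right (m := ∞) (by simp)).clm_apply contDiff_const

theorem hasCompactSupport_partialDeriv {φ : E3 → ℂ} (hφ : HasCompactSupport φ) (i : Fin 3) :
    HasCompactSupport (partialDeriv i φ) :=
  hφ.fderiv_apply (𝕜 := ℝ) _

theorem tsupport_partialDeriv_subset (φ : E3 → ℂ) (i : Fin 3) :
    tsupport (partialDeriv i φ) ⊆ tsupport φ :=
  tsupport_fderiv_apply_subset ℝ _

theorem IsTestFunction.partialDeriv {Ω : Set E3} {φ : E3 → ℂ} (h : IsTestFunction Ω φ)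
    (i : Fin 3) : IsTestFunction Ω (partialDeriv i φ) :=
  ⟨contDiff_partialDeriv h.smooth i, hasCompactSupport_partialDeriv h.compact_support i,
    (tsupport_partialDeriv_subset φ i).trans h.support_subset⟩

theorem isTestFunction_univ {φ : E3 → ℂ} (h : ContDiff ℝ ∞ φ) (h' : HasCompactSupport φ) :
    IsTestFunction univ φ :=
  ⟨h, h', subset_univ _⟩

theorem IsTestFunction.continuous {Ω : Set E3} {φ : E3 → ℂ} (h : IsTestFunction Ω φ) :
    Continuous φ := h.smooth.continuous

theorem IsTestFunction.integrable {Ω : Set E3} {φ : E3 → ℂ} (h : IsTestFunction Ω φ) :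
    Integrable φ := h.continuous.integrable_of_hasCompactSupport h.compact_support

theorem IsTestFunction.memLp {Ω : Set E3} {φ : E3 → ℂ} (h : IsTestFunction Ω φ) (p : ℝ≥0∞) :
    MemLp φ p := h.continuous.memLp_of_hasCompactSupport h.compact_support

theorem IsTestFunction.add {Ω : Set E3} {φ ψ : E3 → ℂ} (h : IsTestFunction Ω φ)
    (h' : IsTestFunction Ω ψ) : IsTestFunction Ω (fun x => φ x + ψ x) :=
  ⟨h.smooth.add h'.smooth, h.compact_support.add h'.compact_support,
    (tsupport_add φ ψ).trans (union_subset h.support_subset h'.support_subset)⟩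

theorem IsTestFunction.const_mul {Ω : Set E3} {φ : E3 → ℂ} (h : IsTestFunction Ω φ) (c : ℂ) :
    IsTestFunction Ω (fun x => c * φ x) :=
  ⟨contDiff_const.mul h.smooth, h.compact_support.mul_left,
    (tsupport_mul_subset_right (f := fun _ => c) (g := φ)).trans h.support_subset⟩

theorem IsTestFunction.sub {Ω : Set E3} {φ ψ : E3 → ℂ} (h : IsTestFunction Ω φ)
    (h' : IsTestFunction Ω ψ) : IsTestFunction Ω (fun x => φ x - ψ x) := by
  simpa [sub_eq_add_neg] using h.add (h'.const_mul (-1))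

theorem partialDeriv_comm {φ : E3 → ℂ} (hφ : ContDiff ℝ ∞ φ) (i j : Fin 3) :
    partialDeriv i (partialDeriv j φ) = partialDeriv j (partialDeriv i φ) := by
  ext x
  have hd : DifferentiableAt ℝ (fderiv ℝ φ) x :=
    ((hφ.fderiv_right (m := ∞) (by simp)).differentiable (by simp)) x
  have key : ∀ i j : Fin 3, partialDeriv i (partialDeriv j φ) x =
      fderiv ℝ (fderiv ℝ φ) x (EuclideanSpace.single i 1) (EuclideanSpace.single j 1) := by
    intro i j
    unfold partialDeriv
    rw [fderiv_clm_apply hd (differentiableAt_const _)]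
    simp
  rw [key, key]
  exact (hφ.contDiffAt.isSymmSndFDerivAt (by simp; exact WithTop.coe_le_coe.2 le_top)).eq _ _

theorem laplacian_apply_of_contDiffAt {φ : E3 → ℂ} {x : E3} (hφ : ContDiffAt ℝ 2 φ x) :
    Δ φ x = ∑ i, partialDeriv i (partialDeriv i φ) x := by
  rw [InnerProductSpace.laplacian_eq_iteratedFDeriv_orthonormalBasis φ
    (EuclideanSpace.basisFun (Fin 3) ℝ)]
  have hd : DifferentiableAt ℝ (fderiv ℝ φ) x :=
    (hφ.fderiv_right (m := 1) (by norm_num)).differentiableAt (by simp)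
  refine Finset.sum_congr rfl fun i _ => ?_
  unfold partialDeriv
  rw [fderiv_clm_apply hd (differentiableAt_const _), iteratedFDeriv_two_apply]
  simp

theorem laplacian_eq_sum {φ : E3 → ℂ} (hφ : ContDiff ℝ ∞ φ) :
    Δ φ = fun x => ∑ i, partialDeriv i (partialDeriv i φ) x :=
  funext fun _ => laplacian_apply_of_contDiffAt
    (hφ.contDiffAt.of_le (WithTop.coe_le_coe.2 le_top))

theorem contDiff_laplacian {φ : E3 → ℂ} (hφ : ContDiff ℝ ∞ φ) : ContDiff ℝ ∞ (Δ φ) := by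
  rw [laplacian_eq_sum hφ]
  exact ContDiff.sum fun i _ => contDiff_partialDeriv (contDiff_partialDeriv hφ i) i

theorem IsTestFunction.laplacian {Ω : Set E3} {φ : E3 → ℂ} (h : IsTestFunction Ω φ) :
    IsTestFunction Ω (Δ φ) := by
  have h2 := fun i => (h.partialDeriv i).partialDeriv i
  rw [laplacian_eq_sum h.smooth]
  simp only [Fin.sum_univ_three]
  exact ((h2 0).add (h2 1)).add (h2 2)

theorem partialDeriv_sum {φ : Fin 3 → E3 → ℂ} (hφ : ∀ j, Differentiable ℝ (φ j)) (i : Fin 3) :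
    partialDeriv i (fun x => ∑ j, φ j x) = fun x => ∑ j, partialDeriv i (φ j) x := by
  ext x
  simp only [partialDeriv]
  rw [fderiv_fun_sum fun j _ => hφ j x]
  simp

theorem partialDeriv_laplacian {φ : E3 → ℂ} (hφ : ContDiff ℝ ∞ φ) (i : Fin 3) :
    partialDeriv i (Δ φ) = Δ (partialDeriv i φ) := by
  rw [laplacian_eq_sum hφ, laplacian_eq_sum (contDiff_partialDeriv hφ i), partialDeriv_sum
    fun j => (contDiff_partialDeriv (contDiff_partialDeriv hφ j) j).differentiable (by simp)]
  ext x
  refine Finset.sum_congr rfl fun j _ => ?_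
  rw [partialDeriv_comm (contDiff_partialDeriv hφ j) i j, partialDeriv_comm hφ i j]

/-! ### Integration by parts -/

theorem integral_mul_partialDeriv {f φ : E3 → ℂ} (hf : ContDiff ℝ ∞ f)
    (hφ : IsTestFunction univ φ) (i : Fin 3) :
    ∫ x, f x * partialDeriv i φ x = -∫ x, partialDeriv i f x * φ x := by
  have hint : ∀ {a b : E3 → ℂ}, Continuous a → Continuous b → HasCompactSupport b →
      Integrable (fun x => a x * b x) := fun ha hb hb' =>
    (ha.mul hb).integrable_of_hasCompactSupport hb'.mul_left
  have h1 := hφ.partialDeriv i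
  exact integral_mul_fderiv_eq_neg_fderiv_mul_of_integrable
    (hint (contDiff_partialDeriv hf i).continuous hφ.continuous hφ.compact_support)
    (hint hf.continuous h1.continuous h1.compact_support)
    (hint hf.continuous hφ.continuous hφ.compact_support)
    (fun x _ => hf.differentiable (by simp) x) (fun x _ => hφ.smooth.differentiable (by simp) x)

theorem integrable_mul_test {Ω : Set E3} {f φ : E3 → ℂ} (hf : LocallyIntegrable f)
    (hφ : IsTestFunction Ω φ) : Integrable (fun x => f x * φ x) := by
  simpa [mul_comm] using hf.integrable_smul_right_of_hasCompactSupport hφ.continuous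
    hφ.compact_support

theorem integral_mul_laplacian {f φ : E3 → ℂ} (hf : ContDiff ℝ ∞ f)
    (hφ : IsTestFunction univ φ) :
    ∫ x, f x * Δ φ x = ∫ x, Δ f x * φ x := by
  rw [laplacian_eq_sum hf, laplacian_eq_sum hφ.smooth]
  simp only [Finset.mul_sum, Finset.sum_mul]
  rw [integral_finsetSum, integral_finsetSum]
  · refine Finset.sum_congr rfl fun i _ => ?_
    rw [integral_mul_partialDeriv hf (hφ.partialDeriv i),
      integral_mul_partialDeriv (contDiff_partialDeriv hf i) hφ, neg_neg]
  · exact fun i _ => integrable_mul_test (contDiff_partialDeriv (contDiff_partialDeriv hf i) i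
      ).continuous.locallyIntegrable hφ
  · exact fun i _ => integrable_mul_test hf.continuous.locallyIntegrable
      ((hφ.partialDeriv i).partialDeriv i)

/-! ### Multi-index derivatives as compositions of partial derivatives -/

/-- A list of directions permits induction on one derivative at a time, which the three nested
iterates of `multiDeriv` do not. -/
theorem exists_list_multiDeriv (α : Fin 3 → ℕ) :
    ∃ l : List (Fin 3), l.length = order α ∧ ∀ φ, multiDeriv α φ = l.foldr partialDeriv φ := by
  have hrep : ∀ (i : Fin 3) (n : ℕ) (φ : E3 → ℂ),
      (partialDeriv i)^[n] φ = (List.replicate n i).foldr partialDeriv φ := by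
    intro i n
    induction n with
    | zero => simp
    | succ n ih =>
      intro φ
      rw [Function.iterate_succ_apply', ih, List.replicate_succ, List.foldr_cons]
  refine ⟨List.replicate (α 0) 0 ++ List.replicate (α 1) 1 ++ List.replicate (α 2) 2, ?_, ?_⟩
  · simp [order, Fin.sum_univ_three, add_assoc]
  · intro φ
    simp [multiDeriv, hrep, List.foldr_append]

theorem contDiff_foldr {φ : E3 → ℂ} (hφ : ContDiff ℝ ∞ φ) (l : List (Fin 3)) :
    ContDiff ℝ ∞ (l.foldr partialDeriv φ) := by
  induction l with
  | nil => exact hφ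
  | cons i l ih => exact contDiff_partialDeriv ih i

theorem IsTestFunction.foldr {Ω : Set E3} {φ : E3 → ℂ} (h : IsTestFunction Ω φ)
    (l : List (Fin 3)) : IsTestFunction Ω (l.foldr Biharmonic.partialDeriv φ) := by
  induction l with
  | nil => exact h
  | cons i l ih => exact ih.partialDeriv i

theorem partialDeriv_foldr {φ : E3 → ℂ} (hφ : ContDiff ℝ ∞ φ) (i : Fin 3) (l : List (Fin 3)) :
    partialDeriv i (l.foldr partialDeriv φ) = l.foldr partialDeriv (partialDeriv i φ) := by
  induction l with
  | nil => rfl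
  | cons j l ih =>
    simp only [List.foldr_cons]
    rw [partialDeriv_comm (contDiff_foldr hφ l), ih]

theorem integral_mul_foldr {f φ : E3 → ℂ} (hf : ContDiff ℝ ∞ f) (hφ : IsTestFunction univ φ)
    (l : List (Fin 3)) :
    ∫ x, f x * l.foldr partialDeriv φ x =
      (-1) ^ l.length * ∫ x, l.foldr partialDeriv f x * φ x := by
  induction l generalizing f with
  | nil => simp
  | cons i l ih =>
    simp only [List.foldr_cons, List.length_cons]
    rw [integral_mul_partialDeriv hf (hφ.foldr l), ih (contDiff_partialDeriv hf i),
      partialDeriv_foldr hf, pow_succ]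
    ring

theorem contDiff_multiDeriv {φ : E3 → ℂ} (hφ : ContDiff ℝ ∞ φ) (α : Fin 3 → ℕ) :
    ContDiff ℝ ∞ (multiDeriv α φ) := by
  obtain ⟨l, -, hl⟩ := exists_list_multiDeriv α
  rw [hl]
  exact contDiff_foldr hφ l

theorem IsTestFunction.multiDeriv {Ω : Set E3} {φ : E3 → ℂ} (h : IsTestFunction Ω φ)
    (α : Fin 3 → ℕ) : IsTestFunction Ω (multiDeriv α φ) := by
  obtain ⟨l, -, hl⟩ := exists_list_multiDeriv α
  rw [hl]
  exact h.foldr l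

theorem integral_mul_multiDeriv {f φ : E3 → ℂ} (hf : ContDiff ℝ ∞ f)
    (hφ : IsTestFunction univ φ) (α : Fin 3 → ℕ) :
    ∫ x, f x * multiDeriv α φ x = (-1) ^ order α * ∫ x, multiDeriv α f x * φ x := by
  obtain ⟨l, hl, hl'⟩ := exists_list_multiDeriv α
  rw [hl', hl', integral_mul_foldr hf hφ, hl]

/-! ### `L²` bounds of derivatives by the bilaplacian -/

theorem partialDeriv_conj {φ : E3 → ℂ} (hφ : Differentiable ℝ φ) (i : Fin 3) :
    partialDeriv i (fun x => conj (φ x)) = fun x => conj (partialDeriv i φ x) := by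
  ext x
  have := (Complex.conjCLE.toContinuousLinearMap.hasFDerivAt.comp x (hφ x).hasFDerivAt).fderiv
  simp only [partialDeriv]
  change fderiv ℝ (Complex.conjCLE.toContinuousLinearMap ∘ φ) x _ = _
  rw [this]
  simp

theorem IsTestFunction.conj {Ω : Set E3} {φ : E3 → ℂ} (h : IsTestFunction Ω φ) :
    IsTestFunction Ω (fun x => conj (φ x)) := by
  refine ⟨Complex.conjCLE.contDiff.comp h.smooth, ?_, ?_⟩
  · exact h.compact_support.comp_left (g := fun z => (starRingEnd ℂ) z) (by simp)
  · refine Subset.trans ?_ h.support_subset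
    exact closure_mono fun x hx => by simpa using hx

theorem laplacian_conj {φ : E3 → ℂ} (hφ : ContDiff ℝ ∞ φ) :
    Δ (fun x => conj (φ x)) = fun x => conj (Δ φ x) := by
  have hc : ContDiff ℝ ∞ fun x => conj (φ x) := Complex.conjCLE.contDiff.comp hφ
  rw [laplacian_eq_sum hφ, laplacian_eq_sum hc]
  ext x
  rw [map_sum]
  refine Finset.sum_congr rfl fun i _ => ?_
  rw [partialDeriv_conj (hφ.differentiable (by simp)),
    partialDeriv_conj ((contDiff_partialDeriv hφ i).differentiable (by simp))]

/-- The squared `L²` norm. -/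
noncomputable def sqNorm (φ : E3 → ℂ) : ℝ := ∫ x, ‖φ x‖ ^ 2

theorem sqNorm_nonneg (φ : E3 → ℂ) : 0 ≤ sqNorm φ := integral_nonneg fun _ => by positivity

theorem integrable_sq {φ : E3 → ℂ} (h : IsTestFunction univ φ) :
    Integrable (fun x => ‖φ x‖ ^ 2) := (h.memLp 2).norm.integrable_sq

theorem integral_conj_mul_self (φ : E3 → ℂ) :
    ∫ x, conj (φ x) * φ x = (sqNorm φ : ℂ) := by
  rw [sqNorm, ← integral_complex_ofReal]
  congr 1 with x
  rw [mul_comm, Complex.mul_conj, Complex.normSq_eq_norm_sq]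

theorem integral_conj_partialDeriv {φ ψ : E3 → ℂ} (hφ : IsTestFunction univ φ)
    (hψ : IsTestFunction univ ψ) (i : Fin 3) :
    ∫ x, conj (partialDeriv i φ x) * partialDeriv i ψ x =
      -∫ x, conj (φ x) * partialDeriv i (partialDeriv i ψ) x := by
  rw [integral_mul_partialDeriv hφ.conj.smooth (hψ.partialDeriv i),
    partialDeriv_conj (hφ.smooth.differentiable (by simp)), neg_neg]

theorem integral_conj_laplacian {φ ψ : E3 → ℂ} (hφ : IsTestFunction univ φ)
    (hψ : IsTestFunction univ ψ) :
    ∑ i, ∫ x, conj (partialDeriv i φ x) * partialDeriv i ψ x =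
      -∫ x, conj (φ x) * Δ ψ x := by
  rw [laplacian_eq_sum hψ.smooth]
  simp only [Finset.mul_sum, integral_conj_partialDeriv hφ hψ]
  rw [integral_finsetSum, Finset.sum_neg_distrib]
  exact fun i _ => integrable_mul_test hφ.conj.continuous.locallyIntegrable
    ((hψ.partialDeriv i).partialDeriv i)

theorem norm_integral_conj_mul_le {φ ψ : E3 → ℂ} (hφ : IsTestFunction univ φ)
    (hψ : IsTestFunction univ ψ) :
    ‖∫ x, conj (φ x) * ψ x‖ ≤ sqNorm φ + sqNorm ψ := by
  rw [sqNorm, sqNorm, ← integral_add (integrable_sq hφ) (integrable_sq hψ)]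
  refine norm_integral_le_of_norm_le ((integrable_sq hφ).add (integrable_sq hψ))
    (Eventually.of_forall fun x => ?_)
  rw [norm_mul, RCLike.norm_conj]
  nlinarith [sq_nonneg (‖φ x‖ - ‖ψ x‖), sq_nonneg (‖φ x‖), sq_nonneg (‖ψ x‖)]

theorem sum_sqNorm_partialDeriv {φ : E3 → ℂ} (hφ : IsTestFunction univ φ) :
    ((∑ i, sqNorm (partialDeriv i φ) : ℝ) : ℂ) = -∫ x, conj (φ x) * Δ φ x := by
  rw [← integral_conj_laplacian hφ hφ, Complex.ofReal_sum]
  exact Finset.sum_congr rfl fun i _ => (integral_conj_mul_self _).symm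

/-- Integration by parts gives `∑ᵢ ‖∂ᵢφ‖² = -⟨φ, Δφ⟩`. -/
theorem sqNorm_partialDeriv_le {φ : E3 → ℂ} (hφ : IsTestFunction univ φ) (i : Fin 3) :
    sqNorm (partialDeriv i φ) ≤ sqNorm φ + sqNorm (Δ φ) := by
  refine (Finset.single_le_sum (f := fun i => sqNorm (partialDeriv i φ))
    (fun i _ => sqNorm_nonneg _) (Finset.mem_univ i)).trans ?_
  refine le_trans ?_ (norm_integral_conj_mul_le hφ hφ.laplacian)
  rw [← norm_neg, ← sum_sqNorm_partialDeriv hφ, Complex.norm_real]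
  exact Real.le_norm_self _

/-- Integrating by parts and commuting `Δ` with `∂ⱼ` gives the identity `∑ᵢⱼ ‖∂ᵢ∂ⱼφ‖² = ‖Δφ‖²`, of
which a single summand is kept. -/
theorem sqNorm_partialDeriv_partialDeriv_le {φ : E3 → ℂ} (hφ : IsTestFunction univ φ)
    (i j : Fin 3) : sqNorm (partialDeriv i (partialDeriv j φ)) ≤ sqNorm (Δ φ) := by
  have h1 : ((∑ j, ∑ i, sqNorm (partialDeriv i (partialDeriv j φ)) : ℝ) : ℂ) =
      ((sqNorm (Δ φ) : ℝ) : ℂ) := by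
    have h2 : ∀ j, ((∑ i, sqNorm (partialDeriv i (partialDeriv j φ)) : ℝ) : ℂ) =
        -∫ x, conj (partialDeriv j φ x) * partialDeriv j (Δ φ) x := fun j => by
      rw [sum_sqNorm_partialDeriv (hφ.partialDeriv j), partialDeriv_laplacian hφ.smooth]
    rw [Complex.ofReal_sum]
    simp only [h2]
    rw [Finset.sum_neg_distrib, integral_conj_laplacian hφ hφ.laplacian, neg_neg,
      ← integral_conj_mul_self]
    rw [integral_mul_laplacian hφ.conj.smooth hφ.laplacian, laplacian_conj hφ.smooth]
  rw [← Complex.ofReal_inj.1 h1]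
  refine le_trans ?_ (Finset.single_le_sum (f := fun j => ∑ i,
    sqNorm (partialDeriv i (partialDeriv j φ)))
    (fun i _ => Finset.sum_nonneg fun _ _ => sqNorm_nonneg _) (Finset.mem_univ j))
  exact Finset.single_le_sum (f := fun i => sqNorm (partialDeriv i (partialDeriv j φ)))
    (fun i _ => sqNorm_nonneg _) (Finset.mem_univ i)

theorem sqNorm_laplacian_le {φ : E3 → ℂ} (hφ : IsTestFunction univ φ) :
    sqNorm (Δ φ) ≤ sqNorm φ + sqNorm (Δ (Δ φ)) := by
  have h := norm_integral_conj_mul_le hφ hφ.laplacian.laplacian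
  have h2 : ∫ x, conj (φ x) * Δ (Δ φ) x = (sqNorm (Δ φ) : ℂ) := by
    rw [integral_mul_laplacian hφ.conj.smooth hφ.laplacian, laplacian_conj hφ.smooth,
      integral_conj_mul_self]
  rw [h2, Complex.norm_real] at h
  exact (Real.le_norm_self _).trans h

/-- Elliptic regularity by hand: orders one and two are the preceding bounds, and orders three and
four apply them to derivatives of `φ`, with `Δ` commuted through so that it falls on `φ`. The
intermediate `‖Δφ‖² = ⟨φ, Δ²φ⟩` is absorbed by `sqNorm_laplacian_le`. -/
theorem sqNorm_multiDeriv_le {φ : E3 → ℂ} (hφ : IsTestFunction univ φ) {α : Fin 3 → ℕ}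
    (hα : α ∈ multiIndices 4) :
    sqNorm (multiDeriv α φ) ≤ 2 * (sqNorm φ + sqNorm (Δ (Δ φ))) := by
  obtain ⟨l, hl, hl'⟩ := exists_list_multiDeriv α
  rw [mem_multiIndices, ← hl] at hα
  rw [hl']
  have n0 := sqNorm_nonneg φ
  have n4 := sqNorm_nonneg (Δ (Δ φ))
  have n2 := sqNorm_laplacian_le hφ
  have comm2 : ∀ i j, Δ (partialDeriv i (partialDeriv j φ)) =
      partialDeriv i (partialDeriv j (Δ φ)) := fun i j => by
    rw [partialDeriv_laplacian hφ.smooth,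
      partialDeriv_laplacian (contDiff_partialDeriv hφ.smooth j)]
  match l, hα with
  | [], _ => simp only [List.foldr_nil]; linarith
  | [i], _ => simp only [List.foldr_cons, List.foldr_nil]; linarith [sqNorm_partialDeriv_le hφ i]
  | [i, j], _ =>
    simp only [List.foldr_cons, List.foldr_nil]
    linarith [sqNorm_partialDeriv_partialDeriv_le hφ i j]
  | [i, j, k], _ =>
    simp only [List.foldr_cons, List.foldr_nil]
    have h1 := sqNorm_partialDeriv_le ((hφ.partialDeriv k).partialDeriv j) i
    rw [comm2] at h1
    linarith [sqNorm_partialDeriv_partialDeriv_le hφ j k,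
      sqNorm_partialDeriv_partialDeriv_le hφ.laplacian j k]
  | [i, j, k, m], _ =>
    simp only [List.foldr_cons, List.foldr_nil]
    have h1 := sqNorm_partialDeriv_partialDeriv_le ((hφ.partialDeriv m).partialDeriv k) i j
    rw [comm2] at h1
    linarith [sqNorm_partialDeriv_partialDeriv_le hφ.laplacian k m]
  | _ :: _ :: _ :: _ :: _ :: _, h => simp only [List.length_cons] at h; omega

/-! ### Functions of the form `h(|x|) / |x|` -/

/-- The function `x ↦ h(|x|) / |x|`. -/
noncomputable def radial (h : ℝ → ℂ) (x : E3) : ℂ := ((‖x‖⁻¹ : ℝ) : ℂ) * h ‖x‖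

theorem norm_radial (h : ℝ → ℂ) (x : E3) : ‖radial h x‖ = ‖x‖⁻¹ * ‖h ‖x‖‖ := by
  simp [radial]

theorem radial_neg (h : ℝ → ℂ) (x : E3) : radial h (-x) = radial h x := by
  simp [radial]

theorem measurable_radial {h : ℝ → ℂ} (hh : Continuous h) : Measurable (radial h) :=
  (Complex.measurable_ofReal.comp measurable_norm.inv).mul (hh.measurable.comp measurable_norm)

theorem hasFDerivAt_comp_norm {F : ℝ → ℂ} {F' : ℂ} {x : E3} (hx : x ≠ 0)
    (hF : HasDerivAt F F' ‖x‖) :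
    HasFDerivAt (fun y : E3 => F ‖y‖)
      (((‖x‖⁻¹ • innerSL ℝ x : E3 →L[ℝ] ℝ)).smulRight F') x := by
  have h1 : HasFDerivAt (fun y : E3 => ‖y‖) (‖x‖⁻¹ • innerSL ℝ x : E3 →L[ℝ] ℝ) x := by
    have h2 := ((hasFDerivAt_id x).norm_sq).sqrt (by simpa using hx)
    have h3 : (fun y : E3 => √(‖id y‖ ^ 2)) = fun y => ‖y‖ := by
      ext y; simp
    rw [h3] at h2
    refine h2.congr_fderiv ?_
    ext v
    simp
    field_simp
  have h4 := hF.hasFDerivAt.comp x h1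
  refine h4.congr_fderiv ?_
  ext v
  simp [mul_assoc]

theorem real_inner_single (x : E3) (i : Fin 3) :
    inner ℝ x (EuclideanSpace.single i (1 : ℝ)) = x i := by
  simp [EuclideanSpace.inner_single_right]

theorem partialDeriv_comp_norm {F : ℝ → ℂ} {F' : ℂ} {x : E3} (hx : x ≠ 0)
    (hF : HasDerivAt F F' ‖x‖) (i : Fin 3) :
    partialDeriv i (fun y : E3 => F ‖y‖) x = ((x i : ℝ) : ℂ) * ((‖x‖ : ℂ)⁻¹ * F') := by
  unfold partialDeriv
  rw [(hasFDerivAt_comp_norm hx hF).fderiv]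
  simp [real_inner_single]
  ring

theorem contDiffAt_radial {h : ℝ → ℂ} (hh : ContDiff ℝ ∞ h) {x : E3} (hx : x ≠ 0) :
    ContDiffAt ℝ ∞ (radial h) x := by
  have hn : ContDiffAt ℝ ∞ (fun y : E3 => ‖y‖) x := contDiffAt_norm ℝ hx
  exact (Complex.ofRealCLM.contDiff.contDiffAt.comp x (hn.inv (by simpa using hx))).mul
    (hh.contDiffAt.comp x hn)

theorem radial_eventuallyEq_zero {h : ℝ → ℂ} {δ : ℝ} (hδ : 0 < δ) (h0 : ∀ r < δ, h r = 0) :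
    radial h =ᶠ[𝓝 0] 0 := by
  filter_upwards [Metric.ball_mem_nhds (0 : E3) hδ] with x hx
  rw [mem_ball_zero_iff] at hx
  simp [radial, h0 _ hx]

theorem contDiff_radial {h : ℝ → ℂ} (hh : ContDiff ℝ ∞ h) {δ : ℝ} (hδ : 0 < δ)
    (h0 : ∀ r < δ, h r = 0) : ContDiff ℝ ∞ (radial h) := by
  rw [contDiff_iff_contDiffAt]
  intro x
  by_cases hx : x = 0
  · subst hx
    exact contDiffAt_const.congr_of_eventuallyEq (radial_eventuallyEq_zero hδ h0)
  · exact contDiffAt_radial hh hx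

theorem contDiff_deriv {h : ℝ → ℂ} (hh : ContDiff ℝ ∞ h) : ContDiff ℝ ∞ (deriv h) :=
  (contDiff_infty_iff_deriv.1 hh).2

theorem hasDerivAt_of_contDiff {h : ℝ → ℂ} (hh : ContDiff ℝ ∞ h) (r : ℝ) :
    HasDerivAt h (deriv h r) r := (hh.differentiable (by simp) r).hasDerivAt

theorem partialDeriv_radial {h : ℝ → ℂ} (hh : ContDiff ℝ ∞ h) {x : E3} (hx : x ≠ 0) (i : Fin 3) :
    partialDeriv i (radial h) x = ((x i : ℝ) : ℂ) *
      (deriv h ‖x‖ * ((‖x‖ : ℂ) ^ 2)⁻¹ - h ‖x‖ * ((‖x‖ : ℂ) ^ 3)⁻¹) := by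
  have hr : (‖x‖ : ℂ) ≠ 0 := by simpa using hx
  have hcast : HasDerivAt (fun r : ℝ => (r : ℂ)) 1 ‖x‖ := Complex.ofRealCLM.hasDerivAt
  have h1 : HasDerivAt (fun r : ℝ => ((r⁻¹ : ℝ) : ℂ) * h r)
      ((-1) / (‖x‖ : ℂ) ^ 2 * h ‖x‖ + (‖x‖ : ℂ)⁻¹ * deriv h ‖x‖) ‖x‖ := by
    have := (hcast.fun_inv hr).fun_mul (hasDerivAt_of_contDiff hh ‖x‖)
    simp only [Complex.ofReal_inv]
    exact this
  have h2 := partialDeriv_comp_norm hx h1 i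
  change partialDeriv i (fun y : E3 => ((‖y‖⁻¹ : ℝ) : ℂ) * h ‖y‖) x = _
  rw [h2]
  field_simp
  ring

theorem sum_sq_ofReal (x : E3) : ∑ i, ((x i : ℝ) : ℂ) ^ 2 = (‖x‖ : ℂ) ^ 2 := by
  rw [← Complex.ofReal_pow, EuclideanSpace.real_norm_sq_eq]
  push_cast
  rfl

/-- In dimension three the radial Laplacian is `r⁻¹ ∂_r² r`, so dividing the profile by `r` turns
`Δ` into a plain second derivative. -/
theorem laplacian_radial_of_ne {h : ℝ → ℂ} (hh : ContDiff ℝ ∞ h) {x : E3} (hx : x ≠ 0) :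
    Δ (radial h) x = radial (deriv (deriv h)) x := by
  have hr : (‖x‖ : ℂ) ≠ 0 := by simpa using hx
  rw [laplacian_apply_of_contDiffAt ((contDiffAt_radial hh hx).of_le (WithTop.coe_le_coe.2 le_top))]
  set F1 : ℝ → ℂ := fun r => deriv h r * ((r : ℂ) ^ 2)⁻¹ - h r * ((r : ℂ) ^ 3)⁻¹ with hF1
  have hcast : HasDerivAt (fun r : ℝ => (r : ℂ)) 1 ‖x‖ := Complex.ofRealCLM.hasDerivAt
  have hF : HasDerivAt F1 (deriv (deriv h) ‖x‖ * ((‖x‖ : ℂ) ^ 2)⁻¹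
      - 3 * deriv h ‖x‖ * ((‖x‖ : ℂ) ^ 3)⁻¹ + 3 * h ‖x‖ * ((‖x‖ : ℂ) ^ 4)⁻¹) ‖x‖ := by
    have d2 := (hcast.fun_pow 2).fun_inv (pow_ne_zero 2 hr)
    have d3 := (hcast.fun_pow 3).fun_inv (pow_ne_zero 3 hr)
    have := ((hasDerivAt_of_contDiff (contDiff_deriv hh) ‖x‖).mul d2).sub
      ((hasDerivAt_of_contDiff hh ‖x‖).mul d3)
    refine this.congr_deriv ?_
    field_simp
    ring
  have key : ∀ i, partialDeriv i (partialDeriv i (radial h)) x =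
      F1 ‖x‖ + ((x i : ℝ) : ℂ) ^ 2 * ((‖x‖ : ℂ)⁻¹ * (deriv (deriv h) ‖x‖ * ((‖x‖ : ℂ) ^ 2)⁻¹
      - 3 * deriv h ‖x‖ * ((‖x‖ : ℂ) ^ 3)⁻¹ + 3 * h ‖x‖ * ((‖x‖ : ℂ) ^ 4)⁻¹)) := by
    intro i
    have hev : partialDeriv i (radial h) =ᶠ[𝓝 x] fun y => ((y i : ℝ) : ℂ) * F1 ‖y‖ := by
      filter_upwards [isOpen_compl_singleton.mem_nhds hx] with y hy
      exact partialDeriv_radial hh hy i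
    have hco : HasFDerivAt (fun y : E3 => ((y i : ℝ) : ℂ))
        (Complex.ofRealCLM ∘L (EuclideanSpace.proj i : E3 →L[ℝ] ℝ)) x :=
      (Complex.ofRealCLM ∘L (EuclideanSpace.proj i : E3 →L[ℝ] ℝ)).hasFDerivAt
    have hp := hco.fun_mul (hasFDerivAt_comp_norm hx hF)
    change fderiv ℝ (partialDeriv i (radial h)) x _ = _
    rw [hev.fderiv_eq, hp.fderiv]
    simp [real_inner_single]
    ring
  simp only [key]
  rw [Finset.sum_add_distrib, ← Finset.sum_mul, sum_sq_ofReal]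
  simp only [hF1, radial, Finset.sum_const, Finset.card_univ, Fintype.card_fin, nsmul_eq_mul]
  push_cast
  field_simp
  ring

theorem laplacian_radial {h : ℝ → ℂ} (hh : ContDiff ℝ ∞ h) {δ : ℝ} (hδ : 0 < δ)
    (h0 : ∀ r < δ, h r = 0) : Δ (radial h) = radial (deriv (deriv h)) := by
  ext x
  by_cases hx : x = 0
  · subst hx
    rw [(InnerProductSpace.laplacian_congr_nhds (radial_eventuallyEq_zero hδ h0)).self_of_nhds]
    have : (0 : E3 → ℂ) = fun _ => 0 := rfl
    rw [this, InnerProductSpace.laplacian_const]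
    simp [radial]
  · exact laplacian_radial_of_ne hh hx

/-! ### Integrals of radial functions -/

theorem measureReal_ball_one : (volume : Measure E3).real (Metric.ball 0 1) = 4 * Real.pi / 3 := by
  rw [Measure.real, EuclideanSpace.volume_ball_fin_three]
  rw [ENNReal.ofReal_one, one_pow, one_mul, ENNReal.toReal_ofReal (by positivity)]
  ring

theorem integral_comp_norm {F : Type*} [NormedAddCommGroup F] [NormedSpace ℝ F] (f : ℝ → F) :
    ∫ x : E3, f ‖x‖ = (4 * Real.pi) • ∫ r in Ioi (0 : ℝ), r ^ 2 • f r := by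
  rw [integral_fun_norm_addHaar, measureReal_ball_one, finrank_euclideanSpace_fin,
    ← Nat.cast_smul_eq_nsmul ℝ, smul_smul]
  congr 1
  push_cast
  ring

theorem integrable_comp_norm {F : Type*} [NormedAddCommGroup F] [NormedSpace ℝ F] {f : ℝ → F} :
    Integrable (fun x : E3 => f ‖x‖) ↔ IntegrableOn (fun r => r ^ 2 • f r) (Ioi 0) := by
  rw [integrable_fun_norm_addHaar, finrank_euclideanSpace_fin]

theorem integrableOn_norm_inv_sq (b : ℝ) :
    IntegrableOn (fun x : E3 => (‖x‖⁻¹) ^ 2) (Metric.ball 0 b) := by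
  rw [integrableOn_fun_norm_addHaar volume (f := fun r => (r⁻¹) ^ 2), finrank_euclideanSpace_fin]
  refine (integrableOn_const (C := (1 : ℝ)) (by simp)).congr_fun (fun r hr => ?_) measurableSet_Ioo
  have : r ≠ 0 := hr.1.ne'
  simp
  field_simp

theorem integrableOn_norm_inv (b : ℝ) :
    IntegrableOn (fun x : E3 => ‖x‖⁻¹) (Metric.ball 0 b) := by
  refine Integrable.mono' ((integrableOn_norm_inv_sq b).add (integrableOn_const (C := (1 : ℝ))
    measure_ball_lt_top.ne)) measurable_norm.inv.aestronglyMeasurable (Eventually.of_forall fun x => ?_)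
  simp only [norm_inv, norm_norm, Pi.add_apply]
  nlinarith [sq_nonneg (‖x‖⁻¹ - 1)]

theorem locallyIntegrable_radial {h : ℝ → ℂ} (hh : Continuous h) :
    LocallyIntegrable (radial h) := by
  rw [locallyIntegrable_iff]
  intro k hk
  obtain ⟨b, hb⟩ := hk.isBounded.subset_ball (0 : E3)
  obtain ⟨C, hC⟩ := (isCompact_Icc (a := 0) (b := b)).exists_bound_of_continuousOn hh.continuousOn
  refine IntegrableOn.mono_set ?_ hb
  refine Integrable.mono' ((integrableOn_norm_inv b).mul_const C)
    (measurable_radial hh).aestronglyMeasurable ?_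
  filter_upwards [ae_restrict_mem measurableSet_ball] with x hx
  rw [norm_radial]
  rw [mem_ball_zero_iff] at hx
  gcongr
  exact hC _ ⟨norm_nonneg _, hx.le⟩

/-- The Jacobian `r²` cancels `r⁻²`, so the value depends only on the width of the shell and not on
its radius. This makes the later estimates uniform as the shell moves to infinity. -/
theorem integral_shell_norm_inv_sq {a b : ℝ} (ha : 0 < a) (hab : a ≤ b) :
    Integrable (fun x : E3 => (Icc a b).indicator (fun r => (r⁻¹) ^ 2) ‖x‖) ∧
    ∫ x : E3, (Icc a b).indicator (fun r => (r⁻¹) ^ 2) ‖x‖ = 4 * Real.pi * (b - a) := by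
  have h1 : EqOn (fun r : ℝ => r ^ 2 • (Icc a b).indicator (fun r => (r⁻¹) ^ 2) r)
      ((Icc a b).indicator fun _ => (1 : ℝ)) (Ioi 0) := by
    intro r hr
    have : r ≠ 0 := (mem_Ioi.1 hr).ne'
    by_cases hr' : r ∈ Icc a b
    · simp only [indicator_of_mem hr', smul_eq_mul]
      field_simp
    · simp [indicator_of_notMem hr']
  have hsub : Ioi 0 ∩ Icc a b = Icc a b := inter_eq_right.2 fun r hr => ha.trans_le hr.1
  constructor
  · rw [integrable_comp_norm, integrableOn_congr_fun h1 measurableSet_Ioi]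
    exact ((integrable_indicator_iff measurableSet_Icc).2
      (integrableOn_const (by simp))).integrableOn
  · rw [integral_comp_norm, setIntegral_congr_fun measurableSet_Ioi h1,
      setIntegral_indicator measurableSet_Icc, hsub]
    simp [hab]

/-! ### A smooth step -/

/-- A smooth function equal to `0` for `s ≤ 0` and to `1` for `s ≥ 1`. -/
noncomputable def step (s : ℝ) : ℂ := (Real.smoothTransition s : ℂ)

theorem contDiff_step : ContDiff ℝ ∞ step :=
  Complex.ofRealCLM.contDiff.comp Real.smoothTransition.contDiff

theorem step_of_nonpos {s : ℝ} (hs : s ≤ 0) : step s = 0 := by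
  simp [step, Real.smoothTransition.zero_of_nonpos hs]

theorem step_of_one_le {s : ℝ} (hs : 1 ≤ s) : step s = 1 := by
  simp [step, Real.smoothTransition.one_of_one_le hs]

theorem norm_step_le (s : ℝ) : ‖step s‖ ≤ 1 := by
  rw [step, Complex.norm_real, Real.norm_of_nonneg (Real.smoothTransition.nonneg s)]
  exact Real.smoothTransition.le_one s

theorem contDiff_iteratedDeriv {h : ℝ → ℂ} (hh : ContDiff ℝ ∞ h) (n : ℕ) :
    ContDiff ℝ ∞ (iteratedDeriv n h) := by
  induction n with
  | zero => simpa using hh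
  | succ n ih => rw [iteratedDeriv_succ]; exact contDiff_deriv ih

theorem iteratedDeriv_step_eq_zero {n : ℕ} (hn : n ≠ 0) {s : ℝ} (hs : s ∉ Icc (0 : ℝ) 1) :
    iteratedDeriv n step s = 0 := by
  have : ∃ c : ℂ, step =ᶠ[𝓝 s] fun _ => c := by
    rw [mem_Icc, not_and_or, not_le, not_le] at hs
    rcases hs with hs | hs
    · exact ⟨0, by filter_upwards [gt_mem_nhds hs] with t ht using step_of_nonpos ht.le⟩
    · exact ⟨1, by filter_upwards [lt_mem_nhds hs] with t ht using step_of_one_le ht.le⟩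
  obtain ⟨c, hc⟩ := this
  rw [hc.iteratedDeriv_eq, iteratedDeriv_const, if_neg hn]

theorem exists_bound_iteratedDeriv_step :
    ∃ C : ℝ, 1 ≤ C ∧ ∀ n ≤ 4, ∀ s, ‖iteratedDeriv n step s‖ ≤ C := by
  have h1 : ∀ n, ∃ C : ℝ, ∀ s, ‖iteratedDeriv n step s‖ ≤ C := by
    intro n
    rcases eq_or_ne n 0 with rfl | hn
    · exact ⟨1, by simpa using norm_step_le⟩
    · exact (HasCompactSupport.intro isCompact_Icc
        fun s hs => iteratedDeriv_step_eq_zero hn hs).exists_bound_of_continuous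
        (contDiff_iteratedDeriv contDiff_step n).continuous
  choose C hC using h1
  refine ⟨1 + ∑ n ∈ Finset.range 5, |C n|, ?_, fun n hn s => (hC n s).trans ?_⟩
  · linarith [Finset.sum_nonneg fun n (_ : n ∈ Finset.range 5) => abs_nonneg (C n)]
  · have := Finset.single_le_sum (fun n (_ : n ∈ Finset.range 5) => abs_nonneg (C n))
      (Finset.mem_range.2 (by omega : n < 5))
    linarith [le_abs_self (C n)]

/-! ### The distributional Laplacian of `h(|x|) / |x|` -/

theorem step_smul_eventually (r : ℝ) (hr : 0 < r) :
    ∀ᶠ n : ℕ in atTop, step (((n : ℝ) + 1) * r - 1) = 1 := by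
  obtain ⟨N, hN⟩ := exists_nat_gt (2 / r)
  filter_upwards [eventually_ge_atTop N] with n hn
  apply step_of_one_le
  have : (N : ℝ) ≤ n := by exact_mod_cast hn
  rw [div_lt_iff₀ hr] at hN
  nlinarith

theorem tendsto_integral_radial_step {m : ℝ → ℂ} (hm : Continuous m) {φ : E3 → ℂ}
    (hφ : IsTestFunction univ φ) :
    Tendsto (fun n : ℕ => ∫ x, radial (fun r => step (((n : ℝ) + 1) * r - 1) * m r) x * φ x) atTop
      (𝓝 (∫ x, radial m x * φ x)) := by
  refine tendsto_integral_of_dominated_convergence (fun x => ‖radial m x * φ x‖) (fun n => ?_)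
    (integrable_mul_test (locallyIntegrable_radial hm) hφ).norm (fun n => ?_) ?_
  · refine ((measurable_radial ?_).mul hφ.continuous.measurable).aestronglyMeasurable
    exact (contDiff_step.continuous.comp (by fun_prop)).mul hm
  · refine Eventually.of_forall fun x => ?_
    rw [norm_mul, norm_mul, norm_radial, norm_radial, norm_mul]
    gcongr
    exact mul_le_of_le_one_left (norm_nonneg _) (norm_step_le _)
  · refine Eventually.of_forall fun x => ?_
    refine tendsto_const_nhds.congr' ?_
    by_cases hx : x = 0
    · subst hx
      exact Eventually.of_forall fun n => by simp [radial]
    · filter_upwards [step_smul_eventually ‖x‖ (norm_pos_iff.2 hx)] with n hn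
      simp [radial, hn]

/-- In polar coordinates this is `4π ∫ s step''(s - 1) ds`, whose primitive `s step'(s - 1) - step(s
- 1)` runs from `0` to `-1`. It is the source of the weight `-4π` of the point mass. -/
theorem integral_radial_deriv_deriv_step :
    ∫ x, radial (fun s => deriv (deriv step) (s - 1)) x = -(4 * Real.pi) := by
  have h0 : ∀ s ∉ Icc (1 : ℝ) 2, deriv (deriv step) (s - 1) = 0 := fun s hs => by
    have := iteratedDeriv_step_eq_zero (n := 2) two_ne_zero (s := s - 1)
      (fun h => hs ⟨by linarith [h.1], by linarith [h.2]⟩)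
    simpa [iteratedDeriv_succ] using this
  have hc : Continuous fun s : ℝ => deriv (deriv step) (s - 1) :=
    (contDiff_deriv (contDiff_deriv contDiff_step)).continuous.comp (by fun_prop)
  have h1 : EqOn (fun s : ℝ => s ^ 2 • (((s⁻¹ : ℝ) : ℂ) * deriv (deriv step) (s - 1)))
      (fun s => (s : ℂ) * deriv (deriv step) (s - 1)) (Ioi 0) := by
    intro s hs
    have : (s : ℂ) ≠ 0 := by exact_mod_cast (mem_Ioi.1 hs).ne'
    simp only [Complex.real_smul]
    push_cast
    field_simp
  have h2 := integral_comp_norm fun s : ℝ => (((s⁻¹ : ℝ) : ℂ) * deriv (deriv step) (s - 1))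
  change ∫ x : E3, (((‖x‖⁻¹ : ℝ) : ℂ) * deriv (deriv step) (‖x‖ - 1)) = _
  rw [h2, setIntegral_congr_fun measurableSet_Ioi h1]
  have h3 : ∫ s in Ioi (0 : ℝ), (s : ℂ) * deriv (deriv step) (s - 1) = (-1) - 0 := by
    have hval : (fun s : ℝ => (s : ℂ) * deriv step (s - 1) - step (s - 1)) 0 = 0 := by
      simp [step_of_nonpos]
    rw [← hval]
    apply integral_Ioi_of_hasDerivAt_of_tendsto'
      (f := fun s : ℝ => (s : ℂ) * deriv step (s - 1) - step (s - 1))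
    · intro s _
      have hs : HasDerivAt (fun s : ℝ => s - 1) 1 s := (hasDerivAt_id s).sub_const 1
      have a1 : HasDerivAt (fun s : ℝ => deriv step (s - 1)) (deriv (deriv step) (s - 1)) s := by
        simpa using! (hasDerivAt_of_contDiff (contDiff_deriv contDiff_step) (s - 1)).scomp s hs
      have a2 : HasDerivAt (fun s : ℝ => step (s - 1)) (deriv step (s - 1)) s := by
        simpa using! (hasDerivAt_of_contDiff contDiff_step (s - 1)).scomp s hs
      have a3 : HasDerivAt (fun r : ℝ => (r : ℂ)) 1 s := Complex.ofRealCLM.hasDerivAt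
      refine ((a3.fun_mul a1).fun_sub a2).congr_deriv ?_
      ring
    · refine Integrable.integrableOn ?_
      refine Continuous.integrable_of_hasCompactSupport (by fun_prop)
        (HasCompactSupport.intro (isCompact_Icc (a := 1) (b := 2)) fun s hs => ?_)
      rw [h0 s hs, mul_zero]
    · refine tendsto_const_nhds.congr' ?_
      filter_upwards [eventually_gt_atTop 2] with s hs
      have := iteratedDeriv_step_eq_zero (n := 1) one_ne_zero (s := s - 1)
        (fun h => by linarith [h.2])
      rw [iteratedDeriv_one] at this
      rw [this, step_of_one_le (by linarith)]
      simp
  rw [h3, Complex.real_smul]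
  push_cast
  ring

/-- These are the terms in which a derivative falls on the cutoff `step((n+1)r - 1)`. Under `x =
y/(n+1)` the term with `step''` is scale invariant, the one with `step'` gains a factor `1/(n+1)`,
and `h` and `φ` are evaluated ever closer to the origin. -/
theorem tendsto_integral_radial_layer {h : ℝ → ℂ} (hh : ContDiff ℝ ∞ h) {φ : E3 → ℂ}
    (hφ : IsTestFunction univ φ) :
    Tendsto (fun n : ℕ => ∫ x, radial (fun r =>
        ((n : ℂ) + 1) ^ 2 * deriv (deriv step) (((n : ℝ) + 1) * r - 1) * h r +
        2 * ((n : ℂ) + 1) * deriv step (((n : ℝ) + 1) * r - 1) * deriv h r) x * φ x) atTop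
      (𝓝 (-(4 * Real.pi * h 0 * φ 0))) := by
  obtain ⟨C, hC1, hC⟩ := exists_bound_iteratedDeriv_step
  have hC' : ∀ s, ‖deriv step s‖ ≤ C := fun s => by simpa using hC 1 (by norm_num) s
  have hC'' : ∀ s, ‖deriv (deriv step) s‖ ≤ C := fun s => by
    simpa [iteratedDeriv_succ] using hC 2 (by norm_num) s
  have z1 : ∀ s ∉ Icc (0 : ℝ) 1, deriv step s = 0 := fun s hs => by
    simpa using iteratedDeriv_step_eq_zero one_ne_zero hs
  have z2 : ∀ s ∉ Icc (0 : ℝ) 1, deriv (deriv step) s = 0 := fun s hs => by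
    simpa [iteratedDeriv_succ] using iteratedDeriv_step_eq_zero two_ne_zero hs
  have hd := contDiff_deriv hh
  have hs1 := contDiff_deriv contDiff_step
  have hs2 := contDiff_deriv hs1
  obtain ⟨M1, hM1⟩ := (isCompact_Icc (a := (0 : ℝ)) (b := 2)).exists_bound_of_continuousOn
    hh.continuous.continuousOn
  obtain ⟨M2, hM2⟩ := (isCompact_Icc (a := (0 : ℝ)) (b := 2)).exists_bound_of_continuousOn
    hd.continuous.continuousOn
  have hM10 : 0 ≤ M1 := (norm_nonneg _).trans (hM1 0 (by simp))
  have hM20 : 0 ≤ M2 := (norm_nonneg _).trans (hM2 0 (by simp))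
  obtain ⟨M3, hM3⟩ := hφ.compact_support.exists_bound_of_continuous hφ.continuous
  have hM30 : 0 ≤ M3 := (norm_nonneg _).trans (hM3 0)
  set F : ℕ → E3 → ℂ := fun n y => radial (fun s =>
    deriv (deriv step) (s - 1) * h (s / ((n : ℝ) + 1)) +
      2 * ((n : ℂ) + 1)⁻¹ * deriv step (s - 1) * deriv h (s / ((n : ℝ) + 1))) y *
        φ (((n : ℝ) + 1)⁻¹ • y) with hF
  have hscale : ∀ n : ℕ, ∫ x, radial (fun r =>
        ((n : ℂ) + 1) ^ 2 * deriv (deriv step) (((n : ℝ) + 1) * r - 1) * h r +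
        2 * ((n : ℂ) + 1) * deriv step (((n : ℝ) + 1) * r - 1) * deriv h r) x * φ x =
      ∫ y, F n y := by
    intro n
    have hc : (0 : ℝ) < (n : ℝ) + 1 := by positivity
    set f : E3 → ℂ := fun x => radial (fun r =>
        ((n : ℂ) + 1) ^ 2 * deriv (deriv step) (((n : ℝ) + 1) * r - 1) * h r +
        2 * ((n : ℂ) + 1) * deriv step (((n : ℝ) + 1) * r - 1) * deriv h r) x * φ x with hf
    have h1 := Measure.integral_comp_inv_smul_of_nonneg (volume : Measure E3) f hc.le
    rw [finrank_euclideanSpace_fin] at h1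
    have h2 : ∫ x, f x = (((n : ℝ) + 1) ^ 3)⁻¹ • ∫ x, f (((n : ℝ) + 1)⁻¹ • x) := by
      rw [h1, smul_smul, inv_mul_cancel₀ (by positivity), one_smul]
    rw [h2, ← integral_smul]
    congr 1 with y
    have e1 : ‖((n : ℝ) + 1)⁻¹ • y‖ = ‖y‖ / ((n : ℝ) + 1) := by
      rw [norm_smul, norm_inv, Real.norm_of_nonneg hc.le]
      ring
    have e2 : ((n : ℝ) + 1) * (‖y‖ / ((n : ℝ) + 1)) = ‖y‖ := by field_simp
    have hc' : (n : ℂ) + 1 ≠ 0 := by exact_mod_cast hc.ne'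
    simp only [hf, hF, radial, e1, e2, Complex.real_smul]
    push_cast
    field_simp
  simp only [hscale]
  have hlim : -(4 * Real.pi * h 0 * φ 0) =
      ∫ x, radial (fun s => deriv (deriv step) (s - 1)) x * (h 0 * φ 0) := by
    rw [integral_mul_const, integral_radial_deriv_deriv_step]
    ring
  rw [hlim]
  -- After rescaling, the layer is `1 ≤ ‖y‖ ≤ 2` for every `n`, so one multiple of `‖y‖⁻¹` on the
  -- ball of radius `3` dominates the whole sequence.
  refine tendsto_integral_of_dominated_convergence
    ((Metric.ball 0 3).indicator fun y => ‖y‖⁻¹ * ((C * M1 + 2 * C * M2) * M3)) (fun n => ?_) ?_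
    (fun n => ?_) ?_
  · refine ((measurable_radial ?_).mul ?_).aestronglyMeasurable
    · have := hh.continuous
      have := hd.continuous
      have := hs1.continuous
      have := hs2.continuous
      fun_prop
    · exact (hφ.continuous.comp (by fun_prop)).measurable
  · exact (integrable_indicator_iff measurableSet_ball).2 ((integrableOn_norm_inv 3).mul_const _)
  · refine Eventually.of_forall fun y => ?_
    simp only [hF, norm_mul, norm_radial]
    by_cases hy : ‖y‖ - 1 ∈ Icc (0 : ℝ) 1
    · have hyb : y ∈ Metric.ball (0 : E3) 3 := by
        rw [mem_ball_zero_iff]; linarith [hy.2]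
      rw [indicator_of_mem hyb, mul_assoc]
      have hyc : ‖y‖ / ((n : ℝ) + 1) ∈ Icc (0 : ℝ) 2 := by
        refine ⟨by positivity, ?_⟩
        rw [div_le_iff₀ (by positivity)]
        nlinarith [hy.2, (Nat.cast_nonneg n : (0 : ℝ) ≤ n)]
      gcongr
      · refine (norm_add_le _ _).trans ?_
        simp only [norm_mul]
        have hn1 : ‖((n : ℂ) + 1)⁻¹‖ ≤ 1 := by
          rw [norm_inv]
          refine inv_le_one_of_one_le₀ ?_
          have : (n : ℂ) + 1 = ((n + 1 : ℝ) : ℂ) := by push_cast; rfl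
          rw [this, Complex.norm_real, Real.norm_of_nonneg (by positivity)]
          linarith [(Nat.cast_nonneg n : (0 : ℝ) ≤ n)]
        have h2 : ‖(2 : ℂ)‖ * ‖((n : ℂ) + 1)⁻¹‖ ≤ 2 := by
          rw [Complex.norm_ofNat]; linarith
        gcongr
        · exact hC'' _
        · exact hM1 _ hyc
        · exact hC' _
        · exact hM2 _ hyc
      · exact hM3 _
    · rw [z1 _ hy, z2 _ hy]
      simp only [zero_mul, mul_zero, add_zero, norm_zero]
      exact indicator_nonneg (fun _ _ => by positivity) _
  · refine Eventually.of_forall fun y => ?_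
    have hinv : Tendsto (fun n : ℕ => ((n : ℝ) + 1)⁻¹) atTop (𝓝 0) := by
      simpa using tendsto_one_div_add_atTop_nhds_zero_nat (𝕜 := ℝ)
    have hinvc : Tendsto (fun n : ℕ => ((n : ℂ) + 1)⁻¹) atTop (𝓝 0) := by
      have := (Complex.continuous_ofReal.tendsto 0).comp hinv
      simpa [Function.comp_def] using this
    have hdiv : Tendsto (fun n : ℕ => ‖y‖ / ((n : ℝ) + 1)) atTop (𝓝 0) := by
      simpa [div_eq_mul_inv] using hinv.const_mul ‖y‖
    have l1 := (hh.continuous.tendsto 0).comp hdiv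
    have l2 := (hd.continuous.tendsto 0).comp hdiv
    have l3 : Tendsto (fun n : ℕ => φ (((n : ℝ) + 1)⁻¹ • y)) atTop (𝓝 (φ 0)) := by
      have := hinv.smul_const y
      rw [zero_smul] at this
      exact (hφ.continuous.tendsto 0).comp this
    have l4 := (((l1.const_mul (deriv (deriv step) (‖y‖ - 1))).add
      (((hinvc.const_mul 2).mul_const (deriv step (‖y‖ - 1))).mul l2)).const_mul
        (((‖y‖⁻¹ : ℝ) : ℂ))).mul l3
    simp only [hF, radial]
    refine l4.trans_eq ?_
    congr 1
    ring

theorem deriv_deriv_step_mul {h : ℝ → ℂ} (hh : ContDiff ℝ ∞ h) (c : ℝ) :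
    deriv (deriv fun r => step (c * r - 1) * h r) = fun r =>
      ((c : ℂ) ^ 2 * deriv (deriv step) (c * r - 1) * h r +
        2 * (c : ℂ) * deriv step (c * r - 1) * deriv h r) +
      step (c * r - 1) * deriv (deriv h) r := by
  have hs : ∀ r, HasDerivAt (fun r : ℝ => c * r - 1) c r := fun r => by
    simpa using ((hasDerivAt_id r).const_mul c).sub_const 1
  have a2 : ∀ r, HasDerivAt (fun r : ℝ => step (c * r - 1)) (c * deriv step (c * r - 1)) r :=
    fun r => by
      simpa using! (hasDerivAt_of_contDiff contDiff_step (c * r - 1)).scomp r (hs r)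
  have a1 : ∀ r, HasDerivAt (fun r : ℝ => deriv step (c * r - 1))
      (c * deriv (deriv step) (c * r - 1)) r := fun r => by
    simpa using! (hasDerivAt_of_contDiff (contDiff_deriv contDiff_step) (c * r - 1)).scomp r (hs r)
  have h1 : (deriv fun r => step (c * r - 1) * h r) = fun r =>
      c * deriv step (c * r - 1) * h r + step (c * r - 1) * deriv h r :=
    funext fun r => ((a2 r).fun_mul (hasDerivAt_of_contDiff hh r)).deriv
  rw [h1]
  ext r
  rw [((((a1 r).const_mul (c : ℂ)).fun_mul (hasDerivAt_of_contDiff hh r)).fun_add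
    ((a2 r).fun_mul (hasDerivAt_of_contDiff (contDiff_deriv hh) r))).deriv]
  ring

/-- In distributional form, `Δ(h/r) = h''/r - 4πh(0)δ`. The singularity is cut out at scale
`1/(n+1)`, the Laplacian is moved onto the now smooth function, and the cutoff terms concentrate
into the point mass. -/
theorem integral_radial_mul_laplacian {h : ℝ → ℂ} (hh : ContDiff ℝ ∞ h) {φ : E3 → ℂ}
    (hφ : IsTestFunction univ φ) :
    ∫ x, radial h x * Δ φ x =
      (∫ x, radial (deriv (deriv h)) x * φ x) - 4 * Real.pi * h 0 * φ 0 := by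
  have hd2 := contDiff_deriv (contDiff_deriv hh)
  have h1 := tendsto_integral_radial_step hh.continuous hφ.laplacian
  have h2 := (tendsto_integral_radial_layer hh hφ).add
    (tendsto_integral_radial_step hd2.continuous hφ)
  have h3 : ∀ n : ℕ, ∫ x, radial (fun r => step (((n : ℝ) + 1) * r - 1) * h r) x * Δ φ x =
      (∫ x, radial (fun r =>
        ((n : ℂ) + 1) ^ 2 * deriv (deriv step) (((n : ℝ) + 1) * r - 1) * h r +
        2 * ((n : ℂ) + 1) * deriv step (((n : ℝ) + 1) * r - 1) * deriv h r) x * φ x) +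
      ∫ x, radial (fun r => step (((n : ℝ) + 1) * r - 1) * deriv (deriv h) r) x * φ x := by
    intro n
    have hsm : ContDiff ℝ ∞ fun r : ℝ => ((n : ℝ) + 1) * r - 1 := by fun_prop
    have hsh : ContDiff ℝ ∞ fun r => step (((n : ℝ) + 1) * r - 1) * h r :=
      (contDiff_step.comp hsm).mul hh
    have hδ : (0 : ℝ) < ((n : ℝ) + 1)⁻¹ := by positivity
    have hz : ∀ r < ((n : ℝ) + 1)⁻¹, step (((n : ℝ) + 1) * r - 1) * h r = 0 := fun r hr => by
      rw [step_of_nonpos, zero_mul]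
      have : ((n : ℝ) + 1) * r < ((n : ℝ) + 1) * ((n : ℝ) + 1)⁻¹ := by gcongr
      rw [mul_inv_cancel₀ (by positivity)] at this
      linarith
    have c1 := (contDiff_deriv contDiff_step).continuous
    have c2 := (contDiff_deriv (contDiff_deriv contDiff_step)).continuous
    have c3 := hh.continuous
    have c4 := (contDiff_deriv hh).continuous
    have c5 := hd2.continuous
    have c6 := contDiff_step.continuous
    rw [integral_mul_laplacian (contDiff_radial hsh hδ hz) hφ, laplacian_radial hsh hδ hz,
      deriv_deriv_step_mul hh, ← integral_add]
    · congr 1 with x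
      simp only [radial]
      push_cast
      ring
    · exact integrable_mul_test (locallyIntegrable_radial (by fun_prop)) hφ
    · exact integrable_mul_test (locallyIntegrable_radial (by fun_prop)) hφ
  simp only [h3] at h1
  rw [tendsto_nhds_unique h1 h2]
  ring

/-! ### The outgoing fundamental solution of `Δ² - κ⁴` and its truncations -/

/-- The profile `e^{iμr} / 4π` of the fundamental solution of the Helmholtz equation. -/
noncomputable def helmProfile (μ : ℂ) (r : ℝ) : ℂ :=
  Complex.exp (Complex.I * μ * r) / (4 * Real.pi)

/-- The profile of the outgoing fundamental solution of `Δ² - κ⁴`. -/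
noncomputable def bihProfile (κ : ℝ) (r : ℝ) : ℂ :=
  (helmProfile κ r - helmProfile (Complex.I * κ) r) / (2 * (κ : ℂ) ^ 2)

theorem contDiff_helmProfile (μ : ℂ) : ContDiff ℝ ∞ (helmProfile μ) := by
  have h : ContDiff ℝ ∞ fun r : ℝ => Complex.I * μ * (r : ℂ) :=
    contDiff_const.mul Complex.ofRealCLM.contDiff
  exact h.cexp.div_const _

theorem contDiff_bihProfile (κ : ℝ) : ContDiff ℝ ∞ (bihProfile κ) :=
  ((contDiff_helmProfile _).sub (contDiff_helmProfile _)).div_const _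

theorem hasDerivAt_helmProfile (μ : ℂ) (r : ℝ) :
    HasDerivAt (helmProfile μ) (Complex.I * μ * helmProfile μ r) r := by
  have h1 : HasDerivAt (fun r : ℝ => Complex.I * μ * (r : ℂ)) (Complex.I * μ) r := by
    simpa using (Complex.ofRealCLM.hasDerivAt (x := r)).const_mul (Complex.I * μ)
  refine (h1.cexp.div_const _).congr_deriv ?_
  rw [helmProfile]
  ring

theorem deriv_helmProfile (μ : ℂ) :
    deriv (helmProfile μ) = fun r => Complex.I * μ * helmProfile μ r :=
  funext fun r => (hasDerivAt_helmProfile μ r).deriv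

theorem iteratedDeriv_helmProfile (μ : ℂ) (n : ℕ) :
    iteratedDeriv n (helmProfile μ) = fun r => (Complex.I * μ) ^ n * helmProfile μ r := by
  induction n with
  | zero => simp
  | succ n ih =>
    rw [iteratedDeriv_succ, ih]
    ext r
    rw [((hasDerivAt_helmProfile μ r).const_mul _).deriv]
    ring

theorem iteratedDeriv_bihProfile (κ : ℝ) (n : ℕ) (r : ℝ) :
    iteratedDeriv n (bihProfile κ) r = ((Complex.I * κ) ^ n * helmProfile κ r -
      (-(κ : ℂ)) ^ n * helmProfile (Complex.I * κ) r) / (2 * (κ : ℂ) ^ 2) := by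
  have hle : ((n : ℕ∞) : WithTop ℕ∞) ≤ ((⊤ : ℕ∞) : WithTop ℕ∞) := WithTop.coe_le_coe.2 le_top
  have h1 : bihProfile κ = fun r => (2 * (κ : ℂ) ^ 2)⁻¹ *
      (helmProfile κ r - helmProfile (Complex.I * κ) r) := by
    ext r; rw [bihProfile]; ring
  rw [h1, iteratedDeriv_const_mul_field, iteratedDeriv_fun_sub
    ((contDiff_helmProfile _).contDiffAt.of_le hle)
    ((contDiff_helmProfile _).contDiffAt.of_le hle),
    iteratedDeriv_helmProfile, iteratedDeriv_helmProfile]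
  simp only
  have : Complex.I * (Complex.I * (κ : ℂ)) = -κ := by
    rw [← mul_assoc, Complex.I_mul_I]; ring
  rw [this]
  ring

theorem norm_helmProfile (μ : ℂ) (r : ℝ) :
    ‖helmProfile μ r‖ = Real.exp (-(μ.im * r)) / (4 * Real.pi) := by
  rw [helmProfile, norm_div, Complex.norm_exp]
  congr 1
  · simp
  · rw [norm_mul, Complex.norm_ofNat, Complex.norm_real, Real.norm_of_nonneg Real.pi_pos.le]

/-- For `r ≥ 0` both exponentials have modulus at most one, so each derivative costs exactly one
factor `κ` against the prefactor `1/(2κ²)`. -/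
theorem norm_iteratedDeriv_bihProfile_le {κ : ℝ} (hκ : 0 < κ) (n : ℕ) {r : ℝ} (hr : 0 ≤ r) :
    ‖iteratedDeriv n (bihProfile κ) r‖ ≤ κ ^ n / (4 * Real.pi * κ ^ 2) := by
  rw [iteratedDeriv_bihProfile, norm_div]
  have h2 : ‖2 * (κ : ℂ) ^ 2‖ = 2 * κ ^ 2 := by
    rw [norm_mul, norm_pow, Complex.norm_real, Real.norm_of_nonneg hκ.le, Complex.norm_ofNat]
  have h3 : ‖helmProfile κ r‖ = 1 / (4 * Real.pi) := by
    rw [norm_helmProfile]; simp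
  have h4 : ‖helmProfile (Complex.I * κ) r‖ ≤ 1 / (4 * Real.pi) := by
    rw [norm_helmProfile]
    gcongr
    simp
    positivity
  rw [h2, div_le_div_iff₀ (by positivity) (by positivity)]
  have h5 := norm_sub_le ((Complex.I * κ) ^ n * helmProfile κ r)
    ((-(κ : ℂ)) ^ n * helmProfile (Complex.I * κ) r)
  simp only [norm_mul, norm_pow, Complex.norm_I, one_mul, norm_neg, Complex.norm_real,
    Real.norm_of_nonneg hκ.le, h3] at h5
  calc _ ≤ (κ ^ n * (1 / (4 * Real.pi)) + κ ^ n * (1 / (4 * Real.pi))) * (4 * Real.pi * κ ^ 2) := by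
        gcongr
        refine h5.trans ?_
        gcongr
    _ = κ ^ n * (2 * κ ^ 2) := by
        field_simp
        ring

theorem norm_bihProfile_le {κ : ℝ} (hκ : 0 < κ) {r : ℝ} (hr : 0 ≤ r) :
    ‖bihProfile κ r‖ ≤ 1 / (4 * Real.pi * κ ^ 2) := by
  simpa using norm_iteratedDeriv_bihProfile_le hκ 0 hr

theorem bihProfile_zero (κ : ℝ) : bihProfile κ 0 = 0 := by
  simp [bihProfile, helmProfile]

/-- The two exponentials cancel at `r = 0`, so the profile vanishes linearly there and dividing by
`r` leaves a bounded kernel. -/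
theorem norm_bihProfile_le_mul {κ : ℝ} (hκ : 0 < κ) {r : ℝ} (hr : 0 ≤ r) :
    ‖bihProfile κ r‖ ≤ κ / (4 * Real.pi * κ ^ 2) * r := by
  have h := (convex_Ici (0 : ℝ)).norm_image_sub_le_of_norm_hasDerivWithin_le
    (f := bihProfile κ) (f' := deriv (bihProfile κ)) (C := κ / (4 * Real.pi * κ ^ 2))
    (fun x _ => (hasDerivAt_of_contDiff (contDiff_bihProfile κ) x).hasDerivWithinAt)
    (fun x hx => by
      have := norm_iteratedDeriv_bihProfile_le hκ 1 (mem_Ici.1 hx)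
      rwa [iteratedDeriv_one, pow_one] at this)
    (mem_Ici.2 le_rfl) (mem_Ici.2 hr)
  rwa [bihProfile_zero, sub_zero, sub_zero, Real.norm_of_nonneg hr] at h

/-- The outgoing fundamental solution of `Δ² - κ⁴`. -/
noncomputable def bihKernel (κ : ℝ) : E3 → ℂ := radial (bihProfile κ)

theorem norm_bihKernel_le {κ : ℝ} (hκ : 0 < κ) (x : E3) :
    ‖bihKernel κ x‖ ≤ κ / (4 * Real.pi * κ ^ 2) := by
  rw [bihKernel, norm_radial]
  rcases eq_or_ne x 0 with rfl | hx
  · simp; positivity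
  · have hx' := norm_pos_iff.2 hx
    rw [inv_mul_le_iff₀ hx', mul_comm]
    exact norm_bihProfile_le_mul hκ hx'.le

/-- A smooth cutoff equal to `1` for `r ≤ a` and to `0` for `r ≥ a + 1`. -/
noncomputable def cutoff (a r : ℝ) : ℂ := step (a + 1 - r)

theorem contDiff_cutoff (a : ℝ) : ContDiff ℝ ∞ (cutoff a) :=
  contDiff_step.comp (by fun_prop)

theorem cutoff_of_le {a r : ℝ} (h : r ≤ a) : cutoff a r = 1 := step_of_one_le (by linarith)

theorem cutoff_of_ge {a r : ℝ} (h : a + 1 ≤ r) : cutoff a r = 0 := step_of_nonpos (by linarith)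

theorem norm_cutoff_le (a r : ℝ) : ‖cutoff a r‖ ≤ 1 := norm_step_le _

theorem norm_iteratedDeriv_cutoff (a : ℝ) (n : ℕ) (r : ℝ) :
    ‖iteratedDeriv n (cutoff a) r‖ = ‖iteratedDeriv n step (a + 1 - r)‖ := by
  have : cutoff a = fun r => step (a + 1 - r) := rfl
  rw [this, iteratedDeriv_comp_const_sub]
  simp

/-- The profile of the truncated fundamental solution. -/
noncomputable def truncProfile (κ a r : ℝ) : ℂ := cutoff a r * bihProfile κ r

theorem contDiff_truncProfile (κ a : ℝ) : ContDiff ℝ ∞ (truncProfile κ a) :=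
  (contDiff_cutoff a).mul (contDiff_bihProfile κ)

/-- The profile of the error made by the truncation. -/
noncomputable def errProfile (κ a r : ℝ) : ℂ :=
  iteratedDeriv 4 (truncProfile κ a) r - (κ : ℂ) ^ 4 * truncProfile κ a r

theorem contDiff_errProfile (κ a : ℝ) : ContDiff ℝ ∞ (errProfile κ a) :=
  (contDiff_iteratedDeriv (contDiff_truncProfile κ a) 4).sub
    (contDiff_const.mul (contDiff_truncProfile κ a))

theorem iteratedDeriv_four_bihProfile (κ r : ℝ) :
    iteratedDeriv 4 (bihProfile κ) r = (κ : ℂ) ^ 4 * bihProfile κ r := by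
  rw [iteratedDeriv_bihProfile, bihProfile, mul_pow, Complex.I_pow_four]
  ring

theorem errProfile_of_lt {κ a r : ℝ} (hr : r < a) : errProfile κ a r = 0 := by
  have h : truncProfile κ a =ᶠ[𝓝 r] bihProfile κ := by
    filter_upwards [gt_mem_nhds hr] with s hs
    rw [truncProfile, cutoff_of_le hs.le, one_mul]
  rw [errProfile, h.iteratedDeriv_eq, h.self_of_nhds, iteratedDeriv_four_bihProfile, sub_self]

theorem errProfile_of_gt {κ a r : ℝ} (hr : a + 1 < r) : errProfile κ a r = 0 := by
  have h : truncProfile κ a =ᶠ[𝓝 r] fun _ => 0 := by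
    filter_upwards [lt_mem_nhds hr] with s hs
    rw [truncProfile, cutoff_of_ge hs.le, zero_mul]
  rw [errProfile, h.iteratedDeriv_eq, h.self_of_nhds]
  simp

/-- In the Leibniz expansion of the fourth derivative, the term with no derivative on the cutoff
cancels against `κ⁴`. The remaining ones put at most three derivatives on the profile, which costs
`κ³/κ²`. The bound is uniform in `a` because cutoffs with different `a` are translates of each
other. -/
theorem exists_norm_errProfile_le :
    ∃ C : ℝ, 0 < C ∧ ∀ κ : ℝ, 1 ≤ κ → ∀ a r : ℝ, 0 ≤ r → ‖errProfile κ a r‖ ≤ C * κ := by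
  obtain ⟨C, hC1, hC⟩ := exists_bound_iteratedDeriv_step
  -- The binomial coefficients that survive add up to `15 = 4 + 6 + 4 + 1`.
  refine ⟨15 * C, by linarith, fun κ hκ a r hr => ?_⟩
  have hκ0 : 0 < κ := by linarith
  have hle : ((4 : ℕ) : WithTop ℕ∞) ≤ ((⊤ : ℕ∞) : WithTop ℕ∞) := WithTop.coe_le_coe.2 le_top
  have h1 : errProfile κ a r = 4 * iteratedDeriv 1 (cutoff a) r * iteratedDeriv 3 (bihProfile κ) r
      + 6 * iteratedDeriv 2 (cutoff a) r * iteratedDeriv 2 (bihProfile κ) r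
      + 4 * iteratedDeriv 3 (cutoff a) r * iteratedDeriv 1 (bihProfile κ) r
      + iteratedDeriv 4 (cutoff a) r * iteratedDeriv 0 (bihProfile κ) r := by
    have h2 : truncProfile κ a = fun r => cutoff a r * bihProfile κ r := rfl
    rw [errProfile, h2, iteratedDeriv_fun_mul ((contDiff_cutoff a).contDiffAt.of_le hle)
      ((contDiff_bihProfile κ).contDiffAt.of_le hle)]
    simp only [Finset.sum_range_succ, Finset.sum_range_zero, Nat.choose_zero_right, Nat.sub_zero,
      iteratedDeriv_zero, iteratedDeriv_four_bihProfile, Nat.choose_self, Nat.sub_self,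
      show Nat.choose 4 1 = 4 from rfl, show Nat.choose 4 2 = 6 from rfl,
      show Nat.choose 4 3 = 4 from rfl]
    push_cast
    ring
  have hcut : ∀ n ≤ 4, ‖iteratedDeriv n (cutoff a) r‖ ≤ C := fun n hn => by
    rw [norm_iteratedDeriv_cutoff]; exact hC n hn _
  have hb : ∀ n ≤ 3, ‖iteratedDeriv n (bihProfile κ) r‖ ≤ κ := fun n hn => by
    refine (norm_iteratedDeriv_bihProfile_le hκ0 n hr).trans ?_
    rw [div_le_iff₀ (by positivity)]
    have h3 : κ ^ n ≤ κ ^ 3 := pow_le_pow_right₀ hκ hn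
    have hpi := Real.pi_gt_three
    nlinarith [pow_pos hκ0 3]
  rw [h1]
  refine (norm_add_le _ _).trans ?_
  have t := norm_add₃_le (a := 4 * iteratedDeriv 1 (cutoff a) r * iteratedDeriv 3 (bihProfile κ) r)
      (b := 6 * iteratedDeriv 2 (cutoff a) r * iteratedDeriv 2 (bihProfile κ) r)
      (c := 4 * iteratedDeriv 3 (cutoff a) r * iteratedDeriv 1 (bihProfile κ) r)
  have m : ∀ i j, i ≤ 4 → j ≤ 3 →
      ‖iteratedDeriv i (cutoff a) r‖ * ‖iteratedDeriv j (bihProfile κ) r‖ ≤ C * κ :=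
    fun i j hi hj => mul_le_mul (hcut i hi) (hb j hj) (norm_nonneg _) (by linarith)
  simp only [norm_mul, Complex.norm_ofNat, mul_assoc] at t ⊢
  linarith [m 1 3 (by norm_num) (by norm_num), m 2 2 (by norm_num) (by norm_num),
    m 3 1 (by norm_num) (by norm_num), m 4 0 (by norm_num) (by norm_num)]

/-- The truncated fundamental solution. -/
noncomputable def truncKernel (κ a : ℝ) : E3 → ℂ := radial (truncProfile κ a)

/-- The error made by the truncation: `(Δ² - κ⁴) truncKernel = δ₀ + errKernel`. -/
noncomputable def errKernel (κ a : ℝ) : E3 → ℂ := radial (errProfile κ a)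

theorem contDiff_errKernel (κ : ℝ) {a : ℝ} (ha : 0 < a) : ContDiff ℝ ∞ (errKernel κ a) :=
  contDiff_radial (contDiff_errProfile κ a) ha fun _ hr => errProfile_of_lt hr

theorem errKernel_of_notMem {κ a : ℝ} {x : E3} (hx : ‖x‖ ∉ Icc a (a + 1)) :
    errKernel κ a x = 0 := by
  rw [mem_Icc, not_and_or, not_le, not_le] at hx
  rw [errKernel, radial]
  rcases hx with hx | hx
  · rw [errProfile_of_lt hx, mul_zero]
  · rw [errProfile_of_gt hx, mul_zero]

theorem isTestFunction_errKernel (κ : ℝ) {a : ℝ} (ha : 0 < a) :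
    IsTestFunction univ (errKernel κ a) :=
  isTestFunction_univ (contDiff_errKernel κ ha)
    (HasCompactSupport.intro (isCompact_closedBall 0 (a + 1)) fun x hx =>
      errKernel_of_notMem fun h => hx (by simpa using h.2))

theorem truncKernel_of_le {κ a : ℝ} {x : E3} (hx : ‖x‖ ≤ a) :
    truncKernel κ a x = bihKernel κ x := by
  rw [truncKernel, bihKernel, radial, radial, truncProfile, cutoff_of_le hx, one_mul]

theorem truncKernel_of_ge {κ a : ℝ} {x : E3} (hx : a + 1 ≤ ‖x‖) :
    truncKernel κ a x = 0 := by
  rw [truncKernel, radial, truncProfile, cutoff_of_ge hx, zero_mul, mul_zero]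

theorem hasCompactSupport_truncKernel (κ a : ℝ) : HasCompactSupport (truncKernel κ a) :=
  HasCompactSupport.intro (isCompact_closedBall 0 (a + 1)) fun x hx =>
    truncKernel_of_ge (le_of_lt (by simpa using hx))

theorem norm_truncKernel_le_bihKernel (κ a : ℝ) (x : E3) :
    ‖truncKernel κ a x‖ ≤ ‖bihKernel κ x‖ := by
  rw [truncKernel, bihKernel, norm_radial, norm_radial, truncProfile, norm_mul]
  gcongr
  exact mul_le_of_le_one_left (norm_nonneg _) (norm_cutoff_le _ _)

theorem measurable_bihKernel (κ : ℝ) : Measurable (bihKernel κ) :=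
  measurable_radial (contDiff_bihProfile κ).continuous

theorem measurable_truncKernel (κ a : ℝ) : Measurable (truncKernel κ a) :=
  measurable_radial (contDiff_truncProfile κ a).continuous

theorem memLp_truncKernel {κ : ℝ} (hκ : 0 < κ) (a : ℝ) (p : ℝ≥0∞) :
    MemLp (truncKernel κ a) p := by
  have h1 : (Metric.ball (0 : E3) (a + 1)).indicator (truncKernel κ a) = truncKernel κ a := by
    rw [indicator_eq_self]
    intro x hx
    by_contra h
    exact hx (truncKernel_of_ge (by simpa using h))
  rw [← h1, memLp_indicator_iff_restrict measurableSet_ball]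
  have : IsFiniteMeasure ((volume : Measure E3).restrict (Metric.ball 0 (a + 1))) :=
    ⟨by rw [Measure.restrict_apply_univ]; exact measure_ball_lt_top⟩
  exact MemLp.of_bound (measurable_truncKernel κ a).aestronglyMeasurable _
    (Eventually.of_forall fun x => (norm_truncKernel_le_bihKernel κ a x).trans
      (norm_bihKernel_le hκ x))

theorem integrable_truncKernel {κ : ℝ} (hκ : 0 < κ) (a : ℝ) : Integrable (truncKernel κ a) :=
  memLp_one_iff_integrable.1 (memLp_truncKernel hκ a 1)

/-- Both kernels are `‖x‖⁻¹` times a profile bounded by a multiple of `κ⁻²`, respectively `κ`, and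
both vanish for `‖x‖ > a + 1`. What remains is the integral of `‖x‖⁻¹` over a fixed ball. -/
theorem exists_integral_norm_kernel_le (a : ℝ) (ha : 0 < a) :
    ∃ C : ℝ, 0 < C ∧ ∀ κ : ℝ, 1 ≤ κ →
      ∫ x, ‖truncKernel κ a x‖ ≤ C / κ ^ 2 ∧ ∫ x, ‖errKernel κ a x‖ ≤ C * κ := by
  obtain ⟨C, hC0, hC⟩ := exists_norm_errProfile_le
  set J : ℝ := ∫ x in Metric.ball (0 : E3) (a + 2), ‖x‖⁻¹ with hJ
  have hJ0 : 0 ≤ J := integral_nonneg fun x => by positivity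
  have key : ∀ (k : E3 → ℂ) (D : ℝ), Integrable k → (∀ x, ‖k x‖ ≤ ‖x‖⁻¹ * D) →
      (∀ x, a + 1 < ‖x‖ → k x = 0) → ∫ x, ‖k x‖ ≤ J * D := by
    intro k D hk hD h0
    rw [← setIntegral_eq_integral_of_forall_compl_eq_zero (s := Metric.ball (0 : E3) (a + 2)),
      hJ, ← integral_mul_const]
    · exact setIntegral_mono hk.norm.integrableOn ((integrableOn_norm_inv _).mul_const _) hD
    · intro x hx
      rw [mem_ball_zero_iff, not_lt] at hx
      rw [h0 x (by linarith), norm_zero]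
  refine ⟨J * 1 + J * C + 1, by positivity, fun κ hκ => ⟨?_, ?_⟩⟩
  · have hκ0 : 0 < κ := by linarith
    refine (key _ (1 / κ ^ 2) (integrable_truncKernel hκ0 a) (fun x => ?_) fun x hx =>
      truncKernel_of_ge hx.le).trans ?_
    · refine (norm_truncKernel_le_bihKernel κ a x).trans ?_
      rw [bihKernel, norm_radial]
      gcongr
      refine (norm_bihProfile_le hκ0 (norm_nonneg x)).trans ?_
      gcongr
      nlinarith [Real.pi_gt_three, pow_pos hκ0 2]
    · rw [mul_one_div]
      gcongr
      nlinarith [mul_nonneg hJ0 hC0.le]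
  · refine (key _ (C * κ) (isTestFunction_errKernel κ ha).integrable (fun x => ?_) fun x hx =>
      errKernel_of_notMem fun h => by linarith [h.2]).trans ?_
    · rw [errKernel, norm_radial]
      gcongr
      exact hC κ hκ a _ (norm_nonneg x)
    · nlinarith

/-- The error lives in a shell of width one, on which `‖x‖⁻²` integrates to `4π` whatever the
radius. Unlike the `L¹` norm, this `L²` norm stays bounded as the truncation moves to infinity. -/
theorem integral_norm_errKernel_sq_le {κ a : ℝ} {C : ℝ} (ha : 0 < a)
    (hC : ∀ r, 0 ≤ r → ‖errProfile κ a r‖ ≤ C) :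
    ∫ x, ‖errKernel κ a x‖ ^ 2 ≤ C ^ 2 * (4 * Real.pi) := by
  obtain ⟨h1, h2⟩ := integral_shell_norm_inv_sq ha (by linarith : a ≤ a + 1)
  have h3 : ∫ x : E3, C ^ 2 * (Icc a (a + 1)).indicator (fun r => (r⁻¹) ^ 2) ‖x‖ =
      C ^ 2 * (4 * Real.pi) := by
    rw [integral_const_mul, h2]
    ring
  rw [← h3]
  refine integral_mono (integrable_sq (isTestFunction_errKernel κ ha)) (h1.const_mul _)
    fun x => ?_
  simp only
  by_cases hx : ‖x‖ ∈ Icc a (a + 1)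
  · rw [indicator_of_mem hx, errKernel, norm_radial, mul_pow, mul_comm]
    have := hC ‖x‖ (norm_nonneg x)
    gcongr
  · rw [errKernel_of_notMem hx, indicator_of_notMem hx]
    simp

theorem deriv_deriv_bihProfile_zero {κ : ℝ} (hκ : κ ≠ 0) :
    deriv (deriv (bihProfile κ)) 0 = -(4 * Real.pi : ℂ)⁻¹ := by
  have h := iteratedDeriv_bihProfile κ 2 0
  rw [iteratedDeriv_succ, iteratedDeriv_one] at h
  rw [h, helmProfile, helmProfile]
  have hκ' : (κ : ℂ) ≠ 0 := by exact_mod_cast hκ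
  have hpi : (Real.pi : ℂ) ≠ 0 := by exact_mod_cast Real.pi_ne_zero
  rw [mul_pow, Complex.I_sq]
  simp
  field_simp
  norm_num

/-- The formula for `Δ(h/r)` is used twice. The first use leaves no point mass since `h 0 = 0`, and
the second leaves exactly `φ 0` by the normalisation of `h''(0)`. -/
theorem integral_radial_mul_laplacian_laplacian {h : ℝ → ℂ} (hh : ContDiff ℝ ∞ h) (h0 : h 0 = 0)
    (h2 : deriv (deriv h) 0 = -(4 * Real.pi : ℂ)⁻¹) {φ : E3 → ℂ} (hφ : IsTestFunction univ φ) :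
    ∫ x, radial h x * Δ (Δ φ) x = (∫ x, radial (iteratedDeriv 4 h) x * φ x) + φ 0 := by
  have hpi : (Real.pi : ℂ) ≠ 0 := by exact_mod_cast Real.pi_ne_zero
  rw [integral_radial_mul_laplacian hh hφ.laplacian, h0,
    integral_radial_mul_laplacian (contDiff_deriv (contDiff_deriv hh)) hφ, h2]
  simp only [iteratedDeriv_succ, iteratedDeriv_zero]
  field_simp
  ring

theorem integral_bihKernel_mul {κ : ℝ} (hκ : κ ≠ 0) {φ : E3 → ℂ} (hφ : IsTestFunction univ φ) :
    ∫ x, bihKernel κ x * (Δ (Δ φ) x - (κ : ℂ) ^ 4 * φ x) = φ 0 := by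
  have hs := contDiff_bihProfile κ
  have hl := locallyIntegrable_radial hs.continuous
  simp only [mul_sub, bihKernel]
  rw [integral_sub (integrable_mul_test hl hφ.laplacian.laplacian)
    (integrable_mul_test hl (hφ.const_mul _)),
    integral_radial_mul_laplacian_laplacian hs (bihProfile_zero κ)
      (deriv_deriv_bihProfile_zero hκ) hφ]
  have : ∀ x, radial (iteratedDeriv 4 (bihProfile κ)) x * φ x =
      radial (bihProfile κ) x * ((κ : ℂ) ^ 4 * φ x) := fun x => by
    rw [radial, radial, iteratedDeriv_four_bihProfile]; ring
  simp only [this]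
  ring

theorem integral_truncKernel_mul {κ : ℝ} (hκ : κ ≠ 0) {a : ℝ} (ha : 0 < a) {φ : E3 → ℂ}
    (hφ : IsTestFunction univ φ) :
    ∫ x, truncKernel κ a x * (Δ (Δ φ) x - (κ : ℂ) ^ 4 * φ x) =
      φ 0 + ∫ x, errKernel κ a x * φ x := by
  have hs := contDiff_truncProfile κ a
  have hl := locallyIntegrable_radial hs.continuous
  have hl4 := locallyIntegrable_radial (contDiff_iteratedDeriv hs 4).continuous
  have hev : truncProfile κ a =ᶠ[𝓝 0] bihProfile κ := by
    filter_upwards [gt_mem_nhds ha] with s hs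
    rw [truncProfile, cutoff_of_le hs.le, one_mul]
  simp only [mul_sub, truncKernel]
  rw [integral_sub (integrable_mul_test hl hφ.laplacian.laplacian)
    (integrable_mul_test hl (hφ.const_mul _)),
    integral_radial_mul_laplacian_laplacian hs (by rw [hev.self_of_nhds, bihProfile_zero])
      (by rw [hev.deriv.deriv_eq, deriv_deriv_bihProfile_zero hκ]) hφ, add_comm, add_sub_assoc,
    ← integral_sub (integrable_mul_test hl4 hφ) (integrable_mul_test hl (hφ.const_mul _))]
  congr 2 with x
  simp only [errKernel, errProfile, radial]
  ring

/-! ### Convolution -/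

/-- The convolution of two complex valued functions on `ℝ³`. -/
noncomputable def conv (K g : E3 → ℂ) : E3 → ℂ :=
  MeasureTheory.convolution K g (ContinuousLinearMap.mul ℝ ℂ) volume

theorem conv_apply (K g : E3 → ℂ) (x : E3) : conv K g x = ∫ y, K y * g (x - y) := rfl

theorem conv_apply' (K g : E3 → ℂ) (x : E3) : conv K g x = ∫ y, K (x - y) * g y := by
  rw [conv_apply, ← integral_sub_left_eq_self _ _ x]
  simp

theorem conv_comm (K g : E3 → ℂ) : conv K g = conv g K := by
  ext x
  rw [conv_apply, conv_apply']
  simp only [mul_comm]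

theorem contDiff_conv {K φ : E3 → ℂ} (hK : LocallyIntegrable K) (hφ : IsTestFunction univ φ) :
    ContDiff ℝ ∞ (conv K φ) :=
  hφ.compact_support.contDiff_convolution_right _ hK hφ.smooth

theorem partialDeriv_conv {K φ : E3 → ℂ} (hK : LocallyIntegrable K)
    (hφ : IsTestFunction univ φ) (i : Fin 3) :
    partialDeriv i (conv K φ) = conv K (partialDeriv i φ) := by
  ext x
  have h1 := hφ.compact_support.hasFDerivAt_convolution_right (ContinuousLinearMap.mul ℝ ℂ) hK
    (hφ.smooth.of_le (WithTop.coe_le_coe.2 le_top)) x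
  change fderiv ℝ (MeasureTheory.convolution K φ (ContinuousLinearMap.mul ℝ ℂ) volume) x _ = _
  rw [h1.fderiv, convolution_precompR_apply _ hK (hφ.compact_support.fderiv ℝ)
    (hφ.smooth.continuous_fderiv (by simp))]
  rfl

theorem convolutionExists_test {K φ : E3 → ℂ} (hK : LocallyIntegrable K)
    (hφ : IsTestFunction univ φ) (x : E3) : Integrable fun y => K y * φ (x - y) :=
  hφ.compact_support.convolutionExists_right (ContinuousLinearMap.mul ℝ ℂ) hK hφ.continuous x

theorem conv_add_right {K φ ψ : E3 → ℂ} (hK : LocallyIntegrable K) (hφ : IsTestFunction univ φ)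
    (hψ : IsTestFunction univ ψ) (x : E3) :
    conv K (fun y => φ y + ψ y) x = conv K φ x + conv K ψ x := by
  simp only [conv_apply, mul_add]
  exact integral_add (convolutionExists_test hK hφ x) (convolutionExists_test hK hψ x)

theorem conv_const_mul_right (K φ : E3 → ℂ) (c : ℂ) (x : E3) :
    conv K (fun y => c * φ y) x = c * conv K φ x := by
  simp only [conv_apply]
  rw [← integral_const_mul]
  congr 1 with y
  ring

theorem laplacian_conv {K φ : E3 → ℂ} (hK : LocallyIntegrable K) (hφ : IsTestFunction univ φ) :
    Δ (conv K φ) = conv K (Δ φ) := by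
  have h2 := fun i => (hφ.partialDeriv i).partialDeriv i
  rw [laplacian_eq_sum (contDiff_conv hK hφ), laplacian_eq_sum hφ.smooth]
  ext x
  simp only [Fin.sum_univ_three]
  rw [conv_add_right hK ((h2 0).add (h2 1)) (h2 2), conv_add_right hK (h2 0) (h2 1)]
  simp only [partialDeriv_conv hK hφ, partialDeriv_conv hK (hφ.partialDeriv _)]

theorem isTestFunction_conv {K φ : E3 → ℂ} (hK : LocallyIntegrable K) (hK' : HasCompactSupport K)
    (hφ : IsTestFunction univ φ) : IsTestFunction univ (conv K φ) :=
  isTestFunction_univ (contDiff_conv hK hφ) (hK'.convolution _ hφ.compact_support)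

theorem conv_neg {K g : E3 → ℂ} (hK : ∀ x, K (-x) = K x) (x : E3) :
    ∫ y, K y * g (x + y) = conv K g x := by
  rw [conv_apply, ← integral_neg_eq_self]
  simp [hK, sub_eq_add_neg]

theorem conv_eq_of_forall {K K' g : E3 → ℂ} {R : ℝ} (hg : ∀ y, R < ‖y‖ → g y = 0) {x : E3}
    (h : ∀ y, ‖y‖ ≤ R → K (x - y) = K' (x - y)) : conv K g x = conv K' g x := by
  rw [conv_apply', conv_apply']
  congr 1 with y
  by_cases hy : R < ‖y‖
  · simp [hg y hy]
  · rw [h y (not_lt.1 hy)]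

theorem conv_congr_ae {K g g' : E3 → ℂ} (h : g =ᵐ[volume] g') : conv K g = conv K g' := by
  ext x
  rw [conv_apply', conv_apply']
  refine integral_congr_ae ?_
  filter_upwards [h] with y hy
  rw [hy]

/-! ### Convolution with a smooth kernel -/

theorem exists_plateau (ρ : ℝ) : ∃ θ : E3 → ℂ, IsTestFunction univ θ ∧
    (∀ x, ‖x‖ ≤ ρ → θ x = 1) ∧ ∀ x, ‖θ x‖ ≤ 1 := by
  have hpos : 0 < |ρ| + 1 := by positivity
  let f : ContDiffBump (0 : E3) := ⟨|ρ| + 1, |ρ| + 2, hpos, by linarith⟩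
  refine ⟨fun x => (f x : ℂ), isTestFunction_univ (Complex.ofRealCLM.contDiff.comp f.contDiff)
    (f.hasCompactSupport.comp_left (g := fun r : ℝ => (r : ℂ)) (by simp)), fun x hx => ?_,
    fun x => ?_⟩
  · have : f x = 1 := f.one_of_mem_closedBall (by
      rw [mem_closedBall_zero_iff]
      exact hx.trans ((le_abs_self ρ).trans (by simp [f])))
    simp [this]
  · rw [Complex.norm_real, Real.norm_of_nonneg f.nonneg]
    exact f.le_one

/-- When `g` lives in the ball of radius `R` and `‖x‖ < ρ`, the kernel is only read at `‖x - y‖ < ρ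
+ R`. It may therefore be multiplied by a plateau function, which reduces smooth kernels to test
functions. -/
theorem exists_test_conv_eq {S g : E3 → ℂ} (hS : ContDiff ℝ ∞ S) {R : ℝ}
    (hg : ∀ y, R < ‖y‖ → g y = 0) (ρ : ℝ) :
    ∃ T : E3 → ℂ, IsTestFunction univ T ∧ (∀ z, ‖z‖ < ρ + R → T =ᶠ[𝓝 z] S) ∧
      ∀ x, ‖x‖ < ρ → conv S g x = conv g T x := by
  obtain ⟨θ, hθ, hθ1, -⟩ := exists_plateau (ρ + R)
  have hT : IsTestFunction univ fun x => S x * θ x :=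
    isTestFunction_univ (hS.mul hθ.smooth) hθ.compact_support.mul_left
  have hTS : ∀ z, ‖z‖ < ρ + R → (fun x => S x * θ x) =ᶠ[𝓝 z] S := fun z hz => by
    filter_upwards [(isOpen_lt continuous_norm continuous_const).mem_nhds hz] with y hy
    rw [hθ1 y (le_of_lt hy), mul_one]
  refine ⟨_, hT, hTS, fun x hx => ?_⟩
  rw [conv_comm g]
  exact conv_eq_of_forall hg fun y hy => ((hTS (x - y) (by
    linarith [norm_sub_le x y])).self_of_nhds).symm

theorem contDiff_conv_left {S g : E3 → ℂ} (hS : ContDiff ℝ ∞ S) {R : ℝ}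
    (hg' : LocallyIntegrable g) (hg : ∀ y, R < ‖y‖ → g y = 0) : ContDiff ℝ ∞ (conv S g) := by
  rw [contDiff_iff_contDiffAt]
  intro x
  obtain ⟨T, hT, -, h⟩ := exists_test_conv_eq hS hg (‖x‖ + 1)
  refine (contDiff_conv hg' hT).contDiffAt.congr_of_eventuallyEq ?_
  filter_upwards [(isOpen_lt continuous_norm continuous_const).mem_nhds
    (show ‖x‖ < ‖x‖ + 1 by linarith)] with y hy using h y hy

/-! ### Young's inequality -/

theorem eLpNorm_two_sq (f : E3 → ℂ) (μ : Measure E3) :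
    eLpNorm f 2 μ ^ 2 = ∫⁻ x, ‖f x‖ₑ ^ 2 ∂μ := by
  have := eLpNorm_nnreal_pow_eq_lintegral (f := f) (μ := μ) (p := 2) two_ne_zero
  simpa using this

theorem aestronglyMeasurable_conv {K g : E3 → ℂ} (hK : AEStronglyMeasurable K)
    (hg : AEStronglyMeasurable g) : AEStronglyMeasurable (conv K g) :=
  (hK.convolution_integrand (ContinuousLinearMap.mul ℝ ℂ) hg).integral_prod_right'

/-- Young's inequality for `L¹ * L²`: Cauchy–Schwarz with the splitting `|K| = |K|^{1/2} |K|^{1/2}`,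
then Tonelli and translation invariance. Working with lower integrals avoids any convergence
question for `conv K g`. -/
theorem eLpNorm_conv_le {K g : E3 → ℂ} (hK : Integrable K) (hg : AEStronglyMeasurable g) :
    eLpNorm (conv K g) 2 ≤ ENNReal.ofReal (∫ x, ‖K x‖) * eLpNorm g 2 := by
  rw [← ENNReal.pow_le_pow_left_iff two_ne_zero, mul_pow, eLpNorm_two_sq, eLpNorm_two_sq]
  rw [ofReal_integral_norm_eq_lintegral_enorm hK]
  set A := ∫⁻ x, ‖K x‖ₑ with hA
  have hmeas : AEMeasurable (fun p : E3 × E3 => ‖K p.2‖ₑ * ‖g (p.1 - p.2)‖ₑ ^ 2)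
      (volume.prod volume) := by
    have h1 : AEStronglyMeasurable (fun p : E3 × E3 => K p.2) (volume.prod volume) :=
      hK.aestronglyMeasurable.comp_snd
    have h2 : AEStronglyMeasurable (fun p : E3 × E3 => g (p.1 - p.2)) (volume.prod volume) :=
      hg.comp_quasiMeasurePreserving
        (quasiMeasurePreserving_sub_of_right_invariant volume volume)
    exact h1.enorm.mul (h2.enorm.pow_const 2)
  have hpt : ∀ x, ‖conv K g x‖ₑ ^ 2 ≤ A * ∫⁻ y, ‖K y‖ₑ * ‖g (x - y)‖ₑ ^ 2 := by
    intro x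
    have hgx : AEStronglyMeasurable (fun y => g (x - y)) :=
      hg.comp_quasiMeasurePreserving (quasiMeasurePreserving_sub_left_of_right_invariant volume x)
    have h1 : ‖conv K g x‖ₑ ≤ ∫⁻ y, ‖K y‖ₑ ^ (1 / 2 : ℝ) *
        (‖K y‖ₑ * ‖g (x - y)‖ₑ ^ 2) ^ (1 / 2 : ℝ) := by
      refine (enorm_integral_le_lintegral_enorm _).trans_eq ?_
      congr 1 with y
      rw [ENNReal.mul_rpow_of_nonneg _ _ (by norm_num), ← mul_assoc,
        ← ENNReal.rpow_add_of_nonneg _ _ (by norm_num) (by norm_num), ← ENNReal.rpow_natCast,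
        ← ENNReal.rpow_mul]
      norm_num
    have h2 := ENNReal.lintegral_mul_norm_pow_le (μ := volume) hK.aestronglyMeasurable.enorm
      (hK.aestronglyMeasurable.enorm.mul (hgx.enorm.pow_const 2)) (p := 1 / 2) (q := 1 / 2)
      (by norm_num) (by norm_num) (by norm_num)
    calc ‖conv K g x‖ₑ ^ 2
        ≤ (A ^ (1 / 2 : ℝ) * (∫⁻ y, ‖K y‖ₑ * ‖g (x - y)‖ₑ ^ 2) ^ (1 / 2 : ℝ)) ^ 2 := by
          gcongr
          exact h1.trans h2
      _ = _ := by
          rw [mul_pow, ← ENNReal.rpow_natCast, ← ENNReal.rpow_natCast, ← ENNReal.rpow_mul,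
            ← ENNReal.rpow_mul]
          norm_num
  calc ∫⁻ x, ‖conv K g x‖ₑ ^ 2 ≤ ∫⁻ x, A * ∫⁻ y, ‖K y‖ₑ * ‖g (x - y)‖ₑ ^ 2 :=
        lintegral_mono hpt
    _ = A * ∫⁻ x, ∫⁻ y, ‖K y‖ₑ * ‖g (x - y)‖ₑ ^ 2 :=
        lintegral_const_mul'' _ hmeas.lintegral_prod_right'
    _ = A * ∫⁻ y, ∫⁻ x, ‖K y‖ₑ * ‖g (x - y)‖ₑ ^ 2 := by rw [lintegral_lintegral_swap hmeas]
    _ = A * ∫⁻ y, ‖K y‖ₑ * ∫⁻ x, ‖g x‖ₑ ^ 2 := by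
        congr 2 with y
        rw [lintegral_const_mul' _ _ enorm_ne_top,
          lintegral_sub_right_eq_self (fun x => ‖g x‖ₑ ^ 2) y]
    _ = A ^ 2 * ∫⁻ x, ‖g x‖ₑ ^ 2 := by
        rw [lintegral_mul_const'' _ hK.aestronglyMeasurable.enorm, ← mul_assoc, sq]

theorem memLp_conv {K g : E3 → ℂ} (hK : Integrable K) (hg : MemLp g 2) : MemLp (conv K g) 2 :=
  ⟨aestronglyMeasurable_conv hK.aestronglyMeasurable hg.aestronglyMeasurable,
    (eLpNorm_conv_le hK hg.aestronglyMeasurable).trans_lt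
      (ENNReal.mul_lt_top ENNReal.ofReal_lt_top hg.eLpNorm_lt_top)⟩

theorem integrable_conv_of_memLp {K g : E3 → ℂ} (hK : MemLp K 2) (hg : MemLp g 2) (x : E3) :
    Integrable fun y => K y * g (x - y) := by
  have : MemLp (fun y => g (x - y)) 2 :=
    hg.comp_measurePreserving (Measure.measurePreserving_sub_left volume x)
  exact hK.integrable_mul this

theorem conv_sub_right {K g g' : E3 → ℂ} (hK : MemLp K 2) (hg : MemLp g 2) (hg' : MemLp g' 2) :
    conv K (g - g') = conv K g - conv K g' := by
  ext x
  simp only [conv_apply, Pi.sub_apply, mul_sub]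
  exact integral_sub (integrable_conv_of_memLp hK hg x) (integrable_conv_of_memLp hK hg' x)

/-! ### Moving a convolution to the other side of a pairing -/

theorem integral_conv_mul_of_integrable {K g φ : E3 → ℂ} (hK : ∀ x, K (-x) = K x)
    (hint : Integrable (fun p : E3 × E3 => K (p.1 - p.2) * (φ p.1 * g p.2)) (volume.prod volume)) :
    ∫ x, conv K g x * φ x = ∫ y, g y * conv K φ y := by
  have h1 : ∀ x, conv K g x * φ x = ∫ y, K (x - y) * (φ x * g y) := fun x => by
    rw [conv_apply', ← integral_mul_const]
    congr 1 with y
    ring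
  have h2 : ∀ y, g y * conv K φ y = ∫ x, K (x - y) * (φ x * g y) := fun y => by
    rw [conv_apply', ← integral_const_mul]
    congr 1 with x
    rw [← hK (x - y), neg_sub]
    ring
  simp only [h1, h2]
  exact integral_integral_swap hint

theorem integrable_kernel_mul {K g φ : E3 → ℂ} {C : ℝ} (hKm : Measurable K)
    (hKb : ∀ x, ‖K x‖ ≤ C) (hg : Integrable g) (hφ : Integrable φ) :
    Integrable (fun p : E3 × E3 => K (p.1 - p.2) * (φ p.1 * g p.2)) (volume.prod volume) :=
  (hφ.mul_prod hg).bdd_mul (c := C)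
    (hKm.comp (measurable_fst.sub measurable_snd)).aestronglyMeasurable
    (Eventually.of_forall fun _ => hKb _)

theorem integral_conv_mul_of_bounded {K g φ : E3 → ℂ} {C : ℝ} (hK : ∀ x, K (-x) = K x)
    (hKm : Measurable K) (hKb : ∀ x, ‖K x‖ ≤ C) (hg : Integrable g) (hφ : Integrable φ) :
    ∫ x, conv K g x * φ x = ∫ y, g y * conv K φ y :=
  integral_conv_mul_of_integrable hK (integrable_kernel_mul hKm hKb hg hφ)

/-- Here `g` need not be integrable. The double integrand vanishes unless `y` lies within the sum of
the radii of the two supports, so `g` can be truncated there before Fubini is applied. -/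
theorem integral_conv_test_mul {K g φ : E3 → ℂ} (hK : ∀ x, K (-x) = K x)
    (hK' : IsTestFunction univ K) (hg : LocallyIntegrable g) (hφ : IsTestFunction univ φ) :
    ∫ x, conv K g x * φ x = ∫ y, g y * conv K φ y := by
  obtain ⟨r₁, hr₁⟩ := hK'.compact_support.isCompact.isBounded.subset_closedBall (0 : E3)
  obtain ⟨r₂, hr₂⟩ := hφ.compact_support.isCompact.isBounded.subset_closedBall (0 : E3)
  obtain ⟨C, hC⟩ := hK'.compact_support.exists_bound_of_continuous hK'.continuous
  set B := Metric.closedBall (0 : E3) (r₁ + r₂) with hB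
  have hgB : Integrable (B.indicator g) :=
    (integrable_indicator_iff Metric.isClosed_closedBall.measurableSet).2
      (hg.integrableOn_isCompact (isCompact_closedBall _ _))
  refine integral_conv_mul_of_integrable hK
    ((integrable_kernel_mul hK'.continuous.measurable hC hgB hφ.integrable).congr
      (Eventually.of_forall fun p => ?_))
  simp only
  by_cases hp : p.2 ∈ B
  · rw [indicator_of_mem hp]
  · rw [indicator_of_notMem hp]
    by_cases h1 : p.1 ∈ tsupport φ
    · by_cases h2 : p.1 - p.2 ∈ tsupport K
      · refine absurd ?_ hp
        have h3 := mem_closedBall_zero_iff.1 (hr₁ h2)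
        have h4 := mem_closedBall_zero_iff.1 (hr₂ h1)
        rw [hB, mem_closedBall_zero_iff]
        have h5 := norm_sub_le p.1 (p.1 - p.2)
        rw [sub_sub_cancel] at h5
        linarith
      · rw [image_eq_zero_of_notMem_tsupport h2]; simp
    · rw [image_eq_zero_of_notMem_tsupport h1]; simp

/-! ### Inverting `Δ² - κ⁴` on test functions -/

theorem partialDeriv_translate (φ : E3 → ℂ) (x : E3) (i : Fin 3) :
    partialDeriv i (fun y => φ (x + y)) = fun y => partialDeriv i φ (x + y) := by
  ext y
  simp only [partialDeriv]
  rw [fderiv_comp_add_left]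

theorem IsTestFunction.translate {φ : E3 → ℂ} (hφ : IsTestFunction univ φ) (x : E3) :
    IsTestFunction univ fun y => φ (x + y) :=
  isTestFunction_univ (hφ.smooth.comp (contDiff_const.add contDiff_id))
    (hφ.compact_support.comp_homeomorph (Homeomorph.addLeft x))

theorem laplacian_translate {φ : E3 → ℂ} (hφ : IsTestFunction univ φ) (x : E3) :
    Δ (fun y => φ (x + y)) = fun y => Δ φ (x + y) := by
  rw [laplacian_eq_sum hφ.smooth, laplacian_eq_sum (hφ.translate x).smooth]
  simp only [partialDeriv_translate]

theorem isTestFunction_bilaplacian_sub {φ : E3 → ℂ} (hφ : IsTestFunction univ φ) (c : ℂ) :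
    IsTestFunction univ fun x => Δ (Δ φ) x - c * φ x :=
  hφ.laplacian.laplacian.sub (hφ.const_mul c)

theorem bihKernel_neg (κ : ℝ) (x : E3) : bihKernel κ (-x) = bihKernel κ x := radial_neg _ x

theorem truncKernel_neg (κ a : ℝ) (x : E3) : truncKernel κ a (-x) = truncKernel κ a x :=
  radial_neg _ x

theorem errKernel_neg (κ a : ℝ) (x : E3) : errKernel κ a (-x) = errKernel κ a x := radial_neg _ x

theorem conv_bihKernel_bilaplacian_sub {κ : ℝ} (hκ : κ ≠ 0) {φ : E3 → ℂ}
    (hφ : IsTestFunction univ φ) :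
    conv (bihKernel κ) (fun x => Δ (Δ φ) x - (κ : ℂ) ^ 4 * φ x) = φ := by
  ext x
  rw [← conv_neg (bihKernel_neg κ)]
  have := integral_bihKernel_mul hκ (hφ.translate x)
  rw [laplacian_translate hφ, laplacian_translate hφ.laplacian, add_zero] at this
  exact this

theorem conv_truncKernel_bilaplacian_sub {κ : ℝ} (hκ : κ ≠ 0) {a : ℝ} (ha : 0 < a) {φ : E3 → ℂ}
    (hφ : IsTestFunction univ φ) (x : E3) :
    conv (truncKernel κ a) (fun x => Δ (Δ φ) x - (κ : ℂ) ^ 4 * φ x) x =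
      φ x + conv (errKernel κ a) φ x := by
  rw [← conv_neg (truncKernel_neg κ a), ← conv_neg (errKernel_neg κ a)]
  have := integral_truncKernel_mul hκ ha (hφ.translate x)
  rw [laplacian_translate hφ, laplacian_translate hφ.laplacian, add_zero] at this
  exact this

theorem locallyIntegrable_truncKernel (κ a : ℝ) : LocallyIntegrable (truncKernel κ a) :=
  locallyIntegrable_radial (contDiff_truncProfile κ a).continuous

theorem isTestFunction_conv_truncKernel (κ a : ℝ) {φ : E3 → ℂ} (hφ : IsTestFunction univ φ) :
    IsTestFunction univ (conv (truncKernel κ a) φ) :=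
  isTestFunction_conv (locallyIntegrable_truncKernel κ a) (hasCompactSupport_truncKernel κ a) hφ

/-- This is the parametrix identity `(Δ² - κ⁴)(K * φ) = φ + E * φ`. The derivatives are first moved
onto `φ`, where the distributional identity for `K` applies. -/
theorem bilaplacian_conv_truncKernel {κ : ℝ} (hκ : κ ≠ 0) {a : ℝ} (ha : 0 < a) {φ : E3 → ℂ}
    (hφ : IsTestFunction univ φ) :
    Δ (Δ (conv (truncKernel κ a) φ)) = fun x => φ x + conv (errKernel κ a) φ x +
      (κ : ℂ) ^ 4 * conv (truncKernel κ a) φ x := by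
  have hl := locallyIntegrable_truncKernel κ a
  rw [laplacian_conv hl hφ, laplacian_conv hl hφ.laplacian]
  ext x
  rw [← conv_truncKernel_bilaplacian_sub hκ ha hφ, ← conv_const_mul_right,
    ← conv_add_right hl (isTestFunction_bilaplacian_sub hφ _) (hφ.const_mul _)]
  simp

/-! ### `L²` bounds -/

theorem ofReal_sqNorm {φ : E3 → ℂ} (hφ : IsTestFunction univ φ) :
    ENNReal.ofReal (sqNorm φ) = eLpNorm φ 2 ^ 2 := by
  rw [eLpNorm_two_sq, sqNorm, ofReal_integral_eq_lintegral_ofReal (integrable_sq hφ)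
    (Eventually.of_forall fun _ => by positivity)]
  congr 1 with x
  rw [ENNReal.ofReal_pow (norm_nonneg _), ofReal_norm]

theorem eLpNorm_multiDeriv_le {φ : E3 → ℂ} (hφ : IsTestFunction univ φ) {α : Fin 3 → ℕ}
    (hα : α ∈ multiIndices 4) :
    eLpNorm (multiDeriv α φ) 2 ≤ 2 * (eLpNorm φ 2 + eLpNorm (Δ (Δ φ)) 2) := by
  rw [← ENNReal.pow_le_pow_left_iff two_ne_zero, ← ofReal_sqNorm (hφ.multiDeriv α)]
  refine (ENNReal.ofReal_le_ofReal (sqNorm_multiDeriv_le hφ hα)).trans ?_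
  rw [ENNReal.ofReal_mul zero_le_two, ENNReal.ofReal_add (sqNorm_nonneg _) (sqNorm_nonneg _),
    ofReal_sqNorm hφ, ofReal_sqNorm hφ.laplacian.laplacian, ENNReal.ofReal_ofNat, mul_pow]
  gcongr
  · norm_num
  · rw [add_sq]
    gcongr
    exact le_self_add

theorem add_le_const_mul_sq {C κ : ℝ} (hC : 0 < C) (hκ : 1 ≤ κ) :
    2 * (C / κ ^ 2 + (1 + C * κ + κ ^ 4 * (C / κ ^ 2))) ≤ 2 * (1 + 3 * C) * κ ^ 2 := by
  have hκ0 : 0 < κ := by linarith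
  have a4 : (1 : ℝ) ≤ κ ^ 2 := one_le_pow₀ hκ
  have a1 : C / κ ^ 2 ≤ C * κ ^ 2 := by
    rw [div_le_iff₀ (by positivity), mul_assoc]
    have : 1 ≤ κ ^ 2 * κ ^ 2 := by nlinarith
    nlinarith
  have a2 : κ ^ 4 * (C / κ ^ 2) = C * κ ^ 2 := by field_simp
  have a3 : κ ≤ κ ^ 2 := by nlinarith
  rw [a2]
  linarith [mul_le_mul_of_nonneg_left a3 hC.le]

/-- The three terms of the parametrix identity contribute `1`, `Cκ` and `κ⁴ · C/κ²`. The last one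
fixes the power `κ²` of the final estimate. -/
theorem exists_eLpNorm_multiDeriv_conv_le (a : ℝ) (ha : 0 < a) :
    ∃ C : ℝ, 0 < C ∧ ∀ κ : ℝ, 1 ≤ κ → ∀ α ∈ multiIndices 4, ∀ φ, IsTestFunction univ φ →
      eLpNorm (multiDeriv α (conv (truncKernel κ a) φ)) 2 ≤
        ENNReal.ofReal (C * κ ^ 2) * eLpNorm φ 2 := by
  obtain ⟨C, hC0, hC⟩ := exists_integral_norm_kernel_le a ha
  refine ⟨2 * (1 + 3 * C), by positivity, fun κ hκ α hα φ hφ => ?_⟩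
  have hκ0 : 0 < κ := by linarith
  obtain ⟨hC1, hC2⟩ := hC κ hκ
  have hU := isTestFunction_conv_truncKernel κ a hφ
  have hE := isTestFunction_errKernel κ ha
  have hEc := isTestFunction_conv hE.continuous.locallyIntegrable hE.compact_support hφ
  have h1 : eLpNorm (conv (truncKernel κ a) φ) 2 ≤ ENNReal.ofReal (C / κ ^ 2) * eLpNorm φ 2 :=
    (eLpNorm_conv_le (integrable_truncKernel hκ0 a) hφ.continuous.aestronglyMeasurable).trans
      (by gcongr)
  have h2 : eLpNorm (conv (errKernel κ a) φ) 2 ≤ ENNReal.ofReal (C * κ) * eLpNorm φ 2 :=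
    (eLpNorm_conv_le hE.integrable hφ.continuous.aestronglyMeasurable).trans (by gcongr)
  have h3 : eLpNorm (Δ (Δ (conv (truncKernel κ a) φ))) 2 ≤
      ENNReal.ofReal (1 + C * κ + κ ^ 4 * (C / κ ^ 2)) * eLpNorm φ 2 := by
    rw [bilaplacian_conv_truncKernel hκ0.ne' ha hφ]
    have e1 : (fun x => φ x + conv (errKernel κ a) φ x +
        (κ : ℂ) ^ 4 * conv (truncKernel κ a) φ x) =
        (φ + conv (errKernel κ a) φ) + ((κ : ℂ) ^ 4) • conv (truncKernel κ a) φ := rfl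
    have e2 : ‖(κ : ℂ) ^ 4‖ₑ = ENNReal.ofReal (κ ^ 4) := by
      rw [← ofReal_norm, norm_pow, Complex.norm_real, Real.norm_of_nonneg hκ0.le]
    rw [e1, ENNReal.ofReal_add (by positivity) (by positivity),
      ENNReal.ofReal_add zero_le_one (by positivity), ENNReal.ofReal_mul (by positivity : 0 ≤ κ ^ 4),
      ENNReal.ofReal_one, add_mul, add_mul, one_mul, mul_assoc]
    refine (eLpNorm_add_le (hφ.add hEc).continuous.aestronglyMeasurable
      (hU.continuous.const_smul _).aestronglyMeasurable one_le_two).trans ?_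
    rw [eLpNorm_const_smul, e2]
    gcongr
    refine (eLpNorm_add_le hφ.continuous.aestronglyMeasurable
      hEc.continuous.aestronglyMeasurable one_le_two).trans ?_
    gcongr
  refine (eLpNorm_multiDeriv_le hU hα).trans ?_
  refine (mul_le_mul_right (add_le_add h1 h3) _).trans ?_
  have e : ∀ X : ℝ, (2 : ℝ≥0∞) * ENNReal.ofReal X = ENNReal.ofReal (2 * X) := fun X => by
    rw [ENNReal.ofReal_mul zero_le_two, ENNReal.ofReal_ofNat]
  rw [← add_mul, ← mul_assoc, ← ENNReal.ofReal_add (by positivity) (by positivity), e]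
  exact mul_le_mul_left (ENNReal.ofReal_le_ofReal (add_le_const_mul_sq hC0 hκ)) _

/-! ### Weak derivatives of a convolution -/

theorem foldr_sub {φ ψ : E3 → ℂ} (hφ : ContDiff ℝ ∞ φ) (hψ : ContDiff ℝ ∞ ψ) (l : List (Fin 3)) :
    l.foldr partialDeriv (fun x => φ x - ψ x) =
      fun x => l.foldr partialDeriv φ x - l.foldr partialDeriv ψ x := by
  induction l with
  | nil => rfl
  | cons i l ih =>
    ext x
    rw [List.foldr_cons, ih]
    simp only [partialDeriv, List.foldr_cons]
    rw [fderiv_fun_sub ((contDiff_foldr hφ l).differentiable (by simp) x)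
      ((contDiff_foldr hψ l).differentiable (by simp) x)]
    rfl

theorem enorm_integral_mul_le {f φ : E3 → ℂ} (hf : AEStronglyMeasurable f)
    (hφ : AEStronglyMeasurable φ) :
    ‖∫ x, f x * φ x‖ₑ ≤ eLpNorm f 2 * eLpNorm φ 2 := by
  refine (enorm_integral_le_lintegral_enorm _).trans ?_
  have := eLpNorm_smul_le_mul_eLpNorm (μ := volume) hφ hf (p := 2) (q := 2) (r := 1)
  rwa [eLpNorm_one_eq_lintegral_enorm] at this

theorem tendsto_integral_mul {f : ℕ → E3 → ℂ} {g φ : E3 → ℂ} (hf : ∀ n, MemLp (f n) 2)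
    (hg : MemLp g 2) (hφ : MemLp φ 2)
    (h : Tendsto (fun n => eLpNorm (f n - g) 2) atTop (𝓝 0)) :
    Tendsto (fun n => ∫ x, f n x * φ x) atTop (𝓝 (∫ x, g x * φ x)) := by
  rw [tendsto_iff_edist_tendsto_0]
  refine tendsto_of_tendsto_of_tendsto_of_le_of_le tendsto_const_nhds
    (h := fun n => eLpNorm (f n - g) 2 * eLpNorm φ 2) ?_ (fun _ => zero_le) fun n => ?_
  · simpa using ENNReal.Tendsto.mul_const h (Or.inr hφ.eLpNorm_ne_top)
  · simp only
    have i1 : Integrable fun x => f n x * φ x := (hf n).integrable_mul hφ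
    have i2 : Integrable fun x => g x * φ x := hg.integrable_mul hφ
    rw [edist_eq_enorm_sub, ← integral_sub i1 i2]
    simp only [← sub_mul]
    exact enorm_integral_mul_le ((hf n).sub hg).aestronglyMeasurable hφ.aestronglyMeasurable

/-- Test functions converging to `g` in `L²` have convolutions whose `α`-derivatives are Cauchy, by
`hA` applied to differences. The `L²` limit is the weak derivative, because the integration by parts
formula passes to the limit on both sides. -/
theorem exists_weakDeriv_conv {K : E3 → ℂ} (hK : Integrable K) (hK2 : MemLp K 2)
    (hKc : HasCompactSupport K) {α : Fin 3 → ℕ} {A : ℝ} (hA0 : 0 ≤ A)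
    (hA : ∀ φ, IsTestFunction univ φ →
      eLpNorm (multiDeriv α (conv K φ)) 2 ≤ ENNReal.ofReal A * eLpNorm φ 2)
    {g : E3 → ℂ} (hg : MemLp g 2) :
    ∃ h : E3 → ℂ, MemLp h 2 ∧ eLpNorm h 2 ≤ ENNReal.ofReal A * eLpNorm g 2 ∧
      ∀ φ, IsTestFunction univ φ →
        ∫ x, conv K g x * multiDeriv α φ x = (-1) ^ order α * ∫ x, h x * φ x := by
  have hKl := hK.locallyIntegrable
  have hex : ∀ n : ℕ, ∃ φ : E3 → ℂ, IsTestFunction univ φ ∧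
      eLpNorm (g - φ) 2 ≤ ENNReal.ofReal (1 / ((n : ℝ) + 1)) := fun n => by
    obtain ⟨φ, h1, h2, h3⟩ := hg.exist_eLpNorm_sub_le (by simp) one_le_two
      (ε := 1 / ((n : ℝ) + 1)) (by positivity)
    exact ⟨φ, isTestFunction_univ h2 h1, h3⟩
  choose s hs hsg using hex
  have hlim0 : Tendsto (fun n : ℕ => ENNReal.ofReal (1 / ((n : ℝ) + 1))) atTop (𝓝 0) := by
    simpa using ENNReal.tendsto_ofReal (tendsto_one_div_add_atTop_nhds_zero_nat (𝕜 := ℝ))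
  have hU : ∀ n, IsTestFunction univ (conv K (s n)) := fun n => isTestFunction_conv hKl hKc (hs n)
  have hdiff : ∀ n m, eLpNorm (multiDeriv α (conv K (s n)) - multiDeriv α (conv K (s m))) 2 ≤
      ENNReal.ofReal A * eLpNorm (s n - s m) 2 := fun n m => by
    have e1 : multiDeriv α (conv K (s n)) - multiDeriv α (conv K (s m)) =
        multiDeriv α (conv K (s n - s m)) := by
      rw [conv_sub_right hK2 ((hs n).memLp 2) ((hs m).memLp 2)]
      obtain ⟨l, -, hl⟩ := exists_list_multiDeriv α
      rw [hl, hl, hl]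
      exact (foldr_sub (hU n).smooth (hU m).smooth l).symm
    rw [e1]
    exact hA _ ((hs n).sub (hs m))
  let F : ℕ → Lp ℂ 2 (volume : Measure E3) := fun n => (((hU n).multiDeriv α).memLp 2).toLp
  have hcauchy : CauchySeq F := by
    refine cauchySeq_of_le_tendsto_0 (fun N : ℕ => 2 * A * (1 / ((N : ℝ) + 1)))
      (fun n m N hn hm => ?_) ?_
    · rw [dist_eq_norm, ← MemLp.toLp_sub, Lp.norm_toLp]
      refine ENNReal.toReal_le_of_le_ofReal (by positivity) ((hdiff n m).trans ?_)
      have hN : ∀ k, N ≤ k → eLpNorm (g - s k) 2 ≤ ENNReal.ofReal (1 / ((N : ℝ) + 1)) :=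
        fun k hk => (hsg k).trans (by gcongr)
      have e2 : s n - s m = (g - s m) - (g - s n) := by abel
      have h4 : eLpNorm (s n - s m) 2 ≤ 2 * ENNReal.ofReal (1 / ((N : ℝ) + 1)) := by
        rw [e2, two_mul]
        exact (eLpNorm_sub_le (hg.sub ((hs m).memLp 2)).aestronglyMeasurable
          (hg.sub ((hs n).memLp 2)).aestronglyMeasurable one_le_two).trans
          (add_le_add (hN m hm) (hN n hn))
      refine (mul_le_mul_right h4 _).trans_eq ?_
      rw [ENNReal.ofReal_mul (by positivity), ENNReal.ofReal_mul zero_le_two,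
        ENNReal.ofReal_ofNat]
      ring
    · simpa using (tendsto_one_div_add_atTop_nhds_zero_nat (𝕜 := ℝ)).const_mul (2 * A)
  obtain ⟨F₀, hF'⟩ := cauchySeq_tendsto_of_complete hcauchy
  obtain ⟨F', hF'e⟩ : ∃ F' : E3 → ℂ, F' = F₀ := ⟨_, rfl⟩
  have hF'm : MemLp F' 2 := hF'e ▸ Lp.memLp F₀
  have hF'2 : Tendsto (fun n => eLpNorm (multiDeriv α (conv K (s n)) - F') 2) atTop (𝓝 0) := by
    have h5 := (Lp.tendsto_Lp_iff_tendsto_eLpNorm' F F₀).1 hF'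
    rw [← hF'e] at h5
    refine h5.congr fun n => eLpNorm_congr_ae ?_
    filter_upwards [(((hU n).multiDeriv α).memLp 2).coeFn_toLp] with x hx
    simp only [Pi.sub_apply, F, hx]
  have hgs : Tendsto (fun n => eLpNorm (s n - g) 2) atTop (𝓝 0) := by
    refine tendsto_of_tendsto_of_tendsto_of_le_of_le tendsto_const_nhds hlim0
      (fun _ => zero_le) fun n => ?_
    simp only
    rw [eLpNorm_sub_comm]
    exact hsg n
  refine ⟨F', hF'm, ?_, fun φ hφ => ?_⟩
  · have h6 : ∀ n, eLpNorm F' 2 ≤ eLpNorm (multiDeriv α (conv K (s n)) - F') 2 +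
        ENNReal.ofReal A * (eLpNorm (s n - g) 2 + eLpNorm g 2) := fun n => by
      have e3 : F' = multiDeriv α (conv K (s n)) -
          (multiDeriv α (conv K (s n)) - F') := by abel
      have e4 : s n = (s n - g) + g := by abel
      have m1 := ((hU n).multiDeriv α).memLp 2
      have b1 : eLpNorm F' 2 ≤ eLpNorm (multiDeriv α (conv K (s n))) 2 +
          eLpNorm (multiDeriv α (conv K (s n)) - F') 2 := by
        conv_lhs => rw [e3]
        exact eLpNorm_sub_le m1.aestronglyMeasurable
          (m1.sub hF'm).aestronglyMeasurable one_le_two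
      have b2 : eLpNorm (s n) 2 ≤ eLpNorm (s n - g) 2 + eLpNorm g 2 := by
        conv_lhs => rw [e4]
        exact eLpNorm_add_le (((hs n).memLp 2).sub hg).aestronglyMeasurable
          hg.aestronglyMeasurable one_le_two
      rw [add_comm]
      exact b1.trans (add_le_add_left ((hA _ (hs n)).trans (mul_le_mul_right b2 _)) _)
    have h7 := hF'2.add (ENNReal.Tendsto.const_mul (a := ENNReal.ofReal A)
      (hgs.add (tendsto_const_nhds (x := eLpNorm g 2))) (Or.inr ENNReal.ofReal_ne_top))
    rw [zero_add, zero_add] at h7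
    exact ge_of_tendsto' h7 h6
  · have l1 := tendsto_integral_mul (fun n => ((hU n).multiDeriv α).memLp 2) hF'm
      (hφ.memLp 2) hF'2
    have hconv : Tendsto (fun n => eLpNorm (conv K (s n) - conv K g) 2) atTop (𝓝 0) := by
      refine tendsto_of_tendsto_of_tendsto_of_le_of_le tendsto_const_nhds
        (h := fun n => ENNReal.ofReal (∫ x, ‖K x‖) * eLpNorm (s n - g) 2) ?_ (fun _ => zero_le)
        fun n => ?_
      · simpa using ENNReal.Tendsto.const_mul (a := ENNReal.ofReal (∫ x, ‖K x‖)) hgs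
          (Or.inr ENNReal.ofReal_ne_top)
      · simp only
        rw [← conv_sub_right hK2 ((hs n).memLp 2) hg]
        exact eLpNorm_conv_le hK (((hs n).memLp 2).sub hg).aestronglyMeasurable
    have l2 := tendsto_integral_mul (fun n => (hU n).memLp 2) (memLp_conv hK hg)
      ((hφ.multiDeriv α).memLp 2) hconv
    refine tendsto_nhds_unique l2 ((l1.const_mul ((-1) ^ order α)).congr fun n => ?_)
    rw [integral_mul_multiDeriv (hU n).smooth hφ]

/-! ### Potentials of compactly supported sources away from the source -/

theorem laplacian_conv_left {S g : E3 → ℂ} (hS : ContDiff ℝ ∞ S) {R : ℝ}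
    (hg' : LocallyIntegrable g) (hg : ∀ y, R < ‖y‖ → g y = 0) :
    Δ (conv S g) = conv (Δ S) g := by
  ext x
  obtain ⟨T, hT, hTS, h⟩ := exists_test_conv_eq hS hg (‖x‖ + 1)
  have hev : conv S g =ᶠ[𝓝 x] conv g T := by
    filter_upwards [(isOpen_lt continuous_norm continuous_const).mem_nhds
      (show ‖x‖ < ‖x‖ + 1 by linarith)] with y hy using h y hy
  rw [(InnerProductSpace.laplacian_congr_nhds hev).eq_of_nhds, laplacian_conv hg' hT, conv_comm]
  refine conv_eq_of_forall hg fun y hy => ?_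
  exact (InnerProductSpace.laplacian_congr_nhds
    (hTS (x - y) (by linarith [norm_sub_le x y]))).eq_of_nhds

theorem fderiv_conv_left {S g : E3 → ℂ} (hS : ContDiff ℝ ∞ S) {R : ℝ}
    (hg' : LocallyIntegrable g) (hg : ∀ y, R < ‖y‖ → g y = 0) (x v : E3) :
    fderiv ℝ (conv S g) x v = conv (fun z => fderiv ℝ S z v) g x := by
  obtain ⟨T, hT, hTS, h⟩ := exists_test_conv_eq hS hg (‖x‖ + 1)
  have hev : conv S g =ᶠ[𝓝 x] conv g T := by
    filter_upwards [(isOpen_lt continuous_norm continuous_const).mem_nhds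
      (show ‖x‖ < ‖x‖ + 1 by linarith)] with y hy using h y hy
  have h1 := hT.compact_support.hasFDerivAt_convolution_right (ContinuousLinearMap.mul ℝ ℂ) hg'
    (hT.smooth.of_le (WithTop.coe_le_coe.2 le_top)) x
  have h2 : fderiv ℝ (conv g T) x v = conv g (fun z => fderiv ℝ T z v) x := by
    change fderiv ℝ (MeasureTheory.convolution g T (ContinuousLinearMap.mul ℝ ℂ) volume) x _ = _
    rw [h1.fderiv, convolution_precompR_apply _ hg' (hT.compact_support.fderiv ℝ)
      (hT.smooth.continuous_fderiv (by simp))]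
    rfl
  rw [hev.fderiv_eq, h2, conv_comm]
  refine conv_eq_of_forall hg fun y hy => ?_
  simp only [(hTS (x - y) (by linarith [norm_sub_le x y])).fderiv_eq]

theorem exists_smooth_eq_radial {h : ℝ → ℂ} (hh : ContDiff ℝ ∞ h) {δ : ℝ} (hδ : 0 < δ) :
    ∃ S : E3 → ℂ, ContDiff ℝ ∞ S ∧ ∀ z, δ ≤ ‖z‖ → S z = radial h z := by
  refine ⟨radial fun r => step (2 / δ * r - 1) * h r, contDiff_radial (δ := δ / 2)
    ((contDiff_step.comp ((contDiff_const.mul contDiff_id).sub contDiff_const)).mul hh)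
    (by positivity) fun r hr => ?_, fun z hz => ?_⟩
  · rw [step_of_nonpos, zero_mul]
    rw [sub_nonpos, div_mul_eq_mul_div, div_le_one hδ]
    linarith
  · simp only [radial]
    rw [step_of_one_le, one_mul]
    have : 2 ≤ 2 / δ * ‖z‖ := by
      rw [div_mul_eq_mul_div, le_div_iff₀ hδ]
      linarith
    linarith

theorem conv_radial_eq {h : ℝ → ℂ} {g S : E3 → ℂ} {R δ : ℝ} (hg : ∀ y, R < ‖y‖ → g y = 0)
    (hS : ∀ z, δ ≤ ‖z‖ → S z = radial h z) {x : E3} (hx : R + δ ≤ ‖x‖) :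
    conv (radial h) g x = conv S g x :=
  conv_eq_of_forall hg fun y hy => (hS _ (by linarith [norm_sub_norm_le x y])).symm

/-- Near a point outside the ball that carries the source, the potential with kernel `radial h` is
a potential with smooth kernel. -/
theorem exists_smooth_kernel {h : ℝ → ℂ} (hh : ContDiff ℝ ∞ h) {g : E3 → ℂ} {R : ℝ}
    (hg : ∀ y, R < ‖y‖ → g y = 0) {x : E3} (hx : R < ‖x‖) :
    ∃ S : E3 → ℂ, ContDiff ℝ ∞ S ∧ conv (radial h) g =ᶠ[𝓝 x] conv S g ∧
      ∀ y, ‖y‖ ≤ R → S =ᶠ[𝓝 (x - y)] radial h := by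
  -- Smoothing only within half the gap between `x` and the source ball keeps the kernel unchanged
  -- at `z - y` for all `z` near `x`, not merely at `x - y`. Derivatives of the potential then agree
  -- too.
  obtain ⟨S, hS, hSr⟩ := exists_smooth_eq_radial hh (δ := (‖x‖ - R) / 2) (by linarith)
  refine ⟨S, hS, ?_, fun y hy => ?_⟩
  · filter_upwards [(isOpen_lt continuous_const continuous_norm).mem_nhds
      (show (R + ‖x‖) / 2 < ‖x‖ by linarith)] with z hz
    exact conv_radial_eq hg hSr (by linarith [show (R + ‖x‖) / 2 < ‖z‖ from hz])
  · filter_upwards [(isOpen_lt continuous_const continuous_norm).mem_nhds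
      (show (‖x‖ - R) / 2 < ‖x - y‖ by linarith [norm_sub_norm_le x y])] with z hz
    exact hSr z (le_of_lt hz)

theorem contDiffAt_conv_radial {h : ℝ → ℂ} (hh : ContDiff ℝ ∞ h) {g : E3 → ℂ} {R : ℝ}
    (hg' : LocallyIntegrable g) (hg : ∀ y, R < ‖y‖ → g y = 0) {x : E3} (hx : R < ‖x‖) :
    ContDiffAt ℝ ∞ (conv (radial h) g) x := by
  obtain ⟨S, hS, hev, -⟩ := exists_smooth_kernel hh hg hx
  exact (contDiff_conv_left hS hg' hg).contDiffAt.congr_of_eventuallyEq hev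

theorem fderiv_conv_radial {h : ℝ → ℂ} (hh : ContDiff ℝ ∞ h) {g : E3 → ℂ} {R : ℝ}
    (hg' : LocallyIntegrable g) (hg : ∀ y, R < ‖y‖ → g y = 0) {x : E3} (hx : R < ‖x‖) (v : E3) :
    fderiv ℝ (conv (radial h) g) x v = conv (fun z => fderiv ℝ (radial h) z v) g x := by
  obtain ⟨S, hS, hev, hSr⟩ := exists_smooth_kernel hh hg hx
  rw [hev.fderiv_eq, fderiv_conv_left hS hg' hg]
  refine conv_eq_of_forall hg fun y hy => ?_
  simp only [(hSr y hy).fderiv_eq]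

theorem laplacian_conv_radial {h : ℝ → ℂ} (hh : ContDiff ℝ ∞ h) {g : E3 → ℂ} {R : ℝ}
    (hg' : LocallyIntegrable g) (hg : ∀ y, R < ‖y‖ → g y = 0) {x : E3} (hx : R < ‖x‖) :
    Δ (conv (radial h) g) x = conv (radial (deriv (deriv h))) g x := by
  obtain ⟨S, hS, hev, hSr⟩ := exists_smooth_kernel hh hg hx
  rw [(InnerProductSpace.laplacian_congr_nhds hev).eq_of_nhds, laplacian_conv_left hS hg' hg]
  refine conv_eq_of_forall hg fun y hy => ?_
  rw [(InnerProductSpace.laplacian_congr_nhds (hSr y hy)).eq_of_nhds]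
  refine laplacian_radial_of_ne hh fun h0 => ?_
  rw [sub_eq_zero.1 h0] at hx
  linarith

theorem integrable_conv_radial {h : ℝ → ℂ} (hh : ContDiff ℝ ∞ h) {g : E3 → ℂ} {R : ℝ}
    (hg' : LocallyIntegrable g) (hg : ∀ y, R < ‖y‖ → g y = 0) {x : E3} (hx : R < ‖x‖) :
    Integrable fun y => radial h (x - y) * g y := by
  obtain ⟨S, hS, hSr⟩ := exists_smooth_eq_radial hh (δ := ‖x‖ - R) (by linarith)
  obtain ⟨θ, hθ, hθ1, -⟩ := exists_plateau R
  have hφ : IsTestFunction univ fun y => S (x - y) * θ y :=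
    isTestFunction_univ ((hS.comp (contDiff_const.sub contDiff_id)).mul hθ.smooth)
      hθ.compact_support.mul_left
  refine (integrable_mul_test hg' hφ).congr (Eventually.of_forall fun y => ?_)
  by_cases hy : R < ‖y‖
  · simp [hg y hy]
  · simp only
    rw [hθ1 y (not_lt.1 hy), hSr _ (by linarith [norm_sub_norm_le x y, not_lt.1 hy])]
    ring

theorem integrable_conv_fderiv_radial {h : ℝ → ℂ} (hh : ContDiff ℝ ∞ h) {g : E3 → ℂ} {R : ℝ}
    (hg' : LocallyIntegrable g) (hg : ∀ y, R < ‖y‖ → g y = 0) {x : E3} (hx : R < ‖x‖) (v : E3) :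
    Integrable fun y => fderiv ℝ (radial h) (x - y) v * g y := by
  obtain ⟨S, hS, -, hSr⟩ := exists_smooth_kernel hh hg hx
  obtain ⟨θ, hθ, hθ1, -⟩ := exists_plateau R
  have hS' : ContDiff ℝ ∞ fun z => fderiv ℝ S z v :=
    (hS.fderiv_right (m := ∞) (by simp)).clm_apply contDiff_const
  have hφ : IsTestFunction univ fun y => fderiv ℝ S (x - y) v * θ y :=
    isTestFunction_univ ((hS'.comp (contDiff_const.sub contDiff_id)).mul hθ.smooth)
      hθ.compact_support.mul_left
  refine (integrable_mul_test hg' hφ).congr (Eventually.of_forall fun y => ?_)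
  by_cases hy : R < ‖y‖
  · simp [hg y hy]
  · simp only
    rw [hθ1 y (not_lt.1 hy), (hSr y (not_lt.1 hy)).fderiv_eq]
    ring

/-! ### The radiation condition for potentials -/

theorem fderiv_radial {h : ℝ → ℂ} (hh : ContDiff ℝ ∞ h) {x : E3} (hx : x ≠ 0) (v : E3) :
    fderiv ℝ (radial h) x v = ((inner ℝ x v : ℝ) : ℂ) *
      (deriv h ‖x‖ * ((‖x‖ : ℂ) ^ 2)⁻¹ - h ‖x‖ * ((‖x‖ : ℂ) ^ 3)⁻¹) := by
  have hr : (‖x‖ : ℂ) ≠ 0 := by simpa using hx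
  have hcast : HasDerivAt (fun r : ℝ => (r : ℂ)) 1 ‖x‖ := Complex.ofRealCLM.hasDerivAt
  have h1 : HasDerivAt (fun r : ℝ => ((r⁻¹ : ℝ) : ℂ) * h r)
      ((-1) / (‖x‖ : ℂ) ^ 2 * h ‖x‖ + (‖x‖ : ℂ)⁻¹ * deriv h ‖x‖) ‖x‖ := by
    have := (hcast.fun_inv hr).fun_mul (hasDerivAt_of_contDiff hh ‖x‖)
    simp only [Complex.ofReal_inv]
    exact this
  change fderiv ℝ (fun y : E3 => ((‖y‖⁻¹ : ℝ) : ℂ) * h ‖y‖) x v = _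
  rw [(hasFDerivAt_comp_norm hx h1).fderiv]
  simp
  field_simp
  ring

/-- The profile `h` of a radial kernel for which `∂_r - iκ` gains one power of `|x|`, uniformly for
sources in bounded sets. -/
structure IsRadiatingProfile (κ : ℝ) (h : ℝ → ℂ) : Prop where
  smooth : ContDiff ℝ ∞ h
  bound : ∀ R : ℝ, 0 ≤ R → ∃ M : ℝ, ∀ x y : E3, 2 * R + 2 ≤ ‖x‖ → ‖y‖ ≤ R →
    ‖x‖ * ‖fderiv ℝ (radial h) (x - y) (‖x‖⁻¹ • x) - Complex.I * κ * radial h (x - y)‖ ≤ M / ‖x‖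

theorem IsRadiatingProfile.linear {κ : ℝ} {h₁ h₂ : ℝ → ℂ} (H₁ : IsRadiatingProfile κ h₁)
    (H₂ : IsRadiatingProfile κ h₂) (a b : ℂ) :
    IsRadiatingProfile κ fun r => a * h₁ r + b * h₂ r := by
  refine ⟨(contDiff_const.mul H₁.smooth).add (contDiff_const.mul H₂.smooth), fun R hR => ?_⟩
  obtain ⟨M₁, hM₁⟩ := H₁.bound R hR
  obtain ⟨M₂, hM₂⟩ := H₂.bound R hR
  refine ⟨‖a‖ * M₁ + ‖b‖ * M₂, fun x y hx hy => ?_⟩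
  have hz : x - y ≠ 0 := fun h0 => by rw [sub_eq_zero.1 h0] at hx; linarith
  have hd : ∀ r, deriv (fun r => a * h₁ r + b * h₂ r) r = a * deriv h₁ r + b * deriv h₂ r :=
    fun r => (((hasDerivAt_of_contDiff H₁.smooth r).const_mul a).fun_add
      ((hasDerivAt_of_contDiff H₂.smooth r).const_mul b)).deriv
  have e : fderiv ℝ (radial fun r => a * h₁ r + b * h₂ r) (x - y) (‖x‖⁻¹ • x) -
      Complex.I * κ * radial (fun r => a * h₁ r + b * h₂ r) (x - y) =
      a * (fderiv ℝ (radial h₁) (x - y) (‖x‖⁻¹ • x) - Complex.I * κ * radial h₁ (x - y)) +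
      b * (fderiv ℝ (radial h₂) (x - y) (‖x‖⁻¹ • x) - Complex.I * κ * radial h₂ (x - y)) := by
    rw [fderiv_radial H₁.smooth hz, fderiv_radial H₂.smooth hz,
      fderiv_radial ((contDiff_const.mul H₁.smooth).add (contDiff_const.mul H₂.smooth)) hz, hd]
    simp only [radial]
    ring
  rw [e]
  calc _ ≤ ‖x‖ * (‖a‖ * ‖fderiv ℝ (radial h₁) (x - y) (‖x‖⁻¹ • x) -
          Complex.I * κ * radial h₁ (x - y)‖ + ‖b‖ * ‖fderiv ℝ (radial h₂) (x - y) (‖x‖⁻¹ • x) -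
          Complex.I * κ * radial h₂ (x - y)‖) := by
        gcongr
        exact (norm_add_le _ _).trans (by rw [norm_mul, norm_mul])
    _ = ‖a‖ * (‖x‖ * ‖fderiv ℝ (radial h₁) (x - y) (‖x‖⁻¹ • x) -
          Complex.I * κ * radial h₁ (x - y)‖) + ‖b‖ * (‖x‖ * ‖fderiv ℝ (radial h₂) (x - y)
          (‖x‖⁻¹ • x) - Complex.I * κ * radial h₂ (x - y)‖) := by ring
    _ ≤ ‖a‖ * (M₁ / ‖x‖) + ‖b‖ * (M₂ / ‖x‖) := by
        gcongr
        · exact hM₁ x y hx hy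
        · exact hM₂ x y hx hy
    _ = _ := by ring

theorem fderiv_radial_helmProfile_sub (μ ν : ℂ) {z : E3} (hz : z ≠ 0) (v : E3) :
    fderiv ℝ (radial (helmProfile μ)) z v - ν * radial (helmProfile μ) z =
      helmProfile μ ‖z‖ / ‖z‖ * (((inner ℝ z v / ‖z‖ : ℝ) : ℂ) * (Complex.I * μ - 1 / ‖z‖) - ν) := by
  have hr : (‖z‖ : ℂ) ≠ 0 := by simpa using hz
  rw [fderiv_radial (contDiff_helmProfile μ) hz, deriv_helmProfile, radial]
  push_cast
  field_simp

/-- With `c` the cosine of the angle between `x - y` and `x`, and `r = ‖x - y‖`, the quantity is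
`(e^{iκr}/4πr)(iκ(c - 1) - c/r)`. For bounded `y` one has `1 - c = O(1/‖x‖)`, so both factors are
`O(1/‖x‖)`. -/
theorem isRadiatingProfile_helmProfile {κ : ℝ} (hκ : 0 < κ) :
    IsRadiatingProfile κ (helmProfile κ) := by
  refine ⟨contDiff_helmProfile _, fun R hR => ⟨2 * κ * R + 2, fun x y hx hy => ?_⟩⟩
  have hρ : 0 < ‖x‖ := by linarith
  have hr2 : ‖x‖ / 2 ≤ ‖x - y‖ := by linarith [norm_sub_norm_le x y]
  have hr0 : 0 < ‖x - y‖ := by linarith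
  have hz : x - y ≠ 0 := norm_pos_iff.1 hr0
  have h1 : ‖helmProfile κ ‖x - y‖‖ ≤ 1 / 2 := by
    rw [norm_helmProfile]
    simp only [Complex.ofReal_im, zero_mul, neg_zero, Real.exp_zero]
    rw [div_le_div_iff₀ (by positivity) two_pos]
    linarith [Real.pi_gt_three]
  rw [fderiv_radial_helmProfile_sub _ _ hz]
  set c : ℝ := inner ℝ (x - y) (‖x‖⁻¹ • x) / ‖x - y‖ with hc
  have hv : ‖(‖x‖⁻¹ • x : E3)‖ = 1 := by rw [norm_smul, norm_inv, norm_norm, inv_mul_cancel₀ hρ.ne']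
  have hc1 : |c| ≤ 1 := by
    rw [hc, abs_div, abs_norm, div_le_one hr0]
    simpa [hv] using abs_real_inner_le_norm (x - y) (‖x‖⁻¹ • x)
  have hc2 : |c - 1| ≤ 2 * R / ‖x‖ := by
    -- Splitting `⟨x - y, x⟩ = ‖x - y‖² + ⟨x - y, y⟩` exposes two terms of size at most `‖x - y‖ R`
    -- each.
    have e : c - 1 = (‖x - y‖ * (‖x - y‖ - ‖x‖) + inner ℝ (x - y) y) / (‖x - y‖ * ‖x‖) := by
      have : inner ℝ (x - y) x = ‖x - y‖ ^ 2 + inner ℝ (x - y) y := by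
        rw [← real_inner_self_eq_norm_sq, ← inner_add_right]
        simp
      rw [hc, inner_smul_right, this]
      field_simp
      ring
    rw [e, abs_div, abs_of_pos (by positivity : 0 < ‖x - y‖ * ‖x‖),
      div_le_div_iff₀ (by positivity) hρ]
    have a1 : |‖x - y‖ - ‖x‖| ≤ R := by
      refine (abs_norm_sub_norm_le _ _).trans ?_
      simpa using hy
    have a2 : |inner ℝ (x - y) y| ≤ ‖x - y‖ * R :=
      (abs_real_inner_le_norm _ _).trans (by gcongr)
    have a3 : |‖x - y‖ * (‖x - y‖ - ‖x‖) + inner ℝ (x - y) y| ≤ ‖x - y‖ * R + ‖x - y‖ * R := by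
      refine (abs_add_le _ _).trans (add_le_add ?_ a2)
      rw [abs_mul, abs_norm]
      gcongr
    calc _ ≤ (‖x - y‖ * R + ‖x - y‖ * R) * ‖x‖ := by gcongr
      _ = _ := by ring
  have e2 : (c : ℂ) * (Complex.I * κ - 1 / ‖x - y‖) - Complex.I * κ =
      Complex.I * κ * ((c - 1 : ℝ) : ℂ) - ((c / ‖x - y‖ : ℝ) : ℂ) := by
    push_cast
    ring
  have h3 : ‖(c : ℂ) * (Complex.I * κ - 1 / ‖x - y‖) - Complex.I * κ‖ ≤
      κ * (2 * R / ‖x‖) + 2 / ‖x‖ := by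
    rw [e2]
    refine (norm_sub_le _ _).trans (add_le_add ?_ ?_)
    · rw [norm_mul, norm_mul, Complex.norm_I, one_mul, Complex.norm_real, Complex.norm_real,
        Real.norm_of_nonneg hκ.le, Real.norm_eq_abs]
      gcongr
    · rw [Complex.norm_real, Real.norm_eq_abs, abs_div, abs_norm,
        div_le_div_iff₀ hr0 hρ]
      nlinarith
  rw [norm_mul, norm_div, Complex.norm_real, norm_norm]
  calc _ ≤ ‖x‖ * ((1 / 2) / (‖x‖ / 2) * (κ * (2 * R / ‖x‖) + 2 / ‖x‖)) := by gcongr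
    _ = _ := by field_simp

/-- No cancellation is needed, because `e^{-κr}` decays. The weak consequence `e^{-κr} ≤ 1/(κr)`
already supplies the missing power. -/
theorem isRadiatingProfile_helmProfile_I {κ : ℝ} (hκ : 0 < κ) :
    IsRadiatingProfile κ (helmProfile (Complex.I * κ)) := by
  refine ⟨contDiff_helmProfile _, fun R hR => ⟨4 * (2 * κ + 1) / κ, fun x y hx hy => ?_⟩⟩
  have hρ : 0 < ‖x‖ := by linarith
  have hr2 : ‖x‖ / 2 ≤ ‖x - y‖ := by linarith [norm_sub_norm_le x y]
  have hr0 : 0 < ‖x - y‖ := by linarith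
  have hz : x - y ≠ 0 := norm_pos_iff.1 hr0
  have h1 : ‖helmProfile (Complex.I * κ) ‖x - y‖‖ ≤ 1 / (κ * ‖x - y‖) := by
    have hpos : 0 < κ * ‖x - y‖ := by positivity
    rw [norm_helmProfile]
    simp only [Complex.mul_im, Complex.I_re, Complex.I_im, Complex.ofReal_re, Complex.ofReal_im,
      zero_mul, one_mul, zero_add, Real.exp_neg]
    rw [div_le_div_iff₀ (by positivity) hpos, inv_mul_eq_div, one_mul,
      div_le_iff₀ (Real.exp_pos _)]
    have := Real.add_one_le_exp (κ * ‖x - y‖)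
    nlinarith [Real.pi_gt_three, Real.exp_pos (κ * ‖x - y‖)]
  rw [fderiv_radial_helmProfile_sub _ _ hz]
  set c : ℝ := inner ℝ (x - y) (‖x‖⁻¹ • x) / ‖x - y‖ with hc
  have hv : ‖(‖x‖⁻¹ • x : E3)‖ = 1 := by rw [norm_smul, norm_inv, norm_norm, inv_mul_cancel₀ hρ.ne']
  have hc1 : |c| ≤ 1 := by
    rw [hc, abs_div, abs_norm, div_le_one hr0]
    simpa [hv] using abs_real_inner_le_norm (x - y) (‖x‖⁻¹ • x)
  have h3 : ‖(c : ℂ) * (Complex.I * (Complex.I * κ) - 1 / ‖x - y‖) - Complex.I * κ‖ ≤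
      2 * κ + 1 := by
    have e3 : Complex.I * (Complex.I * κ) - 1 / (‖x - y‖ : ℂ) =
        -((κ + 1 / ‖x - y‖ : ℝ) : ℂ) := by
      rw [← mul_assoc, Complex.I_mul_I]
      push_cast
      ring
    rw [e3]
    refine (norm_sub_le _ _).trans ?_
    rw [norm_mul, norm_neg, norm_mul, Complex.norm_I, one_mul, Complex.norm_real,
      Complex.norm_real, Complex.norm_real, Real.norm_of_nonneg hκ.le, Real.norm_eq_abs,
      Real.norm_of_nonneg (by positivity)]
    have : 1 / ‖x - y‖ ≤ 1 := by rw [div_le_one hr0]; linarith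
    calc _ ≤ 1 * (κ + 1) + κ := by gcongr
      _ = _ := by ring
  rw [norm_mul, norm_div, Complex.norm_real, norm_norm]
  calc _ ≤ ‖x‖ * ((1 / (κ * (‖x‖ / 2))) / (‖x‖ / 2) * (2 * κ + 1)) := by
        gcongr
        exact h1.trans (by gcongr)
    _ = _ := by field_simp; ring

theorem isRadiatingProfile_bihProfile {κ : ℝ} (hκ : 0 < κ) :
    IsRadiatingProfile κ (bihProfile κ) := by
  have := (isRadiatingProfile_helmProfile hκ).linear (isRadiatingProfile_helmProfile_I hκ)
    (1 / (2 * (κ : ℂ) ^ 2)) (-1 / (2 * (κ : ℂ) ^ 2))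
  convert this using 2 with r
  rw [bihProfile]
  ring

/-- Away from the source, `Δ` replaces the profile by its second derivative, which is `-1/2` times
the sum of the two exponential profiles. -/
theorem isRadiatingProfile_deriv_deriv_bihProfile {κ : ℝ} (hκ : 0 < κ) :
    IsRadiatingProfile κ (deriv (deriv (bihProfile κ))) := by
  have := (isRadiatingProfile_helmProfile hκ).linear (isRadiatingProfile_helmProfile_I hκ)
    (-1 / 2) (-1 / 2)
  convert this using 2 with r
  have h2 : deriv (deriv (bihProfile κ)) = iteratedDeriv 2 (bihProfile κ) := by
    simp [iteratedDeriv_succ]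
  have hκ' : (κ : ℂ) ≠ 0 := by exact_mod_cast hκ.ne'
  rw [h2, iteratedDeriv_bihProfile, mul_pow, Complex.I_sq]
  field_simp
  ring

theorem IsRadiatingProfile.radiationCondition {κ : ℝ} {h : ℝ → ℂ} (H : IsRadiatingProfile κ h)
    {g : E3 → ℂ} {R : ℝ} (hR : 0 ≤ R) (hgi : Integrable g) (hg : ∀ y, R < ‖y‖ → g y = 0) :
    RadiationCondition κ (conv (radial h) g) := by
  obtain ⟨M, hM⟩ := H.bound R hR
  have hlim : Tendsto (fun x : E3 => M * (∫ y, ‖g y‖) / ‖x‖) (Bornology.cobounded E3) (𝓝 0) :=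
    tendsto_const_nhds.div_atTop tendsto_norm_cobounded_atTop
  refine squeeze_zero_norm' ?_ hlim
  filter_upwards [tendsto_norm_cobounded_atTop.eventually_ge_atTop (2 * R + 2)] with x hx
  have hxR : R < ‖x‖ := by linarith
  rw [radialDeriv, fderiv_conv_radial H.smooth hgi.locallyIntegrable hg hxR, conv_apply',
    conv_apply', ← integral_const_mul, ← integral_sub
    (integrable_conv_fderiv_radial H.smooth hgi.locallyIntegrable hg hxR _)
    ((integrable_conv_radial H.smooth hgi.locallyIntegrable hg hxR).const_mul _),
    ← integral_const_mul, mul_div_right_comm, ← integral_const_mul]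
  refine norm_integral_le_of_norm_le (hgi.norm.const_mul _) (Eventually.of_forall fun y => ?_)
  by_cases hy : R < ‖y‖
  · simp [hg y hy]
  · have := hM x y hx (not_lt.1 hy)
    have e : (‖x‖ : ℂ) * (fderiv ℝ (radial h) (x - y) (‖x‖⁻¹ • x) * g y -
        Complex.I * κ * (radial h (x - y) * g y)) = (‖x‖ : ℂ) *
        (fderiv ℝ (radial h) (x - y) (‖x‖⁻¹ • x) - Complex.I * κ * radial h (x - y)) * g y := by
      ring
    rw [e, norm_mul, norm_mul, Complex.norm_real, norm_norm]
    gcongr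

theorem RadiationCondition.congr {κ ρ : ℝ} {w w' : E3 → ℂ} (h : RadiationCondition κ w)
    (hw : ∀ x, ρ < ‖x‖ → w x = w' x) : RadiationCondition κ w' := by
  refine Tendsto.congr' ?_ h
  filter_upwards [tendsto_norm_cobounded_atTop.eventually_gt_atTop ρ] with x hx
  have : w =ᶠ[𝓝 x] w' := by
    filter_upwards [(isOpen_lt continuous_const continuous_norm).mem_nhds hx] with y hy
      using hw y hy
  rw [radialDeriv, radialDeriv, this.fderiv_eq, this.self_of_nhds]

theorem RadiationCondition.linear {κ ρ : ℝ} {w w' : E3 → ℂ} (h : RadiationCondition κ w)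
    (h' : RadiationCondition κ w') (hw : ∀ x, ρ < ‖x‖ → DifferentiableAt ℝ w x)
    (hw' : ∀ x, ρ < ‖x‖ → DifferentiableAt ℝ w' x) (a b : ℂ) :
    RadiationCondition κ fun x => a * w x + b * w' x := by
  have := (Tendsto.const_mul a h).add (Tendsto.const_mul b h')
  rw [mul_zero, mul_zero, add_zero] at this
  refine Tendsto.congr' ?_ this
  filter_upwards [tendsto_norm_cobounded_atTop.eventually_gt_atTop ρ] with x hx
  simp only [radialDeriv]
  rw [fderiv_fun_add ((hw x hx).const_mul a) ((hw' x hx).const_mul b),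
    fderiv_const_mul (hw x hx), fderiv_const_mul (hw' x hx)]
  simp
  ring

theorem radiationCondition_conv_bihKernel {κ : ℝ} (hκ : 0 < κ) {g : E3 → ℂ} {R : ℝ} (hR : 0 ≤ R)
    (hgi : Integrable g) (hg : ∀ y, R < ‖y‖ → g y = 0) :
    RadiationCondition κ (conv (bihKernel κ) g) ∧
      RadiationCondition κ (Δ (conv (bihKernel κ) g)) :=
  ⟨(isRadiatingProfile_bihProfile hκ).radiationCondition hR hgi hg,
    ((isRadiatingProfile_deriv_deriv_bihProfile hκ).radiationCondition hR hgi hg).congr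
      fun _ hx => (laplacian_conv_radial (contDiff_bihProfile κ) hgi.locallyIntegrable hg hx).symm⟩

/-! ### Sobolev regularity of the potential -/

theorem integrable_of_memLp_two {g : E3 → ℂ} {R : ℝ} (hg2 : MemLp g 2)
    (hg : ∀ y, R < ‖y‖ → g y = 0) : Integrable g := by
  have h1 : IntegrableOn g (Metric.closedBall 0 R) :=
    (hg2.locallyIntegrable one_le_two).integrableOn_isCompact (isCompact_closedBall 0 R)
  refine h1.integrable_of_forall_notMem_eq_zero fun x hx => hg x ?_
  simpa using hx

theorem memLp_restrict_ball {f : E3 → ℂ} (hf : ContDiff ℝ ∞ f) (ρ : ℝ) :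
    MemLp f 2 (volume.restrict (Metric.ball (0 : E3) ρ)) := by
  obtain ⟨θ, hθ, hθ1, -⟩ := exists_plateau ρ
  have hT : IsTestFunction univ fun x => f x * θ x :=
    isTestFunction_univ (hf.mul hθ.smooth) hθ.compact_support.mul_left
  refine ((hT.memLp 2).restrict (Metric.ball (0 : E3) ρ)).ae_eq ?_
  filter_upwards [ae_restrict_mem Metric.isOpen_ball.measurableSet] with x hx
  rw [hθ1 x (by simpa using (mem_ball_zero_iff.1 hx).le), mul_one]

/-- The smooth difference of the fundamental solution and its truncation. -/
noncomputable def tailKernel (κ a : ℝ) : E3 → ℂ :=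
  radial fun r => (1 - cutoff a r) * bihProfile κ r

theorem contDiff_tailKernel (κ : ℝ) {a : ℝ} (ha : 0 < a) : ContDiff ℝ ∞ (tailKernel κ a) :=
  contDiff_radial ((contDiff_const.sub (contDiff_cutoff a)).mul (contDiff_bihProfile κ)) ha
    fun r hr => by rw [cutoff_of_le hr.le, sub_self, zero_mul]

theorem bihKernel_eq_add (κ a : ℝ) (x : E3) :
    bihKernel κ x = truncKernel κ a x + tailKernel κ a x := by
  simp only [bihKernel, truncKernel, tailKernel, truncProfile, radial]
  ring

theorem conv_bihKernel_eq_add {κ : ℝ} (hκ : 0 < κ) (a : ℝ) {g : E3 → ℂ} {R : ℝ}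
    (hg2 : MemLp g 2) (hg : ∀ y, R < ‖y‖ → g y = 0) (x : E3) :
    conv (bihKernel κ) g x = conv (truncKernel κ a) g x + conv (tailKernel κ a) g x := by
  have h1 : Integrable fun y => bihKernel κ y * g (x - y) :=
    ((integrable_of_memLp_two hg2 hg).comp_sub_left x).bdd_mul
      (measurable_bihKernel κ).aestronglyMeasurable
      (Eventually.of_forall fun y => norm_bihKernel_le hκ y)
  have h2 := integrable_conv_of_memLp (memLp_truncKernel hκ a 2) hg2 x
  have e : conv (tailKernel κ a) g x =
      ∫ y, (bihKernel κ y * g (x - y) - truncKernel κ a y * g (x - y)) := by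
    rw [conv_apply]
    congr 1 with y
    rw [bihKernel_eq_add κ a]
    ring
  rw [e, integral_sub h1 h2, conv_apply, conv_apply]
  ring

theorem conv_bihKernel_eq_truncKernel {κ : ℝ} {g : E3 → ℂ} {R : ℝ}
    (hg : ∀ y, R < ‖y‖ → g y = 0) {x : E3} (hx : ‖x‖ ≤ R) :
    conv (bihKernel κ) g x = conv (truncKernel κ (2 * R)) g x :=
  conv_eq_of_forall hg fun y hy =>
    (truncKernel_of_le (by linarith [norm_sub_le x y])).symm

theorem multiDeriv_eq_zero {φ : E3 → ℂ} {Ω : Set E3} (hφ : IsTestFunction Ω φ) (α : Fin 3 → ℕ)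
    {x : E3} (hx : x ∉ Ω) : multiDeriv α φ x = 0 :=
  image_eq_zero_of_notMem_tsupport fun h => hx ((hφ.multiDeriv α).support_subset h)

/-- The kernel splits as `Φ = K + (Φ - K)`. The first part has weak derivatives in `L²(ℝ³)`; the
second is smooth, and so is its convolution with the compactly supported `g`. -/
theorem memSobolevLoc_conv_bihKernel {κ : ℝ} (hκ : 1 ≤ κ) {g : E3 → ℂ} {R : ℝ} (hR : 0 < R)
    (hg2 : MemLp g 2) (hg : ∀ y, R < ‖y‖ → g y = 0) :
    MemSobolevLoc 4 (conv (bihKernel κ) g) := by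
  have hκ0 : 0 < κ := by linarith
  have ha : 0 < 2 * R := by positivity
  obtain ⟨C, hC, hb⟩ := exists_eLpNorm_multiDeriv_conv_le (2 * R) ha
  have hgl := (integrable_of_memLp_two hg2 hg).locallyIntegrable
  have hS := contDiff_conv_left (contDiff_tailKernel κ ha) hgl hg
  have hK := memLp_conv (integrable_truncKernel hκ0 (2 * R)) hg2
  have hKl : LocallyIntegrable (conv (truncKernel κ (2 * R)) g) := hK.locallyIntegrable one_le_two
  have hu : conv (bihKernel κ) g =
      fun x => conv (truncKernel κ (2 * R)) g x + conv (tailKernel κ (2 * R)) g x :=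
    funext (conv_bihKernel_eq_add hκ0 _ hg2 hg)
  intro α hα
  obtain ⟨h, hh2, -, hh⟩ := exists_weakDeriv_conv (integrable_truncKernel hκ0 (2 * R))
    (memLp_truncKernel hκ0 _ 2) (hasCompactSupport_truncKernel κ _) (by positivity)
    (hb κ hκ α hα) hg2
  have hhl : LocallyIntegrable h := hh2.locallyIntegrable one_le_two
  have hD := contDiff_multiDeriv hS α
  refine ⟨fun x => h x + multiDeriv α (conv (tailKernel κ (2 * R)) g) x, ⟨?_, ?_, ?_⟩, fun ρ _ =>
    (hh2.restrict _).add (memLp_restrict_ball hD ρ)⟩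
  · rw [hu, locallyIntegrableOn_univ]
    exact hKl.add hS.continuous.locallyIntegrable
  · rw [locallyIntegrableOn_univ]
    exact hhl.add hD.continuous.locallyIntegrable
  · intro φ hφ
    simp only [Measure.restrict_univ, hu, add_mul]
    rw [integral_add (integrable_mul_test hKl (hφ.multiDeriv α))
      (integrable_mul_test hS.continuous.locallyIntegrable (hφ.multiDeriv α)),
      integral_add (integrable_mul_test hhl hφ)
      (integrable_mul_test hD.continuous.locallyIntegrable hφ), hh φ hφ,
      integral_mul_multiDeriv hS hφ, mul_add]

/-- Inside the ball the tail of the kernel is never seen, so the weak derivatives of `K * g` serve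
and carry the explicit power of `κ`. -/
theorem exists_hasWeakDeriv_ball_conv_bihKernel {R : ℝ} (hR : 0 < R) :
    ∃ C : ℝ, 0 < C ∧ ∀ κ : ℝ, 1 ≤ κ → ∀ g : E3 → ℂ, MemLp g 2 → (∀ y, R < ‖y‖ → g y = 0) →
      ∀ α ∈ multiIndices 4, ∃ h : E3 → ℂ,
        HasWeakDeriv (Metric.ball 0 R) α (conv (bihKernel κ) g) h ∧ MemLp h 2 ∧
        eLpNorm h 2 ≤ ENNReal.ofReal (C * κ ^ 2) * eLpNorm g 2 := by
  obtain ⟨C, hC, hb⟩ := exists_eLpNorm_multiDeriv_conv_le (2 * R) (by positivity)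
  refine ⟨C, hC, fun κ hκ g hg2 hg α hα => ?_⟩
  have hκ0 : 0 < κ := by linarith
  obtain ⟨h, hh2, hhb, hh⟩ := exists_weakDeriv_conv (integrable_truncKernel hκ0 (2 * R))
    (memLp_truncKernel hκ0 _ 2) (hasCompactSupport_truncKernel κ _) (by positivity)
    (hb κ hκ α hα) hg2
  have hm : MeasurableSet (Metric.ball (0 : E3) R) := Metric.isOpen_ball.measurableSet
  have hK := memLp_conv (integrable_truncKernel hκ0 (2 * R)) hg2
  have hu : EqOn (conv (truncKernel κ (2 * R)) g) (conv (bihKernel κ) g) (Metric.ball 0 R) :=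
    fun x hx => (conv_bihKernel_eq_truncKernel hg (mem_ball_zero_iff.1 hx).le).symm
  refine ⟨h, ⟨?_, (hh2.locallyIntegrable one_le_two).locallyIntegrableOn _, fun φ hφ => ?_⟩, hh2,
    hhb⟩
  · have h1 : IntegrableOn (conv (truncKernel κ (2 * R)) g) (Metric.ball 0 R) :=
      ((hK.locallyIntegrable one_le_two).integrableOn_isCompact
        (isCompact_closedBall 0 R)).mono_set Metric.ball_subset_closedBall
    exact (h1.congr_fun hu hm).locallyIntegrableOn
  · have hz : ∀ x ∉ Metric.ball (0 : E3) R, φ x = 0 := fun x hx =>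
      image_eq_zero_of_notMem_tsupport fun h' => hx (hφ.support_subset h')
    have hφ' : IsTestFunction univ φ := isTestFunction_univ hφ.smooth hφ.compact_support
    have h1 : ∫ x in Metric.ball (0 : E3) R, conv (truncKernel κ (2 * R)) g x * multiDeriv α φ x =
        ∫ x, conv (truncKernel κ (2 * R)) g x * multiDeriv α φ x :=
      setIntegral_eq_integral_of_forall_compl_eq_zero fun x hx => by
        rw [multiDeriv_eq_zero hφ α hx, mul_zero]
    have h2 : ∫ x in Metric.ball (0 : E3) R, h x * φ x = ∫ x, h x * φ x :=
      setIntegral_eq_integral_of_forall_compl_eq_zero fun x hx => by rw [hz x hx, mul_zero]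
    rw [h2, ← hh φ hφ', ← h1]
    exact setIntegral_congr_fun hm fun x hx => by simp only [hu hx]

theorem sobolevNorm_le {m : ℕ} {Ω : Set E3} {u : E3 → ℂ} {A : ℝ≥0∞}
    (h : ∀ α ∈ multiIndices m, ∃ g : E3 → ℂ, HasWeakDeriv Ω α u g ∧
      eLpNorm g 2 (volume.restrict Ω) ≤ A) :
    sobolevNorm m Ω u ≤ ((multiIndices m).card : ℝ≥0∞) ^ (1 / 2 : ℝ) * A := by
  have h1 : ∑ α ∈ multiIndices m, (⨅ g : E3 → ℂ, ⨅ _ : HasWeakDeriv Ω α u g,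
      eLpNorm g 2 (volume.restrict Ω)) ^ (2 : ℝ) ≤ (multiIndices m).card * A ^ (2 : ℝ) := by
    rw [← nsmul_eq_mul]
    refine Finset.sum_le_card_nsmul _ _ _ fun α hα => ?_
    obtain ⟨g, hg, hgA⟩ := h α hα
    exact ENNReal.rpow_le_rpow ((iInf₂_le g hg).trans hgA) zero_le_two
  refine (ENNReal.rpow_le_rpow h1 (by norm_num)).trans_eq ?_
  rw [ENNReal.mul_rpow_of_nonneg _ _ (by norm_num), ← ENNReal.rpow_mul]
  norm_num

theorem exists_sobolevNorm_conv_bihKernel_le {R : ℝ} (hR : 0 < R) :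
    ∃ C : ℝ, 0 < C ∧ ∀ κ : ℝ, 1 ≤ κ → ∀ g : E3 → ℂ, MemLp g 2 → (∀ y, R < ‖y‖ → g y = 0) →
      MemSobolev 4 (Metric.ball 0 R) (conv (bihKernel κ) g) ∧
      sobolevNorm 4 (Metric.ball 0 R) (conv (bihKernel κ) g) ≤
        ENNReal.ofReal (C * κ ^ 2) * eLpNorm g 2 := by
  obtain ⟨C, hC, hb⟩ := exists_hasWeakDeriv_ball_conv_bihKernel hR
  have hN : 0 < ((multiIndices 4).card : ℝ) ^ (1 / 2 : ℝ) :=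
    Real.rpow_pos_of_pos (by
      exact_mod_cast Finset.card_pos.2 ⟨0, by simp [mem_multiIndices, order]⟩) _
  refine ⟨((multiIndices 4).card : ℝ) ^ (1 / 2 : ℝ) * C, by positivity, fun κ hκ g hg2 hg =>
    ⟨fun α hα => ?_, ?_⟩⟩
  · obtain ⟨h, hw, hh2, -⟩ := hb κ hκ g hg2 hg α hα
    exact ⟨h, hw, hh2.restrict _⟩
  · refine (sobolevNorm_le (A := ENNReal.ofReal (C * κ ^ 2) * eLpNorm g 2)
      fun α hα => ?_).trans_eq ?_
    · obtain ⟨h, hw, hh2, hle⟩ := hb κ hκ g hg2 hg α hα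
      exact ⟨h, hw, (eLpNorm_mono_measure _ Measure.restrict_le_self).trans hle⟩
    · rw [mul_assoc, ENNReal.ofReal_mul hN.le, ← ENNReal.ofReal_rpow_of_nonneg (by positivity)
        (by norm_num), ENNReal.ofReal_natCast, mul_assoc]

theorem integral_conv_bihKernel_mul {κ : ℝ} (hκ : 0 < κ) {g : E3 → ℂ} (hgi : Integrable g)
    {φ : E3 → ℂ} (hφ : IsTestFunction univ φ) :
    ∫ x, conv (bihKernel κ) g x * (Δ (Δ φ) x - (κ : ℂ) ^ 4 * φ x) = ∫ x, g x * φ x := by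
  rw [integral_conv_mul_of_bounded (bihKernel_neg κ) (measurable_bihKernel κ)
    (norm_bihKernel_le hκ) hgi (isTestFunction_bilaplacian_sub hφ _).integrable]
  congr 1 with y
  rw [conv_bihKernel_bilaplacian_sub hκ.ne' hφ]

theorem contDiffOn_conv_bihKernel (κ : ℝ) {g : E3 → ℂ} {R : ℝ} (hgi : Integrable g)
    (hg : ∀ y, R < ‖y‖ → g y = 0) :
    ContDiffOn ℝ ∞ (conv (bihKernel κ) g) (Metric.closedBall (0 : E3) R)ᶜ := fun x hx =>
  (contDiffAt_conv_radial (contDiff_bihProfile κ) hgi.locallyIntegrable hg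
    (by simpa using hx)).contDiffWithinAt

/-! ### Outgoing solutions of `Δw = cw` carry no energy to infinity -/

/-- A smooth bump on `ℝ`, equal to `1` for `|s| ≤ L` and to `0` for `|s| ≥ L + 1`. -/
noncomputable def bump (L s : ℝ) : ℝ :=
  Real.smoothTransition (L + 1 - s) * Real.smoothTransition (L + 1 + s)

theorem contDiff_bump (L : ℝ) : ContDiff ℝ ∞ (bump L) :=
  (Real.smoothTransition.contDiff.comp (contDiff_const.sub contDiff_id)).mul
    (Real.smoothTransition.contDiff.comp (contDiff_const.add contDiff_id))

theorem bump_nonneg (L s : ℝ) : 0 ≤ bump L s :=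
  mul_nonneg (Real.smoothTransition.nonneg _) (Real.smoothTransition.nonneg _)

theorem bump_le_one (L s : ℝ) : bump L s ≤ 1 :=
  mul_le_one₀ (Real.smoothTransition.le_one _) (Real.smoothTransition.nonneg _)
    (Real.smoothTransition.le_one _)

theorem bump_of_abs_le {L s : ℝ} (h : |s| ≤ L) : bump L s = 1 := by
  rw [abs_le] at h
  rw [bump, Real.smoothTransition.one_of_one_le (by linarith),
    Real.smoothTransition.one_of_one_le (by linarith), one_mul]

theorem bump_of_le_abs {L s : ℝ} (h : L + 1 ≤ |s|) : bump L s = 0 := by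
  rw [bump]
  rcases le_abs.1 h with h | h
  · rw [Real.smoothTransition.zero_of_nonpos (by linarith), zero_mul]
  · rw [Real.smoothTransition.zero_of_nonpos (x := L + 1 + s) (by linarith), mul_zero]

/-- A primitive of `bump L`. -/
noncomputable def bumpPrimitive (L s : ℝ) : ℝ := ∫ t in (-(L + 1))..s, bump L t

theorem hasDerivAt_bumpPrimitive (L s : ℝ) : HasDerivAt (bumpPrimitive L) (bump L s) s :=
  ((contDiff_bump L).continuous.integral_hasStrictDerivAt _ s).hasDerivAt

theorem contDiff_bumpPrimitive (L : ℝ) : ContDiff ℝ ∞ (bumpPrimitive L) := by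
  rw [contDiff_infty_iff_deriv]
  refine ⟨fun s => (hasDerivAt_bumpPrimitive L s).differentiableAt, ?_⟩
  rw [show deriv (bumpPrimitive L) = bump L from
    funext fun s => (hasDerivAt_bumpPrimitive L s).deriv]
  exact contDiff_bump L

theorem bumpPrimitive_of_le {L s : ℝ} (hs : s ≤ -(L + 1)) :
    bumpPrimitive L s = 0 := by
  rw [bumpPrimitive, intervalIntegral.integral_symm, neg_eq_zero]
  refine intervalIntegral.integral_zero_ae (Eventually.of_forall fun t ht => bump_of_le_abs ?_)
  rw [uIoc_of_le hs] at ht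
  exact le_abs.2 (Or.inr (by linarith [ht.2]))

theorem bumpPrimitive_of_ge {L s : ℝ} (hs : L + 1 ≤ s) :
    bumpPrimitive L s = bumpPrimitive L (L + 1) := by
  have hi : ∀ a b, IntervalIntegrable (bump L) volume a b := fun a b =>
    (contDiff_bump L).continuous.intervalIntegrable a b
  rw [bumpPrimitive, ← intervalIntegral.integral_add_adjacent_intervals (hi _ (L + 1)) (hi _ _),
    bumpPrimitive, add_eq_left]
  refine intervalIntegral.integral_zero_ae (Eventually.of_forall fun t ht => bump_of_le_abs ?_)
  rw [uIoc_of_le hs] at ht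
  exact le_abs.2 (Or.inl ht.1.le)

theorem contDiff_comp_norm {F : ℝ → ℂ} (hF : ContDiff ℝ ∞ F) {δ : ℝ} (hδ : 0 < δ) {c : ℂ}
    (h0 : ∀ r < δ, F r = c) : ContDiff ℝ ∞ fun x : E3 => F ‖x‖ := by
  rw [contDiff_iff_contDiffAt]
  intro x
  rcases eq_or_ne x 0 with rfl | hx
  · refine (contDiffAt_const (c := c)).congr_of_eventuallyEq ?_
    filter_upwards [Metric.ball_mem_nhds (0 : E3) hδ] with x hx
    exact h0 _ (mem_ball_zero_iff.1 hx)
  · exact hF.contDiffAt.comp x (contDiffAt_norm ℝ hx)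

theorem radialDeriv_eq_sum (w : E3 → ℂ) (x : E3) :
    radialDeriv w x = ∑ i, ((x i : ℝ) : ℂ) * (‖x‖ : ℂ)⁻¹ * partialDeriv i w x := by
  have hx : x = ∑ i, x i • EuclideanSpace.single i (1 : ℝ) := by
    ext j
    simp [Finset.sum_apply, Pi.single_apply]
  have h2 : fderiv ℝ w x x = ∑ i, ((x i : ℝ) : ℂ) * partialDeriv i w x := by
    refine (congrArg (fderiv ℝ w x) hx).trans ?_
    rw [map_sum]
    simp [partialDeriv]
  rw [radialDeriv, map_smul, h2, Complex.real_smul, Finset.mul_sum]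
  push_cast
  exact Finset.sum_congr rfl fun i _ => by ring

theorem partialDeriv_sub {f g : E3 → ℂ} {x : E3} (hf : DifferentiableAt ℝ f x)
    (hg : DifferentiableAt ℝ g x) (i : Fin 3) :
    partialDeriv i (fun y => f y - g y) x = partialDeriv i f x - partialDeriv i g x := by
  simp only [partialDeriv]
  rw [fderiv_fun_sub hf hg]
  rfl

theorem partialDeriv_mul {f g : E3 → ℂ} {x : E3} (hf : DifferentiableAt ℝ f x)
    (hg : DifferentiableAt ℝ g x) (i : Fin 3) :
    partialDeriv i (fun y => f y * g y) x = f x * partialDeriv i g x + g x * partialDeriv i f x := by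
  simp only [partialDeriv]
  rw [fderiv_fun_mul hf hg]
  rfl

/-- The divergence of `w̄∇w - w∇w̄` is `w̄Δw - wΔw̄`, which vanishes because `c` is real. The sign
of `c` plays no role. -/
theorem sum_partialDeriv_flux {w : E3 → ℂ} (hw : ContDiff ℝ ∞ w) {c : ℝ}
    (hc : ∀ x, Δ w x = c * w x) (x : E3) :
    ∑ i, partialDeriv i (fun y => conj (w y) * partialDeriv i w y -
      w y * conj (partialDeriv i w y)) x = 0 := by
  have hd : ∀ {f : E3 → ℂ}, ContDiff ℝ ∞ f → Differentiable ℝ f := fun hf =>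
    hf.differentiable (by simp)
  have hcj : ∀ {f : E3 → ℂ}, ContDiff ℝ ∞ f → Differentiable ℝ fun y => conj (f y) := fun hf =>
    Complex.conjCLE.differentiable.comp (hd hf)
  have h1 : ∀ i, partialDeriv i (fun y => conj (w y) * partialDeriv i w y -
      w y * conj (partialDeriv i w y)) x =
      conj (w x) * partialDeriv i (partialDeriv i w) x -
        w x * conj (partialDeriv i (partialDeriv i w) x) := fun i => by
    have hp := contDiff_partialDeriv hw i
    rw [partialDeriv_sub ((hcj hw x).fun_mul (hd hp x)) ((hd hw x).fun_mul (hcj hp x)),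
      partialDeriv_mul (hcj hw x) (hd hp x), partialDeriv_mul (hd hw x) (hcj hp x),
      partialDeriv_conj (hd hw), partialDeriv_conj (hd hp)]
    ring
  rw [Finset.sum_congr rfl fun i _ => h1 i, Finset.sum_sub_distrib, ← Finset.mul_sum,
    ← Finset.mul_sum, ← map_sum, ← congrFun (laplacian_eq_sum hw) x, hc, map_mul,
    Complex.conj_ofReal]
  ring

/-- A smeared form of zero flux through spheres, which avoids surface integrals: the divergence-free
field is paired with a function whose gradient is `-bump L (ρ - ‖x‖)` times the unit radial vector.
The condition `L + 1 < ρ` makes that function constant near the origin, hence smooth. -/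
theorem integral_bump_flux {w : E3 → ℂ} (hw : ContDiff ℝ ∞ w) {c : ℝ}
    (hc : ∀ x, Δ w x = c * w x) {L ρ : ℝ} (hρ : L + 1 < ρ) :
    Integrable (fun x => bump L (ρ - ‖x‖) * (conj (w x) * radialDeriv w x).im) ∧
      ∫ x, bump L (ρ - ‖x‖) * (conj (w x) * radialDeriv w x).im = 0 := by
  let F : ℝ → ℂ := fun r => (bumpPrimitive L (ρ - r) : ℂ)
  have hF : ContDiff ℝ ∞ F := Complex.ofRealCLM.contDiff.comp
    ((contDiff_bumpPrimitive L).comp (contDiff_const.sub contDiff_id))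
  have hF' : ∀ r, HasDerivAt F (-(bump L (ρ - r) : ℂ)) r := fun r => by
    have h1 := (hasDerivAt_bumpPrimitive L (ρ - r)).comp_const_sub ρ r
    have := h1.ofReal_comp
    simpa [F] using this
  let χ : E3 → ℂ := fun x => F ‖x‖
  have hχ : IsTestFunction univ χ := by
    refine isTestFunction_univ (contDiff_comp_norm hF (δ := ρ - (L + 1)) (by linarith)
      (c := (bumpPrimitive L (L + 1) : ℂ)) fun r hr => ?_) ?_
    · simp only [F]
      rw [bumpPrimitive_of_ge (by linarith)]
    · refine HasCompactSupport.intro (isCompact_closedBall (0 : E3) (ρ + L + 1)) fun x hx => ?_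
      rw [mem_closedBall_zero_iff, not_le] at hx
      simp only [χ, F]
      rw [bumpPrimitive_of_le (by linarith), Complex.ofReal_zero]
  have hpχ : ∀ i x, partialDeriv i χ x =
      ((x i : ℝ) : ℂ) * ((‖x‖ : ℂ)⁻¹ * -(bump L (ρ - ‖x‖) : ℂ)) := fun i x => by
    rcases eq_or_ne x 0 with rfl | hx
    · have : χ =ᶠ[𝓝 0] fun _ => (bumpPrimitive L (L + 1) : ℂ) := by
        filter_upwards [Metric.ball_mem_nhds (0 : E3) (show 0 < ρ - (L + 1) by linarith)] with x hx
        rw [mem_ball_zero_iff] at hx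
        simp only [χ, F]
        rw [bumpPrimitive_of_ge (by linarith)]
      simp [partialDeriv, this.fderiv_eq]
    · exact partialDeriv_comp_norm hx (hF' _) i
  let f : Fin 3 → E3 → ℂ := fun i y => conj (w y) * partialDeriv i w y -
    w y * conj (partialDeriv i w y)
  have hcj : ∀ {g : E3 → ℂ}, ContDiff ℝ ∞ g → ContDiff ℝ ∞ fun y => conj (g y) := fun hg =>
    Complex.conjCLE.contDiff.comp hg
  have hf : ∀ i, ContDiff ℝ ∞ (f i) := fun i =>
    ((hcj hw).mul (contDiff_partialDeriv hw i)).sub (hw.mul (hcj (contDiff_partialDeriv hw i)))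
  have hint : ∀ i, Integrable fun x => f i x * partialDeriv i χ x := fun i =>
    integrable_mul_test (hf i).continuous.locallyIntegrable (hχ.partialDeriv i)
  have hint' : ∀ i, Integrable fun x => partialDeriv i (f i) x * χ x := fun i =>
    integrable_mul_test (contDiff_partialDeriv (hf i) i).continuous.locallyIntegrable hχ
  have h0 : ∫ x, ∑ i, f i x * partialDeriv i χ x = 0 := by
    rw [integral_finsetSum _ fun i _ => hint i,
      Finset.sum_congr rfl fun i _ => integral_mul_partialDeriv (hf i) hχ i,
      Finset.sum_neg_distrib, ← integral_finsetSum _ fun i _ => hint' i]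
    simp only [← Finset.sum_mul]
    simp [f, sum_partialDeriv_flux hw hc]
  have hI : Integrable fun x => ∑ i, f i x * partialDeriv i χ x :=
    integrable_finsetSum _ fun i _ => hint i
  have heq : ∀ x, ∑ i, f i x * partialDeriv i χ x = (-2 * Complex.I) *
      ((bump L (ρ - ‖x‖) * (conj (w x) * radialDeriv w x).im : ℝ) : ℂ) := fun x => by
    have h1 : (((conj (w x) * radialDeriv w x).im : ℝ) : ℂ) * (2 * Complex.I) =
        conj (w x) * radialDeriv w x - w x * conj (radialDeriv w x) := by
      have := Complex.sub_conj (conj (w x) * radialDeriv w x)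
      rw [map_mul, Complex.conj_conj] at this
      rw [this]
      push_cast
      ring
    have h2 : (-2 * Complex.I) * ((bump L (ρ - ‖x‖) * (conj (w x) * radialDeriv w x).im : ℝ) : ℂ)
        = -(bump L (ρ - ‖x‖) : ℂ) *
          (conj (w x) * radialDeriv w x - w x * conj (radialDeriv w x)) := by
      rw [← h1]
      push_cast
      ring
    rw [h2, radialDeriv_eq_sum, map_sum, Finset.mul_sum, Finset.mul_sum, ← Finset.sum_sub_distrib,
      Finset.mul_sum]
    refine Finset.sum_congr rfl fun i _ => ?_
    rw [hpχ]
    simp only [f, map_mul, map_inv₀, Complex.conj_ofReal]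
    ring
  simp only [heq] at h0 hI
  have hne : (-2 * Complex.I : ℂ) ≠ 0 := by simp
  rw [integrable_const_mul_iff (isUnit_iff_ne_zero.2 hne)] at hI
  rw [integral_const_mul, integral_complex_ofReal, mul_eq_zero, or_iff_right hne] at h0
  refine ⟨?_, by exact_mod_cast h0⟩
  have := hI.re
  simpa using this

theorem hasCompactSupport_bump_comp_norm (L ρ : ℝ) :
    HasCompactSupport fun x : E3 => bump L (ρ - ‖x‖) := by
  refine HasCompactSupport.intro (isCompact_closedBall (0 : E3) (ρ + L + 1)) fun x hx => ?_
  rw [mem_closedBall_zero_iff, not_le] at hx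
  exact bump_of_le_abs (le_abs.2 (Or.inr (by linarith)))

theorem integrable_bump_mul (L ρ : ℝ) {f : E3 → ℝ} (hf : Continuous f) :
    Integrable fun x : E3 => bump L (ρ - ‖x‖) * f x :=
  (((contDiff_bump L).continuous.comp (continuous_const.sub continuous_norm)).mul
    hf).integrable_of_hasCompactSupport (hasCompactSupport_bump_comp_norm L ρ).mul_right

/-- With `d = iκw + e` one has `Im(w̄d) = κ‖w‖² + Im(w̄e)`, and the inequality amounts to `(κ‖w‖ -
‖e‖)² ≥ 0` after bounding the last term. -/
theorem mul_normSq_le_of_im (κ : ℝ) (hκ : 0 < κ) (w d : ℂ) :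
    κ ^ 2 * ‖w‖ ^ 2 ≤ 2 * κ * (conj w * d).im + ‖d - Complex.I * κ * w‖ ^ 2 := by
  have h1 : (conj w * d).im = (conj w * (d - Complex.I * κ * w)).im + κ * ‖w‖ ^ 2 := by
    have : conj w * d = conj w * (d - Complex.I * κ * w) + Complex.I * (κ * (conj w * w)) := by
      ring
    rw [this, Complex.add_im, Complex.conj_mul']
    simp [← Complex.ofReal_pow]
  have h2 : |(conj w * (d - Complex.I * κ * w)).im| ≤ ‖w‖ * ‖d - Complex.I * κ * w‖ := by
    refine (Complex.abs_im_le_norm _).trans ?_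
    rw [norm_mul, Complex.norm_conj]
  have h3 := neg_abs_le (conj w * (d - Complex.I * κ * w)).im
  rw [h1]
  nlinarith [sq_nonneg (κ * ‖w‖ - ‖d - Complex.I * κ * w‖)]

/-- The flux term integrates to zero, so the mass of `w` near the sphere of radius `ρ` is bounded by
that of `∂_r w - iκw`. By the radiation condition the latter is at most `ε² r⁻²` pointwise, which
integrates to a fixed multiple of `ε²` on a shell of width `2L + 2`. -/
theorem tendsto_integral_bump_normSq {κ : ℝ} (hκ : 0 < κ) {w : E3 → ℂ} (hw : ContDiff ℝ ∞ w)
    {c : ℝ} (hc : ∀ x, Δ w x = c * w x) (hrad : RadiationCondition κ w) {L : ℝ} (hL : 0 ≤ L) :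
    Tendsto (fun ρ => ∫ x : E3, bump L (ρ - ‖x‖) * ‖w x‖ ^ 2) atTop (𝓝 0) := by
  have hnn : ∀ ρ, 0 ≤ ∫ x : E3, bump L (ρ - ‖x‖) * ‖w x‖ ^ 2 := fun ρ =>
    integral_nonneg fun x => mul_nonneg (bump_nonneg _ _) (by positivity)
  have key : ∀ ε > 0, ∀ᶠ ρ in atTop, ∫ x : E3, bump L (ρ - ‖x‖) * ‖w x‖ ^ 2 ≤
      ε ^ 2 * (4 * Real.pi * (2 * L + 2) / κ ^ 2) := fun ε hε => by
    have h1 := (Metric.tendsto_nhds.1 hrad) ε hε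
    rw [← comap_norm_atTop, eventually_comap] at h1
    obtain ⟨r₀, hr₀⟩ := eventually_atTop.1 h1
    filter_upwards [eventually_gt_atTop (max r₀ 0 + L + 1)] with ρ hρ
    have hρ1 : r₀ < ρ - (L + 1) := by linarith [le_max_left r₀ 0]
    have hρ2 : 0 < ρ - (L + 1) := by linarith [le_max_right r₀ 0]
    obtain ⟨hi, h0⟩ := integral_bump_flux hw hc (L := L) (ρ := ρ) (by linarith)
    obtain ⟨hj, hj'⟩ := integral_shell_norm_inv_sq hρ2 (b := ρ + (L + 1)) (by linarith)
    have hpt : ∀ x : E3, κ ^ 2 * (bump L (ρ - ‖x‖) * ‖w x‖ ^ 2) ≤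
        2 * κ * (bump L (ρ - ‖x‖) * (conj (w x) * radialDeriv w x).im) +
        ε ^ 2 * (Icc (ρ - (L + 1)) (ρ + (L + 1))).indicator (fun r => (r⁻¹) ^ 2) ‖x‖ := fun x => by
      by_cases hx : ‖x‖ ∈ Icc (ρ - (L + 1)) (ρ + (L + 1))
      · rw [indicator_of_mem hx]
        have hx0 : 0 < ‖x‖ := hρ2.trans_le hx.1
        have h3 := hr₀ ‖x‖ (hρ1.le.trans hx.1) x rfl
        rw [dist_zero_right, norm_mul, Complex.norm_real, norm_norm] at h3
        have h4 : ‖radialDeriv w x - Complex.I * κ * w x‖ ^ 2 ≤ ε ^ 2 * (‖x‖⁻¹) ^ 2 := by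
          rw [← mul_pow]
          refine pow_le_pow_left₀ (norm_nonneg _) ?_ 2
          rw [← div_eq_mul_inv, le_div_iff₀ hx0, mul_comm]
          exact h3.le
        have h5 := mul_normSq_le_of_im κ hκ (w x) (radialDeriv w x)
        have h6 := mul_le_mul_of_nonneg_left (h5.trans (add_le_add_right h4 _))
          (bump_nonneg L (ρ - ‖x‖))
        have h7 : bump L (ρ - ‖x‖) * (ε ^ 2 * (‖x‖⁻¹) ^ 2) ≤ ε ^ 2 * (‖x‖⁻¹) ^ 2 :=
          mul_le_of_le_one_left (by positivity) (bump_le_one _ _)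
        linarith
      · rw [indicator_of_notMem hx, bump_of_le_abs]
        · simp
        · rw [mem_Icc, not_and_or, not_le, not_le] at hx
          rcases hx with hx | hx
          · exact le_abs.2 (Or.inl (by linarith))
          · exact le_abs.2 (Or.inr (by linarith))
    have h8 := integral_mono ((integrable_bump_mul L ρ (hw.continuous.norm.pow 2)).const_mul
      (κ ^ 2)) ((hi.const_mul (2 * κ)).add (hj.const_mul (ε ^ 2))) hpt
    simp only [Pi.add_apply] at h8
    rw [integral_const_mul, integral_add (hi.const_mul _) (hj.const_mul _), integral_const_mul,
      integral_const_mul, h0, hj', mul_zero, zero_add] at h8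
    rw [← mul_div_assoc, le_div_iff₀ (by positivity), mul_comm]
    refine h8.trans_eq ?_
    ring
  rw [Metric.tendsto_nhds]
  intro η hη
  have hD : 0 < 4 * Real.pi * (2 * L + 2) / κ ^ 2 := by positivity
  obtain ⟨ε, hε, hεη⟩ : ∃ ε : ℝ, 0 < ε ∧ ε ^ 2 * (4 * Real.pi * (2 * L + 2) / κ ^ 2) < η := by
    refine ⟨√(η / (2 * (4 * Real.pi * (2 * L + 2) / κ ^ 2))), Real.sqrt_pos.2 (by positivity), ?_⟩
    rw [Real.sq_sqrt (by positivity), div_mul_eq_mul_div, div_lt_iff₀ (by positivity)]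
    nlinarith
  filter_upwards [key ε hε] with ρ hρ
  rw [Real.dist_eq, sub_zero, abs_of_nonneg (hnn ρ)]
  linarith

/-! ### Uniqueness for `Δ² - κ⁴` -/

theorem ae_eq_zero_of_integral_mul_test {f : E3 → ℂ} (hf : LocallyIntegrable f)
    (h : ∀ φ, IsTestFunction univ φ → ∫ x, f x * φ x = 0) : f =ᵐ[volume] 0 := by
  refine ae_eq_zero_of_integral_contDiff_smul_eq_zero hf fun g hg hgc => ?_
  have hφ : IsTestFunction univ fun x => (g x : ℂ) :=
    isTestFunction_univ (Complex.ofRealCLM.contDiff.comp hg)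
      (hgc.comp_left (g := fun r : ℝ => (r : ℂ)) (by simp))
  rw [← h _ hφ]
  congr 1 with x
  rw [Complex.real_smul, mul_comm]

theorem contDiff_conv_errKernel (κ : ℝ) {a : ℝ} (ha : 0 < a) {w : E3 → ℂ}
    (hw : LocallyIntegrable w) : ContDiff ℝ ∞ (conv (errKernel κ a) w) := by
  rw [conv_comm]
  exact contDiff_conv hw (isTestFunction_errKernel κ ha)

/-- Using `K * φ` itself as the test function gives `∫ w (φ + E * φ) = 0`. Since `E` is even it can
be moved onto `w`, whence `w + E * w = 0`. -/
theorem ae_eq_neg_conv_errKernel {κ : ℝ} (hκ : 0 < κ) {w : E3 → ℂ} (hw : LocallyIntegrable w)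
    (h : ∀ φ, IsTestFunction univ φ → ∫ x, w x * (Δ (Δ φ) x - (κ : ℂ) ^ 4 * φ x) = 0)
    {a : ℝ} (ha : 0 < a) : w =ᵐ[volume] fun x => -conv (errKernel κ a) w x := by
  have hE := isTestFunction_errKernel κ ha
  have hc := (contDiff_conv_errKernel κ ha hw).continuous.locallyIntegrable (μ := volume)
  have h1 : (fun x => w x + conv (errKernel κ a) w x) =ᵐ[volume] 0 := by
    refine ae_eq_zero_of_integral_mul_test (hw.add hc) fun φ hφ => ?_
    have h2 := h _ (isTestFunction_conv_truncKernel κ a hφ)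
    rw [bilaplacian_conv_truncKernel hκ.ne' ha hφ] at h2
    have h3 := integral_conv_test_mul (errKernel_neg κ a) hE hw hφ
    simp only [add_mul]
    rw [integral_add (integrable_mul_test hw hφ) (integrable_mul_test hc hφ), h3,
      ← integral_add (integrable_mul_test hw hφ)
        (integrable_mul_test hw (isTestFunction_conv hE.integrable.locallyIntegrable
          hE.compact_support hφ)), ← h2]
    congr 1 with x
    ring
  filter_upwards [h1] with x hx
  exact eq_neg_of_add_eq_zero_left hx

/-- A distributional solution of `Δ²w = κ⁴w` is smooth, and satisfies mean value formulae. -/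
theorem exists_smooth_version {κ : ℝ} (hκ : 0 < κ) {w : E3 → ℂ} (hw : LocallyIntegrable w)
    (h : ∀ φ, IsTestFunction univ φ → ∫ x, w x * (Δ (Δ φ) x - (κ : ℂ) ^ 4 * φ x) = 0) :
    ∃ v : E3 → ℂ, ContDiff ℝ ∞ v ∧ w =ᵐ[volume] v ∧ (∀ x, Δ (Δ v) x = (κ : ℂ) ^ 4 * v x) ∧
      ∀ a : ℝ, 0 < a → ∀ x, v x = -conv (errKernel κ a) v x := by
  have hwv := ae_eq_neg_conv_errKernel hκ hw h one_pos
  have hv : ContDiff ℝ ∞ fun x => -conv (errKernel κ 1) w x :=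
    (contDiff_conv_errKernel κ one_pos hw).neg
  refine ⟨fun x => -conv (errKernel κ 1) w x, hv, hwv, ?_, fun a ha => ?_⟩
  · set v : E3 → ℂ := fun x => -conv (errKernel κ 1) w x with hvdef
    have hΔ := contDiff_laplacian hv
    have hc : Continuous fun x => Δ (Δ v) x - (κ : ℂ) ^ 4 * v x :=
      (contDiff_laplacian hΔ).continuous.sub (continuous_const.mul hv.continuous)
    have h0 : (fun x => Δ (Δ v) x - (κ : ℂ) ^ 4 * v x) =ᵐ[volume] 0 := by
      refine ae_eq_zero_of_integral_mul_test hc.locallyIntegrable fun φ hφ => ?_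
      rw [← h φ hφ]
      have e1 : ∫ x, w x * (Δ (Δ φ) x - (κ : ℂ) ^ 4 * φ x) =
          ∫ x, v x * (Δ (Δ φ) x - (κ : ℂ) ^ 4 * φ x) := by
        refine integral_congr_ae ?_
        filter_upwards [hwv] with x hx
        rw [hx]
      have hvl := hv.continuous.locallyIntegrable (μ := volume)
      have hv4 : Continuous fun x => (κ : ℂ) ^ 4 * v x := continuous_const.mul hv.continuous
      rw [e1]
      simp only [sub_mul, mul_sub]
      rw [integral_sub (integrable_mul_test (contDiff_laplacian hΔ).continuous.locallyIntegrable hφ)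
        (integrable_mul_test hv4.locallyIntegrable hφ), integral_sub (integrable_mul_test hvl hφ.laplacian.laplacian)
        (integrable_mul_test hvl (hφ.const_mul _)), integral_mul_laplacian hv hφ.laplacian,
        integral_mul_laplacian hΔ hφ]
      congr 2 with x
      ring
    have h1 := (Continuous.ae_eq_iff_eq volume hc continuous_const).1 h0
    exact fun x => sub_eq_zero.1 (congrFun h1 x)
  · have h2 := (hwv.symm.trans (ae_eq_neg_conv_errKernel hκ hw h ha))
    have h3 := (Continuous.ae_eq_iff_eq volume hv.continuous
      (contDiff_conv_errKernel κ ha hw).continuous.neg).1 h2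
    intro x
    rw [← conv_congr_ae hwv]
    exact congrFun h3 x

/-- The representation `v(x) = -(E_ρ * v)(x)` only involves `v` on a shell of bounded width about
the sphere of radius `ρ`. There the `L²` mass of `v` tends to zero, while `E_ρ` stays bounded in
`L²`. -/
theorem eq_zero_of_radiationCondition {κ : ℝ} (hκ : 1 ≤ κ) {v : E3 → ℂ} (hv : ContDiff ℝ ∞ v)
    (hΔ : ∀ x, Δ (Δ v) x = (κ : ℂ) ^ 4 * v x)
    (hrep : ∀ a : ℝ, 0 < a → ∀ x, v x = -conv (errKernel κ a) v x)
    (h1 : RadiationCondition κ v) (h2 : RadiationCondition κ (Δ v)) (x : E3) : v x = 0 := by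
  have hκ0 : 0 < κ := by linarith
  have hκc : (κ : ℂ) ≠ 0 := by exact_mod_cast hκ0.ne'
  have hL := contDiff_laplacian hv
  have hd : ∀ {f : E3 → ℂ}, ContDiff ℝ ∞ f → ∀ x, (0 : ℝ) < ‖x‖ → DifferentiableAt ℝ f x :=
    fun hf x _ => hf.differentiable (by simp) x
  -- For `c = ±κ²` the combination `p = Δv + cv` satisfies `Δp = cp`, and it inherits the radiation
  -- condition from `v` and `Δv`.
  have comp : ∀ c : ℝ, c ^ 2 = κ ^ 4 → ∀ L : ℝ, 0 ≤ L →
      Tendsto (fun ρ => ∫ x : E3, bump L (ρ - ‖x‖) * ‖Δ v x + c * v x‖ ^ 2) atTop (𝓝 0) := by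
    intro c hc L hL0
    have hs : ContDiff ℝ ∞ fun x => Δ v x + c * v x := hL.add (contDiff_const.mul hv)
    refine tendsto_integral_bump_normSq (c := c) hκ0 hs (fun x => ?_) ?_ hL0
    · have e1 : Δ (fun x => Δ v x + c * v x) x = Δ (Δ v) x + c * Δ v x := by
        have hv2 : ContDiff ℝ 2 v := hv.of_le (WithTop.coe_le_coe.2 le_top)
        have hL2 : ContDiff ℝ 2 (Δ v) := hL.of_le (WithTop.coe_le_coe.2 le_top)
        have := hL2.contDiffAt.laplacian_add (x := x)
          (contDiff_const.mul hv2 : ContDiff ℝ 2 fun x => (c : ℂ) * v x).contDiffAt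
        refine this.trans (congrArg _ ?_)
        have h3 := InnerProductSpace.laplacian_smul (𝕜 := ℝ) c hv2.contDiffAt (x := x)
        simpa [Complex.real_smul, Pi.smul_def] using h3
      have hc' : (κ : ℂ) ^ 4 = (c : ℂ) ^ 2 := by exact_mod_cast hc.symm
      rw [e1, hΔ, hc']
      ring
    · have := h2.linear h1 (hd hL) (hd hv) 1 c
      simpa using this
  -- The half-width `‖x‖ + 1` is what makes the bump equal to one at `x - y` whenever `ρ ≤ ‖y‖ ≤ ρ +
  -- 1`. The difference of the two combinations is `2κ²v`, so the decay passes to `v`.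
  have hlim : Tendsto (fun ρ => ∫ y : E3, bump (‖x‖ + 1) (ρ - ‖y‖) * ‖v y‖ ^ 2) atTop (𝓝 0) := by
    have hp := comp (κ ^ 2) (by ring) (‖x‖ + 1) (by positivity)
    have hm := comp (-κ ^ 2) (by ring) (‖x‖ + 1) (by positivity)
    have hs := hp.add hm
    rw [add_zero] at hs
    refine squeeze_zero (fun ρ => integral_nonneg fun y =>
      mul_nonneg (bump_nonneg _ _) (by positivity)) (fun ρ => ?_) hs
    have i1 : ∀ c : ℝ, Integrable fun y : E3 =>
        bump (‖x‖ + 1) (ρ - ‖y‖) * ‖Δ v y + c * v y‖ ^ 2 := fun c =>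
      integrable_bump_mul _ _ ((hL.continuous.add (continuous_const.mul hv.continuous)).norm.pow 2)
    rw [← integral_add (i1 _) (i1 _)]
    refine integral_mono (integrable_bump_mul _ _ (hv.continuous.norm.pow 2))
      ((i1 _).add (i1 _)) fun y => ?_
    simp only
    rw [← mul_add]
    refine mul_le_mul_of_nonneg_left ?_ (bump_nonneg _ _)
    set p := Δ v y + ((κ ^ 2 : ℝ) : ℂ) * v y with hpdef
    set q := Δ v y + ((-κ ^ 2 : ℝ) : ℂ) * v y with hqdef
    have e2 : 2 * (κ : ℂ) ^ 2 * v y = p - q := by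
      rw [hpdef, hqdef]
      push_cast
      ring
    have e3 : 2 * κ ^ 2 * ‖v y‖ ≤ ‖p‖ + ‖q‖ := by
      have := norm_sub_le p q
      rw [← e2, norm_mul, norm_mul, norm_pow, Complex.norm_real, Real.norm_of_nonneg hκ0.le] at this
      simpa using this
    have e4 : ‖v y‖ ≤ κ ^ 2 * ‖v y‖ :=
      le_mul_of_one_le_left (norm_nonneg _) (one_le_pow₀ hκ)
    nlinarith [norm_nonneg (v y), norm_nonneg p, norm_nonneg q, sq_nonneg (‖p‖ - ‖q‖)]
  obtain ⟨C, hC, hCb⟩ := exists_norm_errProfile_le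
  -- Young's inequality with a free weight `δ` is used in place of Cauchy–Schwarz; `ρ → ∞` is taken
  -- first, then `δ → 0`.
  have hbound : ∀ δ : ℝ, 0 < δ → ∀ ρ : ℝ, 0 < ρ → ‖v x‖ ≤ δ * ((C * κ) ^ 2 * (4 * Real.pi)) +
      1 / δ * ∫ y : E3, bump (‖x‖ + 1) (ρ - ‖y‖) * ‖v y‖ ^ 2 := by
    intro δ hδ ρ hρ
    have i1 : Integrable fun y => ‖errKernel κ ρ y‖ ^ 2 := integrable_sq (isTestFunction_errKernel κ hρ)
    have i2 : Integrable fun y : E3 => bump (‖x‖ + 1) (ρ - ‖x - y‖) * ‖v (x - y)‖ ^ 2 :=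
      (integrable_bump_mul (‖x‖ + 1) ρ (hv.continuous.norm.pow 2)).comp_sub_left x
    have e5 : ∫ y : E3, bump (‖x‖ + 1) (ρ - ‖x - y‖) * ‖v (x - y)‖ ^ 2 =
        ∫ y : E3, bump (‖x‖ + 1) (ρ - ‖y‖) * ‖v y‖ ^ 2 :=
      integral_sub_left_eq_self (fun y : E3 => bump (‖x‖ + 1) (ρ - ‖y‖) * ‖v y‖ ^ 2) volume x
    rw [hrep ρ hρ x, norm_neg, conv_apply]
    refine (norm_integral_le_of_norm_le ((i1.const_mul δ).add (i2.const_mul (1 / δ)))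
      (Eventually.of_forall fun y => ?_)).trans ?_
    · simp only [Pi.add_apply]
      by_cases hy : ‖y‖ ∈ Icc ρ (ρ + 1)
      · rw [bump_of_abs_le, one_mul, norm_mul]
        · have h5 : ‖v (x - y)‖ ^ 2 / δ - 2 * (‖errKernel κ ρ y‖ * ‖v (x - y)‖) +
              δ * ‖errKernel κ ρ y‖ ^ 2 = (‖v (x - y)‖ - δ * ‖errKernel κ ρ y‖) ^ 2 / δ := by
            field_simp
            ring
          have h6 : 0 ≤ (‖v (x - y)‖ - δ * ‖errKernel κ ρ y‖) ^ 2 / δ := by positivity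
          have h7 : 0 ≤ ‖errKernel κ ρ y‖ * ‖v (x - y)‖ := by positivity
          have h8 : 1 / δ * ‖v (x - y)‖ ^ 2 = ‖v (x - y)‖ ^ 2 / δ := by ring
          linarith
        · rw [abs_le]
          have h3 := norm_sub_le x y
          have h4 := norm_sub_norm_le y x
          rw [norm_sub_rev] at h4
          constructor <;> linarith [hy.1, hy.2]
      · rw [errKernel_of_notMem hy, zero_mul, norm_zero]
        have := bump_nonneg (‖x‖ + 1) (ρ - ‖x - y‖)
        positivity
    · simp only [Pi.add_apply]
      rw [integral_add (i1.const_mul δ) (i2.const_mul _), integral_const_mul, integral_const_mul, e5]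
      gcongr
      exact integral_norm_errKernel_sq_le hρ fun r hr => hCb κ hκ ρ r hr
  have hle : ∀ δ : ℝ, 0 < δ → ‖v x‖ ≤ δ * ((C * κ) ^ 2 * (4 * Real.pi)) := fun δ hδ => by
    have h3 := (hlim.const_mul (1 / δ)).const_add (δ * ((C * κ) ^ 2 * (4 * Real.pi)))
    rw [mul_zero, add_zero] at h3
    refine ge_of_tendsto h3 ?_
    filter_upwards [eventually_gt_atTop 0] with ρ hρ using hbound δ hδ ρ hρ
  rw [← norm_le_zero_iff]
  have h4 : Tendsto (fun δ : ℝ => δ * ((C * κ) ^ 2 * (4 * Real.pi))) (𝓝[>] 0) (𝓝 0) := by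
    have : Tendsto (fun δ : ℝ => δ * ((C * κ) ^ 2 * (4 * Real.pi))) (𝓝 0)
        (𝓝 (0 * ((C * κ) ^ 2 * (4 * Real.pi)))) := tendsto_id.mul_const _
    rw [zero_mul] at this
    exact this.mono_left nhdsWithin_le_nhds
  refine ge_of_tendsto h4 ?_
  filter_upwards [self_mem_nhdsWithin] with δ hδ using hle δ hδ

/-- Uniqueness of outgoing solutions of `Δ²w = κ⁴w`. -/
theorem ae_eq_zero_of_outgoing {κ : ℝ} (hκ : 1 ≤ κ) {w : E3 → ℂ} (hw : LocallyIntegrable w)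
    (h : ∀ φ, IsTestFunction univ φ → ∫ x, w x * (Δ (Δ φ) x - (κ : ℂ) ^ 4 * φ x) = 0) {R : ℝ}
    (hwc : ContinuousOn w (Metric.closedBall (0 : E3) R)ᶜ) (h1 : RadiationCondition κ w)
    (h2 : RadiationCondition κ (Δ w)) : w =ᵐ[volume] 0 := by
  obtain ⟨v, hv, hwv, hΔ, hrep⟩ := exists_smooth_version (by linarith) hw h
  have hopen : IsOpen (Metric.closedBall (0 : E3) R)ᶜ := Metric.isClosed_closedBall.isOpen_compl
  have heq : EqOn w v (Metric.closedBall (0 : E3) R)ᶜ :=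
    Measure.eqOn_open_of_ae_eq (ae_restrict_of_ae hwv) hopen hwc hv.continuous.continuousOn
  have hmem : ∀ x : E3, R < ‖x‖ → x ∈ (Metric.closedBall (0 : E3) R)ᶜ := fun x hx => by
    simpa using hx
  have hΔ' : ∀ x : E3, R < ‖x‖ → Δ w x = Δ v x := fun x hx =>
    (InnerProductSpace.laplacian_congr_nhds (by
      filter_upwards [hopen.mem_nhds (hmem x hx)] with y hy using heq hy)).eq_of_nhds
  filter_upwards [hwv] with x hx
  rw [hx]
  exact eq_zero_of_radiationCondition hκ hv hΔ hrep
    (h1.congr fun x hx => heq (hmem x hx)) (h2.congr hΔ') x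

/-! ### The Lippmann–Schwinger equation -/

theorem memLp_potential_mul_conv {V : E3 → ℂ} (hV : MemLp V ∞) {κ : ℝ} (hκ : 0 < κ) (a : ℝ)
    {g : E3 → ℂ} (hg : MemLp g 2) : MemLp (fun x => V x * conv (truncKernel κ a) g x) 2 :=
  MemLp.mul' (p := ∞) (q := 2) (memLp_conv (integrable_truncKernel hκ a) hg) hV

theorem exists_eLpNorm_potential_mul_conv_le {V : E3 → ℂ} (hV : MemLp V ∞) {a : ℝ} (ha : 0 < a) :
    ∃ C₀ : ℝ, 1 ≤ C₀ ∧ ∀ κ : ℝ, C₀ ≤ κ → ∀ g : E3 → ℂ, MemLp g 2 →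
      eLpNorm (fun x => V x * conv (truncKernel κ a) g x) 2 ≤
        ENNReal.ofReal (1 / 2) * eLpNorm g 2 := by
  obtain ⟨C, hC, hCb⟩ := exists_integral_norm_kernel_le a ha
  set A : ℝ := (eLpNorm V ∞ volume).toReal with hA
  have hA0 : 0 ≤ A := ENNReal.toReal_nonneg
  -- This threshold gives both `κ ≥ 1` and `2AC ≤ κ ≤ κ²`, that is `A · C/κ² ≤ 1/2`.
  refine ⟨1 + 2 * A * C, by have := mul_nonneg hA0 hC.le; linarith, fun κ hκ g hg => ?_⟩
  have hAC := mul_nonneg hA0 hC.le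
  have hκ1 : 1 ≤ κ := by linarith
  have hκ0 : 0 < κ := by linarith
  have h1 : eLpNorm (fun x => V x * conv (truncKernel κ a) g x) 2 ≤
      eLpNorm V ∞ * eLpNorm (conv (truncKernel κ a) g) 2 :=
    eLpNorm_smul_le_eLpNorm_top_mul_eLpNorm 2
      (memLp_conv (integrable_truncKernel hκ0 a) hg).aestronglyMeasurable V
  have h2 : eLpNorm (conv (truncKernel κ a) g) 2 ≤ ENNReal.ofReal (C / κ ^ 2) * eLpNorm g 2 :=
    (eLpNorm_conv_le (integrable_truncKernel hκ0 a) hg.aestronglyMeasurable).trans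
      (mul_le_mul_left (ENNReal.ofReal_le_ofReal (hCb κ hκ1).1) _)
  refine h1.trans ((mul_le_mul_right h2 _).trans ?_)
  rw [← mul_assoc, ← ENNReal.ofReal_toReal hV.eLpNorm_ne_top, ← hA, ← ENNReal.ofReal_mul hA0]
  refine mul_le_mul_left (ENNReal.ofReal_le_ofReal ?_) _
  rw [← mul_div_assoc, div_le_div_iff₀ (by positivity) two_pos]
  nlinarith

theorem eLpNorm_eq_zero_of_le_half {X : ℝ≥0∞} (hX : X ≠ ⊤) (h : X ≤ ENNReal.ofReal (1 / 2) * X) :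
    X = 0 := by
  by_contra h0
  have h1 : ENNReal.ofReal (1 / 2) * X < 1 * X :=
    ENNReal.mul_lt_mul_left h0 hX (by rw [ENNReal.ofReal_lt_one]; norm_num)
  rw [one_mul] at h1
  exact absurd h h1.not_ge

theorem potential_mul_conv_sub (V : E3 → ℂ) {κ : ℝ} (hκ : 0 < κ) (a : ℝ) {g g' : E3 → ℂ}
    (hg : MemLp g 2) (hg' : MemLp g' 2) :
    (fun x => V x * conv (truncKernel κ a) g x) - (fun x => V x * conv (truncKernel κ a) g' x) =
      fun x => V x * conv (truncKernel κ a) (g - g') x := by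
  ext x
  rw [conv_sub_right (memLp_truncKernel hκ a 2) hg hg']
  simp only [Pi.sub_apply]
  ring

theorem ae_eq_of_fixedPoint {V f : E3 → ℂ} {κ : ℝ} (hκ : 0 < κ) {a : ℝ}
    (hB : ∀ g : E3 → ℂ, MemLp g 2 → eLpNorm (fun x => V x * conv (truncKernel κ a) g x) 2 ≤
      ENNReal.ofReal (1 / 2) * eLpNorm g 2) {g g' : E3 → ℂ} (hg : MemLp g 2) (hg' : MemLp g' 2)
    (h : g =ᵐ[volume] fun x => f x - V x * conv (truncKernel κ a) g x)
    (h' : g' =ᵐ[volume] fun x => f x - V x * conv (truncKernel κ a) g' x) : g =ᵐ[volume] g' := by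
  have h1 : eLpNorm (g - g') 2 ≤ ENNReal.ofReal (1 / 2) * eLpNorm (g - g') 2 := by
    refine le_trans (le_of_eq ?_) (hB _ (hg.sub hg'))
    rw [← potential_mul_conv_sub V hκ a hg hg', ← eLpNorm_neg]
    refine eLpNorm_congr_ae ?_
    filter_upwards [h, h'] with x hx hx'
    simp only [Pi.neg_apply, Pi.sub_apply]
    rw [hx, hx']
    ring
  have h2 := eLpNorm_eq_zero_of_le_half (hg.sub hg').eLpNorm_ne_top h1
  rw [eLpNorm_eq_zero_iff (hg.sub hg').aestronglyMeasurable two_ne_zero] at h2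
  filter_upwards [h2] with x hx
  exact sub_eq_zero.1 hx

/-- Banach's fixed point theorem in `L²`: the hypothesis makes the affine map a contraction with
ratio `1/2`. The norm bound comes from `X ≤ Y + X/2` with `X` finite. -/
theorem exists_fixedPoint {V f : E3 → ℂ} (hV : MemLp V ∞) (hf : MemLp f 2) {κ : ℝ} (hκ : 0 < κ)
    {a : ℝ} (hB : ∀ g : E3 → ℂ, MemLp g 2 →
      eLpNorm (fun x => V x * conv (truncKernel κ a) g x) 2 ≤
        ENNReal.ofReal (1 / 2) * eLpNorm g 2) :
    ∃ g : E3 → ℂ, MemLp g 2 ∧ (g =ᵐ[volume] fun x => f x - V x * conv (truncKernel κ a) g x) ∧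
      eLpNorm g 2 ≤ 2 * eLpNorm f 2 := by
  have hm : ∀ g : Lp ℂ 2 (volume : Measure E3),
      MemLp (f - fun x => V x * conv (truncKernel κ a) g x) 2 := fun g =>
    hf.sub (memLp_potential_mul_conv hV hκ a (Lp.memLp g))
  let T : Lp ℂ 2 (volume : Measure E3) → Lp ℂ 2 (volume : Measure E3) := fun g => (hm g).toLp
  have hT : ContractingWith (1 / 2) T := by
    refine ⟨by norm_num, fun g g' => ?_⟩
    have e1 : (f - fun x => V x * conv (truncKernel κ a) g x) -
        (f - fun x => V x * conv (truncKernel κ a) g' x) =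
        -(fun x => V x * conv (truncKernel κ a) (g - g' : E3 → ℂ) x) := by
      rw [← potential_mul_conv_sub V hκ a (Lp.memLp g) (Lp.memLp g')]
      abel
    rw [Lp.edist_toLp_toLp, e1, eLpNorm_neg, Lp.edist_def]
    refine (hB _ ((Lp.memLp g).sub (Lp.memLp g'))).trans_eq ?_
    congr 1
    rw [ENNReal.ofReal]
    congr 1
    ext
    simp
  obtain ⟨G, hG⟩ : ∃ G, T G = G := ⟨_, hT.fixedPoint_isFixedPt⟩
  have hGf : (G : E3 → ℂ) =ᵐ[volume] fun x => f x - V x * conv (truncKernel κ a) G x := by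
    have := (hm G).coeFn_toLp
    change (T G : E3 → ℂ) =ᵐ[volume] _ at this
    rwa [hG] at this
  obtain ⟨g, hg⟩ : ∃ g : E3 → ℂ, g = G := ⟨_, rfl⟩
  rw [← hg] at hGf
  have hg2 : MemLp g 2 := hg ▸ Lp.memLp G
  refine ⟨g, hg2, hGf, ?_⟩
  have h1 : eLpNorm g 2 ≤ eLpNorm f 2 + ENNReal.ofReal (1 / 2) * eLpNorm g 2 := by
    rw [eLpNorm_congr_ae hGf]
    refine (eLpNorm_sub_le hf.aestronglyMeasurable
      (memLp_potential_mul_conv hV hκ a hg2).aestronglyMeasurable one_le_two).trans ?_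
    rw [← eLpNorm_congr_ae hGf]
    exact add_le_add_right (hB g hg2) _
  have hX := hg2.eLpNorm_ne_top
  have hY := hf.eLpNorm_ne_top
  rw [← ENNReal.ofReal_toReal hX, ← ENNReal.ofReal_toReal hY] at h1 ⊢
  rw [← ENNReal.ofReal_mul (by norm_num), ← ENNReal.ofReal_add ENNReal.toReal_nonneg (by positivity),
    ENNReal.ofReal_le_ofReal_iff (by positivity)] at h1
  have e : ∀ X : ℝ, (2 : ℝ≥0∞) * ENNReal.ofReal X = ENNReal.ofReal (2 * X) := fun X => by
    rw [ENNReal.ofReal_mul zero_le_two, ENNReal.ofReal_ofNat]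
  rw [e]
  exact ENNReal.ofReal_le_ofReal (by linarith)

theorem indicator_closedBall_ae_eq {f : E3 → ℂ} {R : ℝ}
    (hf : ∀ᵐ x ∂(volume : Measure E3), R < ‖x‖ → f x = 0) :
    (Metric.closedBall (0 : E3) R).indicator f =ᵐ[volume] f := by
  filter_upwards [hf] with x hx
  by_cases h : x ∈ Metric.closedBall (0 : E3) R
  · rw [indicator_of_mem h]
  · rw [indicator_of_notMem h, hx (by simpa using h)]

theorem indicator_closedBall_eq_zero (f : E3 → ℂ) {R : ℝ} (y : E3) (hy : R < ‖y‖) :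
    (Metric.closedBall (0 : E3) R).indicator f y = 0 :=
  indicator_of_notMem (by simpa using hy) f

theorem eLpNorm_restrict_ball {f : E3 → ℂ} {R : ℝ}
    (hf : ∀ᵐ x ∂(volume : Measure E3), R < ‖x‖ → f x = 0) :
    eLpNorm f 2 (volume.restrict (Metric.ball 0 R)) = eLpNorm f 2 := by
  rw [← eLpNorm_indicator_eq_eLpNorm_restrict Metric.isOpen_ball.measurableSet]
  refine eLpNorm_congr_ae ?_
  have hs : ∀ᵐ x ∂(volume : Measure E3), x ∉ Metric.sphere (0 : E3) R :=
    measure_eq_zero_iff_ae_notMem.1 (Measure.addHaar_sphere volume 0 R)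
  filter_upwards [hf, hs] with x hx hx'
  by_cases h : x ∈ Metric.ball (0 : E3) R
  · rw [indicator_of_mem h]
  · rw [indicator_of_notMem h, hx]
    rw [mem_ball_zero_iff, not_lt] at h
    rw [mem_sphere_zero_iff_norm] at hx'
    exact lt_of_le_of_ne h (Ne.symm hx')

theorem MemSobolevLoc.locallyIntegrable {m : ℕ} {u : E3 → ℂ} (h : MemSobolevLoc m u) :
    LocallyIntegrable u := by
  obtain ⟨g, hg, -⟩ := h 0 (by simp [mem_multiIndices, order])
  exact locallyIntegrableOn_univ.1 hg.locInt_left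

/-- The zero multi-index only provides some weak derivative of order zero in `L²`; testing shows
that it coincides with `u` almost everywhere. -/
theorem MemSobolevLoc.memLp {m : ℕ} {u : E3 → ℂ} (h : MemSobolevLoc m u) {ρ : ℝ} (hρ : 0 < ρ) :
    MemLp u 2 (volume.restrict (Metric.ball (0 : E3) ρ)) := by
  obtain ⟨g, hg, hg2⟩ := h 0 (by simp [mem_multiIndices, order])
  have hu := locallyIntegrableOn_univ.1 hg.locInt_left
  have hgl := locallyIntegrableOn_univ.1 hg.locInt_right
  have h0 : (fun x => g x - u x) =ᵐ[volume] 0 := by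
    refine ae_eq_zero_of_integral_mul_test (hgl.sub hu) fun φ hφ => ?_
    have := hg.integral_eq φ hφ
    simp only [Measure.restrict_univ, order, multiDeriv, Pi.zero_apply, Function.iterate_zero, id,
      Finset.sum_const_zero, pow_zero, one_mul] at this
    simp only [sub_mul]
    rw [integral_sub (integrable_mul_test hgl hφ) (integrable_mul_test hu hφ), this, sub_self]
  refine (hg2 ρ hρ).ae_eq (ae_restrict_of_ae ?_)
  filter_upwards [h0] with x hx
  exact sub_eq_zero.1 hx

theorem memLp_potential_mul {V v : E3 → ℂ} (hV : MemLp V ∞) {R : ℝ} (hR : 0 < R)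
    (hVs : ∀ᵐ x ∂(volume : Measure E3), R < ‖x‖ → V x = 0) {m : ℕ} (hv : MemSobolevLoc m v) :
    MemLp (fun x => V x * v x) 2 := by
  have h1 : MemLp ((Metric.ball (0 : E3) (R + 1)).indicator v) 2 :=
    (memLp_indicator_iff_restrict Metric.isOpen_ball.measurableSet).2
      (hv.memLp (by positivity))
  have h2 : MemLp (fun x => V x * (Metric.ball (0 : E3) (R + 1)).indicator v x) 2 :=
    MemLp.mul' (p := ∞) (q := 2) h1 hV
  refine h2.ae_eq ?_
  filter_upwards [hVs] with x hx
  by_cases h : x ∈ Metric.ball (0 : E3) (R + 1)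
  · rw [indicator_of_mem h]
  · rw [mem_ball_zero_iff, not_lt] at h
    rw [hx (by linarith), zero_mul, zero_mul]

theorem integral_mul_bilaplacian_sub {V v : E3 → ℂ} {κ : ℝ} (hv : LocallyIntegrable v)
    (hVv : LocallyIntegrable fun x => V x * v x) {φ : E3 → ℂ}
    (hφ : IsTestFunction univ φ) :
    ∫ x, (v x * Δ (Δ φ) x + (V x * v x - (κ : ℂ) ^ 4 * v x) * φ x) =
      (∫ x, v x * (Δ (Δ φ) x - (κ : ℂ) ^ 4 * φ x)) + ∫ x, V x * v x * φ x := by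
  rw [← integral_add (integrable_mul_test hv (isTestFunction_bilaplacian_sub hφ _))
    (integrable_mul_test hVv hφ)]
  congr 1 with x
  ring

theorem differentiableAt_laplacian {w : E3 → ℂ} {x : E3} (hw : ContDiffAt ℝ 3 w x) :
    DifferentiableAt ℝ (Δ w) x := by
  have hev : Δ w =ᶠ[𝓝 x] fun y => ∑ i, partialDeriv i (partialDeriv i w) y := by
    have h2 : ContDiffAt ℝ 2 w x := hw.of_le (by norm_num)
    filter_upwards [h2.eventually (by simp)] with y hy using laplacian_apply_of_contDiffAt hy
  refine DifferentiableAt.congr_of_eventuallyEq ?_ hev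
  refine DifferentiableAt.fun_sum fun i _ => ?_
  have h1 : ContDiffAt ℝ 2 (partialDeriv i w) x :=
    (hw.fderiv_right (m := 2) (by norm_num)).clm_apply contDiffAt_const
  have h2 : ContDiffAt ℝ 1 (partialDeriv i (partialDeriv i w)) x :=
    (h1.fderiv_right (m := 1) (by norm_num)).clm_apply contDiffAt_const
  exact h2.differentiableAt (by norm_num)

/-- A scattering solution is the potential of its source `f - V v`. -/
theorem IsScatteringSolution.ae_eq_conv {R : ℝ} (hR : 0 < R) {V f v : E3 → ℂ} {κ : ℝ}
    (hκ : 1 ≤ κ) (hf : MemLp f 2) (hVv : MemLp (fun x => V x * v x) 2)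
    (h : IsScatteringSolution R V κ f v) {g : E3 → ℂ} (hg2 : MemLp g 2)
    (hg : ∀ y, R < ‖y‖ → g y = 0) (hgf : g =ᵐ[volume] fun x => f x - V x * v x) :
    v =ᵐ[volume] conv (bihKernel κ) g := by
  have hκ0 : 0 < κ := by linarith
  have hgi := integrable_of_memLp_two hg2 hg
  have hvl := h.memSobolevLoc.locallyIntegrable
  have hul := (memSobolevLoc_conv_bihKernel hκ hR hg2 hg).locallyIntegrable
  have hVvl := hVv.locallyIntegrable one_le_two
  have hfl := hf.locallyIntegrable one_le_two
  have hopen : IsOpen (Metric.closedBall (0 : E3) R)ᶜ := Metric.isClosed_closedBall.isOpen_compl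
  have hmem : ∀ x : E3, R < ‖x‖ → (Metric.closedBall (0 : E3) R)ᶜ ∈ 𝓝 x := fun x hx =>
    hopen.mem_nhds (by simpa using hx)
  have hu3 : ContDiffOn ℝ 3 (conv (bihKernel κ) g) (Metric.closedBall (0 : E3) R)ᶜ :=
    (contDiffOn_conv_bihKernel κ hgi hg).of_le (WithTop.coe_le_coe.2 le_top)
  have hv3' := fun x hx => h.regular.contDiffAt (hmem x hx)
  have hu3' := fun x hx => hu3.contDiffAt (hmem x hx)
  obtain ⟨hr1, hr2⟩ := radiationCondition_conv_bihKernel hκ0 hR.le hgi hg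
  have hw : (fun x => v x - conv (bihKernel κ) g x) =ᵐ[volume] 0 := by
    refine ae_eq_zero_of_outgoing hκ (hvl.sub hul) (fun φ hφ => ?_)
      (h.regular.continuousOn.sub hu3.continuousOn) ?_ ?_
    · have hψ := isTestFunction_bilaplacian_sub hφ ((κ : ℂ) ^ 4)
      have h1 := h.equation φ hφ
      rw [integral_mul_bilaplacian_sub hvl hVvl hφ] at h1
      have h2 : ∫ x, g x * φ x = (∫ x, f x * φ x) - ∫ x, V x * v x * φ x := by
        rw [← integral_sub (integrable_mul_test hfl hφ) (integrable_mul_test hVvl hφ)]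
        refine integral_congr_ae ?_
        filter_upwards [hgf] with x hx
        rw [hx]
        ring
      simp only [sub_mul]
      rw [integral_sub (integrable_mul_test hvl hψ) (integrable_mul_test hul hψ),
        integral_conv_bihKernel_mul hκ0 hgi hφ, h2, ← h1]
      ring
    · have := h.radiation.linear hr1 (fun x hx => (hv3' x hx).differentiableAt (by norm_num))
        (fun x hx => (hu3' x hx).differentiableAt (by norm_num)) 1 (-1)
      refine this.congr (ρ := R) fun x _ => ?_
      ring
    · have := h.radiation_laplacian.linear hr2
        (fun x hx => differentiableAt_laplacian (hv3' x hx))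
        (fun x hx => differentiableAt_laplacian (hu3' x hx)) 1 (-1)
      refine this.congr (ρ := R) fun x hx => ?_
      have := ((hv3' x hx).of_le (m := 2) (by norm_num)).laplacian_sub
        ((hu3' x hx).of_le (m := 2) (by norm_num))
      rw [one_mul, neg_one_mul, ← sub_eq_add_neg]
      exact this.symm
  filter_upwards [hw] with x hx
  exact sub_eq_zero.1 hx

/-- The factor `V` restricts `x` to the closed ball, where the truncated and the full kernel give
the same potential. The contraction for `K` thus solves the equation for `Φ`. -/
theorem potential_mul_conv_ae_eq {V : E3 → ℂ} {R : ℝ}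
    (hVs : ∀ᵐ x ∂(volume : Measure E3), R < ‖x‖ → V x = 0) {κ : ℝ} {g : E3 → ℂ}
    (hg : ∀ y, R < ‖y‖ → g y = 0) :
    (fun x => V x * conv (bihKernel κ) g x) =ᵐ[volume]
      fun x => V x * conv (truncKernel κ (2 * R)) g x := by
  filter_upwards [hVs] with x hx
  rcases lt_or_ge R ‖x‖ with h | h
  · rw [hx h, zero_mul, zero_mul]
  · rw [conv_bihKernel_eq_truncKernel hg h]

theorem isScatteringSolution_conv {R : ℝ} (hR : 0 < R) {V f g : E3 → ℂ} {κ : ℝ} (hκ : 1 ≤ κ)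
    (hV : MemLp V ∞) (hVs : ∀ᵐ x ∂(volume : Measure E3), R < ‖x‖ → V x = 0)
    (hg2 : MemLp g 2) (hg : ∀ y, R < ‖y‖ → g y = 0)
    (hgf : g =ᵐ[volume] fun x => f x - V x * conv (bihKernel κ) g x) :
    IsScatteringSolution R V κ f (conv (bihKernel κ) g) := by
  have hκ0 : 0 < κ := by linarith
  have hgi := integrable_of_memLp_two hg2 hg
  have hu := memSobolevLoc_conv_bihKernel hκ hR hg2 hg
  have hVu := (memLp_potential_mul hV hR hVs hu).locallyIntegrable one_le_two
  obtain ⟨hr1, hr2⟩ := radiationCondition_conv_bihKernel hκ0 hR.le hgi hg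
  refine ⟨hu, fun φ hφ => ?_,
    (contDiffOn_conv_bihKernel κ hgi hg).of_le (WithTop.coe_le_coe.2 le_top), hr1, hr2⟩
  rw [integral_mul_bilaplacian_sub hu.locallyIntegrable hVu hφ,
    integral_conv_bihKernel_mul hκ0 hgi hφ, ← integral_add
    (integrable_mul_test hgi.locallyIntegrable hφ) (integrable_mul_test hVu hφ)]
  refine integral_congr_ae ?_
  filter_upwards [hgf] with x hx
  rw [← add_mul, hx]
  ring

end Biharmonic

/-! ### Existence, uniqueness and the resolvent estimate -/

theorem mainTheorem11 (R : ℝ) (hR : 0 < R) (V : Biharmonic.E3 → ℂ)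
    (hV : MemLp V ∞ volume)
    (hVsupp : ∀ᵐ x ∂(volume : Measure Biharmonic.E3), R < ‖x‖ → V x = 0) :
    ∃ C₀ C : ℝ, 0 < C₀ ∧ 0 < C ∧
      ∀ κ : ℝ, C₀ ≤ κ → ∀ f : Biharmonic.E3 → ℂ, MemLp f 2 volume →
        (∀ᵐ x ∂(volume : Measure Biharmonic.E3), R < ‖x‖ → f x = 0) →
        ∃ u : Biharmonic.E3 → ℂ,
          Biharmonic.IsScatteringSolution R V κ f u ∧
          (∀ v : Biharmonic.E3 → ℂ,
            Biharmonic.IsScatteringSolution R V κ f v → v =ᵐ[volume] u) ∧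
          Biharmonic.MemSobolev 4 (Metric.ball 0 R) u ∧
          Biharmonic.sobolevNorm 4 (Metric.ball 0 R) u ≤
            ENNReal.ofReal (C * κ ^ 2) *
              eLpNorm f 2 (volume.restrict (Metric.ball 0 R)) := by
  -- The truncation radius `2R` is the diameter of the ball, hence the largest distance between a
  -- source point and a point where `V` acts.
  obtain ⟨C₀, hC₀, hB⟩ := Biharmonic.exists_eLpNorm_potential_mul_conv_le hV
    (a := 2 * R) (by positivity)
  obtain ⟨C, hC, hS⟩ := Biharmonic.exists_sobolevNorm_conv_bihKernel_le hR
  -- The factor `2` is the price of passing from `f` to the effective source, whose norm is at most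
  -- `2‖f‖`.
  refine ⟨C₀, C * 2, by linarith, by positivity, fun κ hκ f hf hfs => ?_⟩
  have hκ1 : 1 ≤ κ := hC₀.trans hκ
  have hκ0 : 0 < κ := by linarith
  have hm : MeasurableSet (Metric.closedBall (0 : Biharmonic.E3) R) :=
    Metric.isClosed_closedBall.measurableSet
  obtain ⟨g₀, hg₀, hg₀f, hg₀n⟩ := Biharmonic.exists_fixedPoint hV hf hκ0 (hB κ hκ)
  have hg₀s : ∀ᵐ x ∂(volume : Measure Biharmonic.E3), R < ‖x‖ → g₀ x = 0 := by
    filter_upwards [hg₀f, hfs, hVsupp] with x h1 h2 h3 hx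
    rw [h1, h2 hx, h3 hx, zero_mul, sub_zero]
  have hgg := Biharmonic.indicator_closedBall_ae_eq hg₀s
  -- The fixed point vanishes outside the ball only almost everywhere, whereas the results on
  -- potentials ask for it pointwise.
  set g := (Metric.closedBall (0 : Biharmonic.E3) R).indicator g₀ with hgdef
  have hg0 : ∀ y, R < ‖y‖ → g y = 0 := Biharmonic.indicator_closedBall_eq_zero g₀
  have hg2 : MemLp g 2 := hg₀.indicator hm
  have hgf : g =ᵐ[volume] fun x => f x - V x * Biharmonic.conv (Biharmonic.bihKernel κ) g x := by
    filter_upwards [hgg, hg₀f, Biharmonic.potential_mul_conv_ae_eq (κ := κ) hVsupp hg0]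
      with x h1 h2 h3
    rw [h3, Biharmonic.conv_congr_ae hgg, h1]
    exact h2
  refine ⟨Biharmonic.conv (Biharmonic.bihKernel κ) g,
    Biharmonic.isScatteringSolution_conv hR hκ1 hV hVsupp hg2 hg0 hgf, fun v hv => ?_,
    (hS κ hκ1 g hg2 hg0).1, (hS κ hκ1 g hg2 hg0).2.trans ?_⟩
  -- Any solution `v` is the potential of its own effective source `f - Vv`. That source therefore
  -- solves the same fixed-point equation and agrees with the one constructed.
  · have hVv := Biharmonic.memLp_potential_mul hV hR hVsupp hv.memSobolevLoc
    have hh₀ : MemLp (fun x => f x - V x * v x) 2 := hf.sub hVv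
    have hh₀s : ∀ᵐ x ∂(volume : Measure Biharmonic.E3), R < ‖x‖ → f x - V x * v x = 0 := by
      filter_upwards [hfs, hVsupp] with x h2 h3 hx
      rw [h2 hx, h3 hx, zero_mul, sub_zero]
    have hhh := Biharmonic.indicator_closedBall_ae_eq hh₀s
    set h := (Metric.closedBall (0 : Biharmonic.E3) R).indicator
      (fun x => f x - V x * v x) with hdef
    have hh0 : ∀ y, R < ‖y‖ → h y = 0 := Biharmonic.indicator_closedBall_eq_zero _
    have hh2 : MemLp h 2 := hh₀.indicator hm
    have hvc := hv.ae_eq_conv hR hκ1 hf hVv hh2 hh0 hhh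
    have hfix : h =ᵐ[volume]
        fun x => f x - V x * Biharmonic.conv (Biharmonic.truncKernel κ (2 * R)) h x := by
      filter_upwards [hhh, hvc, Biharmonic.potential_mul_conv_ae_eq (κ := κ) hVsupp hh0]
        with x h1 h2 h3
      rw [← h3, h1, h2]
    have hhg := Biharmonic.ae_eq_of_fixedPoint hκ0 (hB κ hκ) hh2 hg₀ hfix hg₀f
    rw [Biharmonic.conv_congr_ae hgg, ← Biharmonic.conv_congr_ae hhg]
    exact hvc
  · have e : ENNReal.ofReal (C * 2 * κ ^ 2) = ENNReal.ofReal (C * κ ^ 2) * 2 := by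
      rw [mul_right_comm, ENNReal.ofReal_mul (by positivity), ENNReal.ofReal_ofNat]
    rw [Biharmonic.eLpNorm_restrict_ball hfs, eLpNorm_congr_ae hgg, e, mul_assoc]
    exact mul_le_mul_right hg₀n _
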